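/- Fix $d\in\mathbb N$, $r\in\mathbb N$ with $r\ge1$, $\varepsilon>0$, $m>0$, and put $L=\varepsilon r$, $\varepsilon_N=2^{-N}\varepsilon$, $r_N=2^Nr$, $\Lambda_N=\varepsilon_N\{-r_N,\dots,r_N-1\}^d$ for $N\in\mathbb N_0$. For a complex inner product space $\mathfrak h$ (inner product conjugate-linear in the first argument) let $\sigma(\xi,\eta)=\operatorname{Im}\langle\xi,\eta\rangle$. The Weyl algebra $\mathcal W(\mathfrak h)$ is the (unique up to isomorphism) nonzero unital $C^*$-algebra generated by elements $W(\xi)$, $\xi\in\mathfrak h$, with $W(0)=1$, $W(\xi)^*=W(-\xi)$ and $W(\xi)W(\eta)=e^{-\frac i2\sigma(\xi,\eta)}W(\xi+\eta)$. A map between such spaces is symplectic if it is real linear and preserves $\sigma$. *Scaling function.* Let $\phi\in L^2(\mathbb R^d)$ be real-valued and compactly supported with $\int\phi=1$ and $\int\phi(x)\phi(x-k)\,dx=\delta_{k,0}$ for $k\in\mathbb Z^d$, and let $(h_n)_{n\in\mathbb Z^d}$ be a finite family of real numbers with the scaling equation $\phi(x)=\sum_n h_n2^{d/2}\phi(2x-n)$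 for a.e. $x$. Assume that either $\phi\in H^{1/2}(\mathbb R^d)$, or $h_n=\prod_{j=1}^d g_{n_j}$ where $g$ is a Daubechies filter of some order $K\ge2$, i.e. $g$ is real, supported in $\{0,\dots,2K-1\}$, $\sum_n g_n=\sqrt2$ and $\frac12\bigl|\sum_n g_ne^{-in\theta}\bigr|^2=\cos^{2K}(\theta/2)\sum_{k<K}\binom{K-1+k}{k}\sin^{2k}(\theta/2)$ for all real $\theta$. For $x\in\Lambda_N$ let $\phi^{(\varepsilon_N)}_x$ be the $2L$-periodization of $y\mapsto\varepsilon_N^{-d/2}\phi((y-x)/\varepsilon_N)$, a function on $\mathbb T^d_L=[-L,L)^d$. *Lattice.* Let $\mathfrak h_{N,L}=\ell^2(\Lambda_N)$ with $\langle\xi,\eta\rangle=\sum_x\overline{\xi(x)}\eta(x)$; write $\xi=\varepsilon_N^{(d+1)/2}q+i\varepsilon_N^{(d-1)/2}p$ with $q,p$ real-valued, and let $\mathcal W_{N,L}=\mathcal W(\mathfrak h_{N,L})$ with generators $W_N(\xi)$. The scaling map $R^N_{N+1}:\mathfrak h_{N,L}\to\mathfrak h_{N+1,L}$ is $$R^N_{N+1}(q,p)(x)=2^{d/2}\sum_{x'\in\Lambda_N}(q,p)(x')\sum_n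 h_n\,\delta_{x'+n\varepsilon_{N+1}}(x),\qquad x\in\Lambda_{N+1},$$ with indices of $\delta$ taken modulo $2L\mathbb Z^d$. *Continuum.* Let $\gamma_m(k)=(k^2+m^2)^{1/2}$ and $\hat f(k)=\int_{[-L,L)^d}f(x)e^{-ik\cdot x}dx$ for $k\in\frac\pi L\mathbb Z^d$. Let $\mathfrak h_L$ be the completion of the smooth functions $\xi=q_\xi+ip_\xi$ on $\mathbb T^d_L$ for $$\langle\xi,\eta\rangle_L=(2L)^{-d}\sum_{k}\overline{\bigl(\gamma_m^{-1/2}\hat q_\xi+i\gamma_m^{1/2}\hat p_\xi\bigr)(k)}\,\bigl(\gamma_m^{-1/2}\hat q_\eta+i\gamma_m^{1/2}\hat p_\eta\bigr)(k),$$ with complex structure $q+ip\mapsto-\gamma_mp+i\gamma_m^{-1}q$, identified with $\ell^2(\mathbb Z^d)$ through $\xi\mapsto(2L)^{-d/2}(\gamma_m^{-1/2}\hat q_\xi+i\gamma_m^{1/2}\hat p_\xi)$; let $W_{\mathrm{ct}}(\xi)$ be the generators of $\mathcal W(\mathfrak h_L)$. For $\xi\in\mathfrak h_{N,L}$ put $$R^N_\infty(\xi)(y)=\varepsilon_N^{d/2}\sum_{x\in\Lambda_N}(q(x)+ip(x))\,\phi^{(\varepsilon_N)}_x(y).$$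 **Proposition.** (1) Each $R^N_{N+1}$ is symplectic. (2) $R^N_\infty(\xi)\in\mathfrak h_L$ for all $N$ and $\xi\in\mathfrak h_{N,L}$, and $R^N_\infty:\mathfrak h_{N,L}\to\mathfrak h_L$ is symplectic. (3) $R^{N+1}_\infty\circ R^N_{N+1}=R^N_\infty$. (4) There are injective unital $*$-homomorphisms $\alpha^N_{N+1}:\mathcal W_{N,L}\to\mathcal W_{N+1,L}$ with $\alpha^N_{N+1}(W_N(\xi))=W_{N+1}(R^N_{N+1}\xi)$. This system has a $C^*$-inductive limit, and for every inductive limit $\mathcal W_{\infty,L}$ of it (a unital $C^*$-algebra with compatible injective unital $*$-homomorphisms $\alpha^N_\infty:\mathcal W_{N,L}\to\mathcal W_{\infty,L}$ whose ranges have dense union) there is an injective $*$-homomorphism $\beta_L:\mathcal W_{\infty,L}\to\mathcal W(\mathfrak h_L)$ such that $$\beta_L\bigl(\alpha^N_\infty(W_N(\xi))\bigr)=W_{\mathrm{ct}}(R^N_\infty(\xi)),\qquad N\in\mathbb N_0,\ \xi\in\mathfrak h_{N,L}.$$ -/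

import Mathlib

open MeasureTheory

universe u v w

noncomputable section

/-! ### Weyl algebras -/

/-- The canonical symplectic form `σ(ξ, η) = Im ⟨ξ, η⟩` of a complex inner product space
(the inner product is conjugate linear in its first argument). -/
def sympForm {V : Type*} [NormedAddCommGroup V] [InnerProductSpace ℂ V] (ξ η : V) : ℝ :=
  (inner ℂ ξ η).im

/-- `A`, with the elements `W ξ`, is the Weyl algebra of `(V, σ)`: a nonzero unital C*-algebra that
is generated, as a C*-algebra, by unitaries `W ξ` which satisfy the canonical commutation relations
`W ξ * W η = exp (-i σ(ξ, η) / 2) W (ξ + η)`. -/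
structure IsWeylAlgebra {V A : Type*} [NormedAddCommGroup V] [InnerProductSpace ℂ V]
    [CStarAlgebra A] (W : V → A) : Prop where
  nontrivial : Nontrivial A
  map_zero : W 0 = 1
  star_map : ∀ ξ, star (W ξ) = W (-ξ)
  ccr : ∀ ξ η, W ξ * W η =
    Complex.exp (-(Complex.I / 2) * (sympForm ξ η : ℂ)) • W (ξ + η)
  generates : (StarAlgebra.adjoin ℂ (Set.range W)).topologicalClosure = ⊤

/-- Symplectic maps: real linear maps that preserve `σ`. -/
structure IsSymplecticMap {V V' : Type*} [NormedAddCommGroup V] [InnerProductSpace ℂ V]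
    [NormedAddCommGroup V'] [InnerProductSpace ℂ V'] (R : V → V') : Prop where
  map_add : ∀ ξ η, R (ξ + η) = R ξ + R η
  map_real_smul : ∀ (t : ℝ) (ξ : V), R ((t : ℂ) • ξ) = (t : ℂ) • R ξ
  preserves : ∀ ξ η, sympForm (R ξ) (R η) = sympForm ξ η

/-- `C` with the maps `ι N : A N → C` is the C*-inductive limit of the sequence
`A 0 → A 1 → A 2 → ⋯` of unital C*-algebras with injective connecting maps `α N`. -/
structure IsCStarInductiveLimit {A : ℕ → Type*} [∀ N, CStarAlgebra (A N)]
    (α : ∀ N, A N →⋆ₐ[ℂ] A (N + 1)) {C : Type*} [CStarAlgebra C]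
    (ι : ∀ N, A N →⋆ₐ[ℂ] C) : Prop where
  compatible : ∀ N a, ι (N + 1) (α N a) = ι N a
  injective : ∀ N, Function.Injective (ι N)
  dense : Dense (⋃ N, Set.range (ι N))

/-! ### Existence of the Weyl algebra -/

section Existence

variable {V : Type*} [NormedAddCommGroup V] [InnerProductSpace ℂ V]

lemma sympForm_add_left (ξ η ζ : V) : sympForm (ξ + η) ζ = sympForm ξ ζ + sympForm η ζ := by
  simp [sympForm]

lemma sympForm_sub_right (ξ η ζ : V) : sympForm ξ (η - ζ) = sympForm ξ η - sympForm ξ ζ := by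
  simp [sympForm]

lemma sympForm_neg_left (ξ η : V) : sympForm (-ξ) η = -sympForm ξ η := by
  simp [sympForm]

lemma sympForm_swap (ξ η : V) : sympForm ξ η = -sympForm η ξ := by
  unfold sympForm; rw [← inner_conj_symm, Complex.conj_im]

lemma sympForm_self (ξ : V) : sympForm ξ ξ = 0 := by
  have := sympForm_swap ξ ξ; linarith

/-- The phase `exp (-i σ(ξ, η) / 2)`. -/
def weylPhase (ξ η : V) : ℂ := Complex.exp (-(Complex.I / 2) * (sympForm ξ η : ℂ))

lemma norm_weylPhase (ξ η : V) : ‖weylPhase ξ η‖ = 1 := by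
  rw [weylPhase, show -(Complex.I / 2) * (sympForm ξ η : ℂ) =
    ((-(sympForm ξ η) / 2 : ℝ) : ℂ) * Complex.I by push_cast; ring]
  exact Complex.norm_exp_ofReal_mul_I _

lemma norm_rpow_shift (ξ : V) (f : V → ℂ) :
    (fun η => ‖weylPhase ξ η * f (η - ξ)‖ ^ (2 : ENNReal).toReal) =
      (fun η => ‖f η‖ ^ (2 : ENNReal).toReal) ∘ Equiv.subRight ξ := by
  funext η; simp [norm_weylPhase]

/-- The regular Weyl operator `f ↦ exp (-i σ(ξ, ·) / 2) f (· - ξ)` on `ℓ²(V)`. -/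
def weylShift (ξ : V) : lp (fun _ : V => ℂ) 2 →ₗᵢ[ℂ] lp (fun _ : V => ℂ) 2 where
  toFun f := ⟨fun η => weylPhase ξ η * f (η - ξ), by
    have hf := (memℓp_gen_iff (by norm_num)).1 (lp.memℓp f)
    refine (memℓp_gen_iff (by norm_num)).2 ?_
    rw [norm_rpow_shift]
    exact (Equiv.summable_iff (Equiv.subRight ξ)).2 hf⟩
  map_add' f g := by
    ext η
    exact mul_add _ _ _
  map_smul' c f := by ext η; simp [mul_left_comm]
  norm_map' f := by
    rw [lp.norm_eq_tsum_rpow (by norm_num), lp.norm_eq_tsum_rpow (by norm_num)]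
    congr 1
    simp only [LinearMap.coe_mk, AddHom.coe_mk]
    rw [norm_rpow_shift]
    exact Equiv.tsum_eq (Equiv.subRight ξ) fun η => ‖f η‖ ^ (2 : ENNReal).toReal

lemma weylShift_apply (ξ : V) (f : lp (fun _ : V => ℂ) 2) (η : V) :
    weylShift ξ f η = weylPhase ξ η * f (η - ξ) := rfl

lemma weylShift_ccr (ξ η : V) (f : lp (fun _ : V => ℂ) 2) :
    weylShift ξ (weylShift η f) = weylPhase ξ η • weylShift (ξ + η) f := by
  ext ζ
  rw [lp.coeFn_smul, Pi.smul_apply, smul_eq_mul, weylShift_apply, weylShift_apply,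
    weylShift_apply, ← mul_assoc, ← mul_assoc, sub_sub]
  congr 1
  unfold weylPhase
  rw [← Complex.exp_add, ← Complex.exp_add]
  congr 1
  rw [sympForm_sub_right, sympForm_add_left, sympForm_swap η ξ]
  push_cast; ring

lemma weylShift_zero (f : lp (fun _ : V => ℂ) 2) : weylShift (0 : V) f = f := by
  ext ζ
  simp [weylShift_apply, weylPhase, sympForm]

lemma weylShift_neg (ξ : V) (f : lp (fun _ : V => ℂ) 2) :
    weylShift ξ (weylShift (-ξ) f) = f ∧ weylShift (-ξ) (weylShift ξ f) = f := by
  rw [weylShift_ccr, weylShift_ccr]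
  have h : sympForm ξ (-ξ) = 0 := by
    rw [sympForm_swap, sympForm_neg_left, sympForm_self]; simp
  constructor
  · rw [add_neg_cancel, weylShift_zero, weylPhase, h]; simp
  · rw [neg_add_cancel, weylShift_zero, weylPhase, sympForm_neg_left, sympForm_self]; simp

/-- `weylShift ξ` as a unitary equivalence. -/
def weylShiftEquiv (ξ : V) : lp (fun _ : V => ℂ) 2 ≃ₗᵢ[ℂ] lp (fun _ : V => ℂ) 2 where
  __ := weylShift ξ
  invFun := weylShift (-ξ)
  left_inv f := (weylShift_neg ξ f).2
  right_inv f := (weylShift_neg ξ f).1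
  norm_map' := (weylShift ξ).norm_map

/-- `weylShift ξ` as a bounded operator. -/
def weylOp (ξ : V) : lp (fun _ : V => ℂ) 2 →L[ℂ] lp (fun _ : V => ℂ) 2 :=
  (weylShiftEquiv ξ).toContinuousLinearEquiv.toContinuousLinearMap

/-- The concrete Weyl algebra: the C*-algebra generated by the operators `weylOp ξ`. -/
def weylSubalgebra (V : Type*) [NormedAddCommGroup V] [InnerProductSpace ℂ V] :
    StarSubalgebra ℂ (lp (fun _ : V => ℂ) 2 →L[ℂ] lp (fun _ : V => ℂ) 2) :=
  (StarAlgebra.adjoin ℂ (Set.range (weylOp (V := V)))).topologicalClosure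

instance : IsClosed (weylSubalgebra V : Set (lp (fun _ : V => ℂ) 2 →L[ℂ] lp (fun _ : V => ℂ) 2)) :=
  StarSubalgebra.isClosed_topologicalClosure _

/-- The generators of the concrete Weyl algebra. -/
def weylElt (ξ : V) : weylSubalgebra V :=
  ⟨weylOp ξ, StarSubalgebra.le_topologicalClosure _
    (StarAlgebra.subset_adjoin ℂ _ (Set.mem_range_self ξ))⟩

/-- Weyl algebras exist. -/
theorem isWeylAlgebra_weylElt : IsWeylAlgebra (weylElt (V := V)) where
  nontrivial := by
    classical
    refine ⟨0, 1, fun h => ?_⟩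
    have h1 := congrArg (fun T : weylSubalgebra V =>
      (T : lp (fun _ : V => ℂ) 2 →L[ℂ] lp (fun _ : V => ℂ) 2) (lp.single 2 0 1) 0) h
    simp at h1
  map_zero := by
    apply Subtype.ext
    ext1 f
    exact weylShift_zero f
  star_map ξ := by
    apply Subtype.ext
    exact (weylShiftEquiv ξ).star_eq_symm
  ccr ξ η := by
    apply Subtype.ext
    ext1 f
    exact weylShift_ccr ξ η f
  generates := by
    rw [eq_top_iff]
    intro T _
    have hsub : StarAlgebra.adjoin ℂ (Set.range (weylOp (V := V))) =
        (StarAlgebra.adjoin ℂ (Set.range (weylElt (V := V)))).map (weylSubalgebra V).subtype := by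
      rw [StarAlgHom.map_adjoin]
      congr 1
      ext S
      simp [weylElt]
    have hT : (T : lp (fun _ : V => ℂ) 2 →L[ℂ] lp (fun _ : V => ℂ) 2) ∈
        closure (StarAlgebra.adjoin ℂ (Set.range (weylOp (V := V))) : Set _) := T.2
    rw [← SetLike.mem_coe, StarSubalgebra.topologicalClosure_coe, closure_subtype]
    rw [hsub] at hT
    exact hT

end Existence

/-! ### Lattice one-particle spaces -/

/-- The lattice spacing `ε_N = 2^{-N} ε`. -/
def spacing (ε : ℝ) (N : ℕ) : ℝ := ε / 2 ^ N

/-- The sites of the lattice `Λ_N = ε_N {-r_N, …, r_N - 1}^d`, `r_N = 2^N r`, in units of the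
spacing: the index `z` stands for the point `x = ε_N z`. -/
abbrev LatticeSite (d r N : ℕ) : Type :=
  Fin d → Finset.Ico (-(2 ^ N * r : ℤ)) (2 ^ N * r : ℤ)

/-- The lattice one-particle space `ℓ²(Λ_N)`, with `⟨ξ, η⟩ = ∑ x, conj (ξ x) * η x`. -/
abbrev LatticeSpace (d r N : ℕ) : Type := EuclideanSpace ℂ (LatticeSite d r N)

/-- The field part `q = ε_N^{-(d+1)/2} Re ξ`. -/
def fieldPart {d r : ℕ} (ε : ℝ) {N : ℕ} (ξ : LatticeSpace d r N) (x : LatticeSite d r N) : ℝ :=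
  spacing ε N ^ (-((d : ℝ) + 1) / 2) * (ξ x).re

/-- The momentum part `p = ε_N^{-(d-1)/2} Im ξ`. -/
def momentumPart {d r : ℕ} (ε : ℝ) {N : ℕ} (ξ : LatticeSpace d r N) (x : LatticeSite d r N) : ℝ :=
  spacing ε N ^ ((1 - (d : ℝ)) / 2) * (ξ x).im

/-- The vector `ξ = ε_N^{(d+1)/2} q + i ε_N^{(d-1)/2} p`. -/
def ofFieldMomentum {d r : ℕ} (ε : ℝ) {N : ℕ} (q p : LatticeSite d r N → ℝ) :
    LatticeSpace d r N :=
  WithLp.toLp 2 fun x =>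
    ((spacing ε N ^ (((d : ℝ) + 1) / 2) * q x : ℝ) : ℂ) +
      Complex.I * ((spacing ε N ^ (((d : ℝ) - 1) / 2) * p x : ℝ) : ℂ)

/-- The lattice scaling map on real functions,
`(R q)(x) = 2^{d/2} ∑_{x' ∈ Λ_N} q(x') ∑_n h_n δ_{x' + n ε_{N+1}}(x)` for `x ∈ Λ_{N+1}`, where the
index of `δ` is read modulo `2 r_{N+1} ε_{N+1} ℤ^d`. (In units of `ε_{N+1}` the point `x'` of `Λ_N`
has the coordinates `2 x'`.) -/
def scaleFun {d r : ℕ} (h : (Fin d → ℤ) →₀ ℝ) {N : ℕ} (q : LatticeSite d r N → ℝ)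
    (x : LatticeSite d r (N + 1)) : ℝ :=
  2 ^ ((d : ℝ) / 2) * ∑ x' : LatticeSite d r N, q x' * h.sum fun n c =>
    if ∀ j, (2 * (x' j : ℤ) + n j) ≡ (x j : ℤ) [ZMOD 2 * (2 ^ (N + 1) * r)] then c else 0

/-- The one-particle scaling map `R^N_{N+1} : ℓ²(Λ_N) → ℓ²(Λ_{N+1})`, which acts on `q` and on `p`
by `scaleFun`. -/
def scalingMap {d r : ℕ} (ε : ℝ) (h : (Fin d → ℤ) →₀ ℝ) (N : ℕ) (ξ : LatticeSpace d r N) :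
    LatticeSpace d r (N + 1) :=
  ofFieldMomentum ε (scaleFun h (fieldPart ε ξ)) (scaleFun h (momentumPart ε ξ))

/-! ### Scaling functions -/

/-- A real, compactly supported, square integrable, orthonormal scaling function `φ` on `ℝ^d` with
finite real low-pass filter `h`. -/
structure IsScalingFunction {d : ℕ} (φ : EuclideanSpace ℝ (Fin d) → ℝ)
    (h : (Fin d → ℤ) →₀ ℝ) : Prop where
  compactSupport : HasCompactSupport φ
  memLp : MemLp φ 2 volume
  orthonormal : ∀ k : Fin d → ℤ,
    ∫ x, φ x * φ (WithLp.toLp 2 fun j => x j - k j) = if k = 0 then 1 else 0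
  scaling_eq : ∀ᵐ x, φ x =
    h.sum fun n c => c * (2 ^ ((d : ℝ) / 2) * φ (WithLp.toLp 2 fun j => 2 * x j - n j))
  integral_eq : ∫ x, φ x = 1

/-- `φ` belongs to the Sobolev space `H^{1/2}(ℝ^d)` (for integrable `φ`). -/
def MemHalfSobolev {d : ℕ} (φ : EuclideanSpace ℝ (Fin d) → ℝ) : Prop :=
  Integrable fun k : EuclideanSpace ℝ (Fin d) =>
    Real.sqrt (1 + ‖k‖ ^ 2) * ‖FourierTransform.fourier (fun x => (φ x : ℂ)) k‖ ^ 2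

/-- `g` is a Daubechies filter of order `K`: real coefficients, supported in `{0, …, 2K - 1}`, such
that `m₀(θ) = 2^{-1/2} ∑ g_n e^{-inθ}` satisfies `m₀(0) = 1` and
`|m₀(θ)|² = cos(θ/2)^{2K} ∑_{k < K} binom(K-1+k, k) sin(θ/2)^{2k}`. -/
structure IsDaubechiesFilter (K : ℕ) (g : ℤ →₀ ℝ) : Prop where
  support : ∀ n, g n ≠ 0 → 0 ≤ n ∧ n < 2 * (K : ℤ)
  sum_eq : (g.sum fun _ c => c) = Real.sqrt 2
  normSq_eq : ∀ θ : ℝ,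
    ‖g.sum fun n c => (c : ℂ) * Complex.exp (-Complex.I * n * θ)‖ ^ 2 / 2 =
      Real.cos (θ / 2) ^ (2 * K) *
        ∑ k ∈ Finset.range K, ((K - 1 + k).choose k : ℝ) * Real.sin (θ / 2) ^ (2 * k)

/-- `h` is the `d`-fold tensor product of a Daubechies filter of order `K`. -/
def IsDaubechiesTensorFilter {d : ℕ} (K : ℕ) (h : (Fin d → ℤ) →₀ ℝ) : Prop :=
  ∃ g : ℤ →₀ ℝ, IsDaubechiesFilter K g ∧ ∀ n, h n = ∏ j, g (n j)

/-- The rescaled scaling function `φ^{(ε_N)}_x` at the lattice point `x = ε_N z`, as a function on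
the torus `𝕋_L^d = (ℝ / 2Lℤ)^d`: the `2L`-periodization of
`y ↦ ε_N^{-d/2} φ((y - x) / ε_N)`. For compactly supported `φ` the sum is finite at every `y`. -/
def rescaledScaling {d : ℕ} (φ : EuclideanSpace ℝ (Fin d) → ℝ) (ε L : ℝ) (N : ℕ) (z : Fin d → ℤ)
    (y : EuclideanSpace ℝ (Fin d)) : ℝ :=
  ∑' n : Fin d → ℤ, spacing ε N ^ (-(d : ℝ) / 2) *
    φ (WithLp.toLp 2 fun j => (y j - spacing ε N * z j + 2 * L * n j) / spacing ε N)

/-! ### The continuum one-particle space -/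

/-- Fourier coefficient `f̂(k) = ∫_{[-L,L)^d} f(x) e^{-ik·x} dx` at `k = (π/L) n`. -/
def torusFourier {d : ℕ} (L : ℝ) (f : EuclideanSpace ℝ (Fin d) → ℝ) (n : Fin d → ℤ) : ℂ :=
  ∫ x in {x : EuclideanSpace ℝ (Fin d) | ∀ j, x j ∈ Set.Ico (-L) L},
    (f x : ℂ) * Complex.exp (-Complex.I * ((∑ j, Real.pi / L * n j * x j : ℝ) : ℂ))

/-- The dispersion relation `γ_m(k) = (k² + m²)^{1/2}` at `k = (π/L) n`. -/
def dispersion {d : ℕ} (L m : ℝ) (n : Fin d → ℤ) : ℝ :=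
  Real.sqrt (∑ j, (Real.pi / L * n j) ^ 2 + m ^ 2)

/-- The Fourier coefficients
`(2L)^{-d/2} (γ_m^{-1/2}(k) q̂(k) + i γ_m^{1/2}(k) p̂(k))`, `k = (π/L) n`,
of the function `f = q + ip` on the torus. -/
def oneParticleCoeff {d : ℕ} (L m : ℝ) (f : EuclideanSpace ℝ (Fin d) → ℂ) (n : Fin d → ℤ) : ℂ :=
  (((2 * L) ^ (-(d : ℝ) / 2) : ℝ) : ℂ) *
    (((dispersion L m n ^ (-(1 : ℝ) / 2) : ℝ) : ℂ) * torusFourier L (fun x => (f x).re) n +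
      Complex.I * ((dispersion L m n ^ ((1 : ℝ) / 2) : ℝ) : ℂ) *
        torusFourier L (fun x => (f x).im) n)

/-- The one-particle Hilbert space `𝔥_L` of the free field of mass `m > 0` on the torus, i.e. the
completion of the smooth functions `q + ip` in the inner product
`⟨ξ, η⟩ = (2L)^{-d} ∑_k conj (γ^{-1/2} q̂_ξ + i γ^{1/2} p̂_ξ) (γ^{-1/2} q̂_η + i γ^{1/2} p̂_η)`
with the complex structure `q + ip ↦ -γ p + i γ^{-1} q`. It is realized as `ℓ²(ℤ^d)` by means of
`f ↦ oneParticleCoeff L m f`, which is isometric and complex linear on the smooth functions and has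
dense range: the real trigonometric polynomials `q`, `p` already give every finitely supported
sequence. -/
abbrev OneParticleSpace (d : ℕ) : Type := lp (fun _ : Fin d → ℤ => ℂ) 2

open Classical in
/-- The element of `𝔥_L` given by a function `f = q + ip` of finite norm. -/
def toOneParticle {d : ℕ} (L m : ℝ) (f : EuclideanSpace ℝ (Fin d) → ℂ) : OneParticleSpace d :=
  if hf : Memℓp (oneParticleCoeff L m f) 2 then ⟨oneParticleCoeff L m f, hf⟩ else 0

/-- The function `y ↦ ε_N^{d/2} ∑_{x ∈ Λ_N} (q(x) + i p(x)) φ^{(ε_N)}_x(y)` on the torus, `L = ε r`. -/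
def smearedFun {d r : ℕ} (φ : EuclideanSpace ℝ (Fin d) → ℝ) (ε : ℝ) {N : ℕ}
    (ξ : LatticeSpace d r N) (y : EuclideanSpace ℝ (Fin d)) : ℂ :=
  ((spacing ε N ^ ((d : ℝ) / 2) : ℝ) : ℂ) * ∑ x : LatticeSite d r N,
    ((fieldPart ε ξ x : ℂ) + Complex.I * (momentumPart ε ξ x : ℂ)) *
      (rescaledScaling φ ε (ε * r) N (fun j => (x j : ℤ)) y : ℂ)

/-- The map `R^N_∞ : ℓ²(Λ_N) → 𝔥_L`, `L = ε r`. -/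
def smearingMap {d r : ℕ} (φ : EuclideanSpace ℝ (Fin d) → ℝ) (ε m : ℝ) (N : ℕ)
    (ξ : LatticeSpace d r N) : OneParticleSpace d :=
  toOneParticle (ε * r) m (smearedFun φ ε ξ)

end

/-! The C*-algebraic statements reduce to statements about one-particle maps.

Algebra. Any two systems of Weyl unitaries over the same space assign equal norms to the same linear
combination, so sending generators to generators extends to an injective morphism
(`IsWeylAlgebra.exists_injective_starAlgHom`). For the norms: averaging over conjugation by a
suitable Weyl unitary deletes a chosen nonscalar term, so the norm of a sum dominates the ℓ² norm of
its coefficients, while the triangle inequality bounds the norm by their ℓ¹ norm. The two differ by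
the square root of the size of the support. For powers of `y = s* s` the support grows only
polynomially, whereas `‖y ^ 2 ^ n‖ = ‖y‖ ^ 2 ^ n`; the polynomial factor is lost in the limit.

One-particle maps. The periodized translates of `φ` are orthonormal, so Parseval's identity turns
the cross terms `q̂ p̂` of the continuum form, where `γ^{-1/2}` and `γ^{1/2}` cancel, into the
lattice form. The terms `q̂ q̂` and `p̂ p̂` contribute an odd function of `k`, which sums to zero.
In Fourier space the lattice scaling map multiplies by the filter symbol, which is also the factor
in the scaling equation for `φ̂`; this gives compatibility (`smearingMap_scalingMap`), and the
symplecticity of the scaling maps follows from that of the smearing maps.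

Finite norm. It is enough that `∑ (1 + |n|) |φ̂(cn)|²` converges on every lattice. If `φ` is in
`H^{1/2}`, compact support makes `φ̂` its own correlation with a Schwartz function, so the sum is
dominated by the Sobolev integral. For a Daubechies filter, iterating the scaling equation bounds
`φ̂` by products of filter moduli; cosine zeros of order `K`, against a remaining factor below
`2^{K-1}`, give decay of order `s > 1` in each coordinate. -/

noncomputable section

/-! ### Weyl systems and the norm of their linear combinations -/

section WeylSystems

variable {V : Type*} [NormedAddCommGroup V] [InnerProductSpace ℂ V]
variable {A B : Type*} [CStarAlgebra A] [CStarAlgebra B]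

/-- A system of unitaries in a nonzero unital C*-algebra that satisfies the canonical commutation
relations. -/
structure IsWeylSystem (W : V → A) : Prop where
  nontrivial : Nontrivial A
  map_zero : W 0 = 1
  star_map : ∀ ξ, star (W ξ) = W (-ξ)
  ccr : ∀ ξ η, W ξ * W η = weylPhase ξ η • W (ξ + η)

lemma IsWeylAlgebra.isWeylSystem {W : V → A} (hW : IsWeylAlgebra W) : IsWeylSystem W :=
  ⟨hW.nontrivial, hW.map_zero, hW.star_map, hW.ccr⟩

lemma sympForm_smul_I (ξ : V) : sympForm ξ (Complex.I • ξ) = ‖ξ‖ ^ 2 := by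
  rw [sympForm, inner_smul_right, inner_self_eq_norm_sq_to_K]
  simp [← Complex.ofReal_pow]

lemma sympForm_neg_right (ξ η : V) : sympForm ξ (-η) = -sympForm ξ η := by
  simp [sympForm]

lemma sympForm_zero_right (ξ : V) : sympForm ξ 0 = 0 := by
  simp [sympForm]

lemma sympForm_real_smul_left (t : ℝ) (ξ η : V) :
    sympForm ((t : ℂ) • ξ) η = t * sympForm ξ η := by
  simp [sympForm]

/-- Nondegeneracy: `σ(ξ, iξ) = ‖ξ‖²`, so a real multiple of `iξ` does it. The value needed later is
`π`, whose phase is `-1`. -/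
lemma exists_sympForm_eq {ξ : V} (hξ : ξ ≠ 0) (c : ℝ) : ∃ η : V, sympForm η ξ = c := by
  have hn : ‖ξ‖ ^ 2 ≠ 0 := by simpa using hξ
  refine ⟨((-c / ‖ξ‖ ^ 2 : ℝ) : ℂ) • (Complex.I • ξ), ?_⟩
  rw [sympForm_real_smul_left, sympForm_swap, sympForm_smul_I]
  field_simp

namespace IsWeylSystem

variable {W : V → A} {W' : V → B}

/-- A symplectic map leaves the phases unchanged. The composite need not generate the algebra, which
is why generation is not part of `IsWeylSystem`. -/
lemma comp_symplectic {V' : Type*} [NormedAddCommGroup V'] [InnerProductSpace ℂ V'] {R : V' → V}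
    (hW : IsWeylSystem W) (hR : IsSymplecticMap R) : IsWeylSystem (W ∘ R) := by
  have h0 : R 0 = 0 := by simpa using hR.map_real_smul 0 0
  refine ⟨hW.nontrivial, by simp [h0, hW.map_zero], fun ξ => ?_, fun ξ η => ?_⟩
  · have hneg : R (-ξ) = -R ξ := by simpa using hR.map_real_smul (-1) ξ
    simp [hW.star_map, hneg]
  · simp only [Function.comp_apply, hW.ccr, hR.map_add, weylPhase, hR.preserves]

/-- One element of `A × B` carries the same coefficients in both systems, so norms can be compared
without first choosing coefficients or proving linear independence. -/
lemma prod (hW : IsWeylSystem W) (hW' : IsWeylSystem W') :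
    IsWeylSystem fun ξ => (W ξ, W' ξ) := by
  have := hW.nontrivial
  have := hW'.nontrivial
  refine ⟨inferInstance, ?_, fun ξ => ?_, fun ξ η => ?_⟩
  · simp [hW.map_zero, hW'.map_zero]
  · simp [Prod.star_def, hW.star_map, hW'.star_map]
  · simp [hW.ccr, hW'.ccr]

lemma norm_one (hW : IsWeylSystem W) : ‖(1 : A)‖ = 1 := by
  have := hW.nontrivial
  exact CStarRing.norm_one

lemma star_mul_self (hW : IsWeylSystem W) (ξ : V) : star (W ξ) * W ξ = 1 := by
  rw [hW.star_map, hW.ccr, weylPhase, sympForm_neg_left, sympForm_self]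
  simp [hW.map_zero]

lemma norm_apply (hW : IsWeylSystem W) (ξ : V) : ‖W ξ‖ = 1 := by
  have h := CStarRing.norm_star_mul_self (x := W ξ)
  rw [hW.star_mul_self, hW.norm_one] at h
  nlinarith [norm_nonneg (W ξ)]

lemma conj_apply (hW : IsWeylSystem W) (η ξ : V) :
    W η * W ξ * W (-η) = Complex.exp (-(Complex.I * (sympForm η ξ : ℂ))) • W ξ := by
  rw [hW.ccr, smul_mul_assoc, hW.ccr, smul_smul, add_neg_cancel_comm, weylPhase, weylPhase,
    ← Complex.exp_add]
  congr 2
  rw [sympForm_neg_right, sympForm_add_left, sympForm_self, sympForm_swap ξ η]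
  push_cast
  ring

/-- The coefficient of `1` is bounded by the norm of a linear combination of Weyl operators. -/
lemma norm_coeff_le {ι : Type*} [DecidableEq ι] (hW : IsWeylSystem W) (c : ℂ) (f : ι → V)
    (T : Finset ι) (hf : ∀ i ∈ T, f i ≠ 0) (a : ι → ℂ) :
    ‖c‖ ≤ ‖c • (1 : A) + ∑ i ∈ T, a i • W (f i)‖ := by
  induction T using Finset.induction_on generalizing a with
  | empty => simp [norm_smul, hW.norm_one]
  | insert j T hj ih =>
    -- Conjugation by `W η` multiplies the `j`-th term by `-1` and fixes the scalar term. Averaging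
    -- `x` with its conjugate removes `j` and does not increase the norm; the other coefficients
    -- change, hence the induction over all `a`.
    obtain ⟨η, hη⟩ := exists_sympForm_eq (hf j (Finset.mem_insert_self j T)) Real.pi
    set x := c • (1 : A) + ∑ i ∈ insert j T, a i • W (f i) with hx
    have hstar : W η * W (-η) = 1 := by
      have := hW.conj_apply η 0
      simpa [hW.map_zero, sympForm_zero_right] using this
    have hkey : (1 / 2 : ℂ) • (x + W η * x * W (-η)) = c • (1 : A) + ∑ i ∈ T,
        (a i * ((1 + Complex.exp (-(Complex.I * (sympForm η (f i) : ℂ)))) / 2)) • W (f i) := by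
      have h1 : W η * x * W (-η) = c • (1 : A) + ∑ i ∈ insert j T,
          (a i * Complex.exp (-(Complex.I * (sympForm η (f i) : ℂ)))) • W (f i) := by
        rw [hx, mul_add, add_mul, mul_smul_comm, smul_mul_assoc, mul_one, hstar, Finset.mul_sum,
          Finset.sum_mul]
        congr 1
        refine Finset.sum_congr rfl fun i _ => ?_
        rw [mul_smul_comm, smul_mul_assoc, hW.conj_apply, smul_smul]
      have hpi : Complex.exp (-(Complex.I * (sympForm η (f j) : ℂ))) = -1 := by
        rw [hη, Complex.exp_neg, mul_comm, Complex.exp_pi_mul_I]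
        norm_num
      rw [h1, hx, Finset.sum_insert hj, Finset.sum_insert hj, hpi]
      have h2 : ∀ s : A, ∀ p q : A, (1 / 2 : ℂ) • (c • (1 : A) + (a j • s + p) +
          (c • (1 : A) + ((a j * -1) • s + q))) = c • (1 : A) + (1 / 2 : ℂ) • (p + q) := by
        intro s p q
        module
      rw [h2, ← Finset.sum_add_distrib, Finset.smul_sum]
      congr 1
      refine Finset.sum_congr rfl fun i _ => ?_
      rw [← add_smul, smul_smul]
      congr 1
      ring
    calc ‖c‖ ≤ _ := ih (fun i hi => hf i (Finset.mem_insert_of_mem hi)) _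
      _ = ‖(1 / 2 : ℂ) • (x + W η * x * W (-η))‖ := by rw [hkey]
      _ ≤ (1 / 2) * (‖x‖ + ‖W η * x * W (-η)‖) := by
          rw [norm_smul]
          simp only [one_div, norm_inv, Complex.norm_ofNat]
          gcongr
          exact norm_add_le _ _
      _ ≤ (1 / 2) * (‖x‖ + 1 * ‖x‖ * 1) := by
          gcongr
          refine (norm_mul_le _ _).trans ?_
          rw [hW.norm_apply]
          gcongr
          refine (norm_mul_le _ _).trans ?_
          rw [hW.norm_apply]
      _ = ‖x‖ := by ring

/-- The `ℓ²` norm of the coefficients is bounded by the norm of the linear combination. -/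
lemma sum_norm_sq_le (hW : IsWeylSystem W) (T : Finset V) (b : V → ℂ) :
    ∑ ξ ∈ T, ‖b ξ‖ ^ 2 ≤ ‖∑ ξ ∈ T, b ξ • W ξ‖ ^ 2 := by
  classical
  -- The diagonal pairs give the scalar part; off the diagonal `-ξ + η ≠ 0`, so `norm_coeff_le`
  -- isolates the sum of squares.
  have h : star (∑ ξ ∈ T, b ξ • W ξ) * ∑ ξ ∈ T, b ξ • W ξ =
      ((∑ ξ ∈ T, ‖b ξ‖ ^ 2 : ℝ) : ℂ) • (1 : A) + ∑ p ∈ T.offDiag,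
        (star (b p.1) * b p.2 * weylPhase (-p.1) p.2) • W (-p.1 + p.2) := by
    rw [star_sum, Finset.sum_mul_sum, ← Finset.sum_product', ← Finset.diag_union_offDiag,
      Finset.sum_union (Finset.disjoint_diag_offDiag T), Finset.sum_diag]
    congr 1
    · rw [Complex.ofReal_sum, Finset.sum_smul]
      refine Finset.sum_congr rfl fun ξ _ => ?_
      rw [star_smul, smul_mul_smul_comm, hW.star_mul_self]
      congr 1
      simp [Complex.conj_mul']
    · refine Finset.sum_congr rfl fun p _ => ?_
      rw [star_smul, smul_mul_smul_comm, hW.star_map, hW.ccr, smul_smul]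
  have h2 := hW.norm_coeff_le ((∑ ξ ∈ T, ‖b ξ‖ ^ 2 : ℝ) : ℂ) (fun p : V × V => -p.1 + p.2)
    T.offDiag (fun p hp h0 => (Finset.mem_offDiag.1 hp).2.2 (neg_add_eq_zero.1 h0))
    (fun p => star (b p.1) * b p.2 * weylPhase (-p.1) p.2)
  rw [← h, CStarRing.norm_star_mul_self, Complex.norm_real, Real.norm_of_nonneg (by positivity)]
    at h2
  rw [pow_two ‖∑ ξ ∈ T, b ξ • W ξ‖]
  exact h2

/-- The triangle inequality in `A`, Cauchy–Schwarz, and the ℓ² lower bound in `B`, all for the same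
coefficients. The cardinality is the whole loss. -/
lemma norm_fst_sq_le (hW : IsWeylSystem W) (hW' : IsWeylSystem W') (T : Finset V) {s : A × B}
    (hs : s ∈ Submodule.span ℂ ((fun ξ => (W ξ, W' ξ)) '' (T : Set V))) :
    ‖s.1‖ ^ 2 ≤ T.card * ‖s.2‖ ^ 2 := by
  obtain ⟨b, rfl⟩ := (Submodule.mem_span_image_finset_iff_exists_fun' ℂ).1 hs
  have h1 : (∑ ξ ∈ T, b ξ • (W ξ, W' ξ)).1 = ∑ ξ ∈ T, b ξ • W ξ := by simp [Prod.fst_sum]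
  have h2 : (∑ ξ ∈ T, b ξ • (W ξ, W' ξ)).2 = ∑ ξ ∈ T, b ξ • W' ξ := by simp [Prod.snd_sum]
  rw [h1, h2]
  calc ‖∑ ξ ∈ T, b ξ • W ξ‖ ^ 2 ≤ (∑ ξ ∈ T, ‖b ξ‖) ^ 2 := by
        gcongr
        refine (norm_sum_le _ _).trans (le_of_eq ?_)
        simp [norm_smul, hW.norm_apply]
    _ ≤ T.card * ∑ ξ ∈ T, ‖b ξ‖ ^ 2 := sq_sum_le_card_mul_sum_sq
    _ ≤ _ := by
        gcongr
        exact hW'.sum_norm_sq_le T b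

lemma mul_mem_span (hW : IsWeylSystem W) {S T : Set V} {x y : A}
    (hx : x ∈ Submodule.span ℂ (W '' S)) (hy : y ∈ Submodule.span ℂ (W '' T)) :
    x * y ∈ Submodule.span ℂ (W '' Set.image2 (· + ·) S T) := by
  have h := Submodule.mul_mem_mul hx hy
  rw [Submodule.span_mul_span] at h
  refine Submodule.span_le.2 ?_ h
  rintro _ ⟨_, ⟨ξ, hξ, rfl⟩, _, ⟨η, hη, rfl⟩, rfl⟩
  simp only [hW.ccr]
  exact Submodule.smul_mem _ _ (Submodule.subset_span ⟨_, ⟨ξ, hξ, η, hη, rfl⟩, rfl⟩)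

lemma star_mem_span (hW : IsWeylSystem W) {S : Set V} {x : A}
    (hx : x ∈ Submodule.span ℂ (W '' S)) : star x ∈ Submodule.span ℂ (W '' (Neg.neg '' S)) := by
  induction hx using Submodule.span_induction with
  | mem x hx =>
    obtain ⟨ξ, hξ, rfl⟩ := hx
    rw [hW.star_map]
    exact Submodule.subset_span ⟨_, ⟨ξ, hξ, rfl⟩, rfl⟩
  | zero => simp
  | add x y _ _ hx hy => rw [star_add]; exact Submodule.add_mem _ hx hy
  | smul c x _ hx => rw [star_smul]; exact Submodule.smul_mem _ _ hx

lemma adjoin_le_span (hW : IsWeylSystem W) {x : A} (hx : x ∈ StarAlgebra.adjoin ℂ (Set.range W)) :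
    x ∈ Submodule.span ℂ (Set.range W) := by
  induction hx using StarAlgebra.adjoin_induction with
  | mem x hx => exact Submodule.subset_span hx
  | algebraMap c =>
    rw [Algebra.algebraMap_eq_smul_one, ← hW.map_zero]
    exact Submodule.smul_mem _ _ (Submodule.subset_span ⟨0, rfl⟩)
  | add x y _ _ hx hy => exact Submodule.add_mem _ hx hy
  | mul x y _ _ hx hy =>
    rw [← Set.image_univ] at hx hy
    exact Submodule.span_mono (Set.image_subset_range _ _) (hW.mul_mem_span hx hy)
  | star x _ hx =>
    rw [← Set.image_univ] at hx
    exact Submodule.span_mono (Set.image_subset_range _ _) (hW.star_mem_span hx)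

/-- Powers of a linear combination of Weyl operators have supports of polynomial growth. -/
lemma exists_pow_mem_span (hW : IsWeylSystem W) (S : Finset V) {y : A}
    (hy : y ∈ Submodule.span ℂ (W '' (S : Set V))) (n : ℕ) :
    ∃ T : Finset V, T.card ≤ (n + 1) ^ S.card ∧ y ^ n ∈ Submodule.span ℂ (W '' (T : Set V)) := by
  classical
  -- Addition is commutative, so a sum of `n` vectors of `S` depends only on their multiplicities,
  -- each in `{0, …, n}`.
  refine ⟨Finset.univ.image fun k : S → Fin (n + 1) => ∑ s, (k s : ℕ) • (s : V), ?_, ?_⟩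
  · refine Finset.card_image_le.trans ?_
    simp
  · induction n with
    | zero =>
      rw [pow_zero, ← hW.map_zero]
      exact Submodule.subset_span ⟨0, by simp, rfl⟩
    | succ n ih =>
      rw [pow_succ]
      refine Submodule.span_mono (Set.image_mono ?_) (hW.mul_mem_span ih hy)
      rintro _ ⟨_, hk, t, ht, rfl⟩
      simp only [Finset.coe_image, Finset.coe_univ, Set.image_univ, Set.mem_range] at hk ⊢
      obtain ⟨k, rfl⟩ := hk
      -- The extra summand `t` raises its own multiplicity by one.
      refine ⟨fun s => if s = ⟨t, ht⟩ then (k s).succ else (k s).castSucc, ?_⟩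
      have h : ∀ s : S, ((if s = ⟨t, ht⟩ then (k s).succ else (k s).castSucc : Fin (n + 1 + 1)) : ℕ)
          • (s : V) = (k s : ℕ) • (s : V) + if s = ⟨t, ht⟩ then t else 0 := by
        intro s
        split_ifs with h
        · subst h
          simp [add_smul]
        · simp
      simp_rw [h]
      rw [Finset.sum_add_distrib]
      simp

end IsWeylSystem

/-- A polynomial factor does not affect the comparison of exponential growth rates. -/
lemma le_of_pow_two_pow_le {a b : ℝ} (hb : 0 ≤ b) (k : ℕ)
    (h : ∀ n : ℕ, (a ^ 2 ^ n) ^ 2 ≤ ((2 : ℝ) ^ n + 1) ^ k * (b ^ 2 ^ n) ^ 2) : a ≤ b := by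
  by_contra! hab
  have ha : 0 < a := hb.trans_lt hab
  have hr1 : (b / a) ^ 2 < 1 := by
    rw [div_pow, div_lt_one (by positivity)]
    gcongr
  -- If `b < a`, then `M ^ k * ((b / a) ^ 2) ^ M` tends to zero; sampled at `M = 2 ^ n` this
  -- contradicts the hypothesis, which keeps it bounded below.
  have hlim := tendsto_pow_const_mul_const_pow_of_abs_lt_one k
    (by rwa [abs_of_nonneg (by positivity)] : |(b / a) ^ 2| < 1)
  have h2 : Filter.Tendsto (fun n : ℕ => 2 ^ k * ((((2 ^ n : ℕ) : ℝ)) ^ k * ((b / a) ^ 2) ^ 2 ^ n))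
      Filter.atTop (nhds (2 ^ k * 0)) :=
    (hlim.comp (tendsto_pow_atTop_atTop_of_one_lt one_lt_two)).const_mul _
  rw [mul_zero] at h2
  obtain ⟨n, hn⟩ := (h2.eventually (gt_mem_nhds one_pos)).exists
  have h3 : 1 ≤ ((2 : ℝ) ^ n + 1) ^ k * ((b / a) ^ 2) ^ 2 ^ n := by
    rw [div_pow, div_pow, mul_div_assoc', le_div_iff₀ (by positivity), one_mul, ← pow_mul,
      ← pow_mul, mul_comm 2, pow_mul, pow_mul]
    exact h n
  have h4 : ((2 : ℝ) ^ n + 1) ^ k ≤ 2 ^ k * (2 ^ n) ^ k := by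
    rw [← mul_pow]
    gcongr
    linarith [one_le_pow₀ (one_le_two : (1 : ℝ) ≤ 2) (n := n)]
  have h5 : 1 ≤ 2 ^ k * (((2 ^ n : ℕ) : ℝ) ^ k * ((b / a) ^ 2) ^ 2 ^ n) := by
    push_cast
    rw [← mul_assoc]
    exact h3.trans (by gcongr)
  linarith

/-- For the selfadjoint `y = s* s` the C*-identity makes the norm multiplicative on powers `2 ^ n`.
Applied to `y ^ 2 ^ n`, the crude bound `norm_fst_sq_le` loses only a power of `2 ^ n + 1`, which
`le_of_pow_two_pow_le` discards. -/
lemma IsWeylSystem.norm_fst_le {W : V → A} {W' : V → B} (hW : IsWeylSystem W)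
    (hW' : IsWeylSystem W') {s : A × B}
    (hs : s ∈ Submodule.span ℂ (Set.range fun ξ => (W ξ, W' ξ))) : ‖s.1‖ ≤ ‖s.2‖ := by
  classical
  have hP := hW.prod hW'
  obtain ⟨T, hT⟩ : ∃ T : Finset V,
      s ∈ Submodule.span ℂ ((fun ξ => (W ξ, W' ξ)) '' (T : Set V)) := by
    rw [← Set.image_univ] at hs
    obtain ⟨T, -, hT⟩ := Submodule.mem_span_image_iff_exists_fun ℂ |>.1 hs
    obtain ⟨c, rfl⟩ := hT
    refine ⟨T, Submodule.sum_mem _ fun i _ => Submodule.smul_mem _ _ (Submodule.subset_span ?_)⟩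
    exact ⟨i, i.2, rfl⟩
  have hy := hP.mul_mem_span (hP.star_mem_span hT) hT
  obtain ⟨S, hS⟩ : ∃ S : Finset V, (S : Set V) = Set.image2 (· + ·) (Neg.neg '' (T : Set V)) T :=
    ⟨Finset.image₂ (· + ·) (T.image Neg.neg) T, by simp⟩
  rw [← hS] at hy
  have key : ‖star s.1 * s.1‖ ≤ ‖star s.2 * s.2‖ := by
    refine le_of_pow_two_pow_le (norm_nonneg _) S.card fun n => ?_
    obtain ⟨U, hU, hmem⟩ := hP.exists_pow_mem_span S hy (2 ^ n)
    have h := hW.norm_fst_sq_le hW' U hmem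
    have e1 : ‖((star s * s) ^ 2 ^ n).1‖ = ‖star s.1 * s.1‖ ^ 2 ^ n := by
      have := (IsSelfAdjoint.star_mul_self s.1).nnnorm_pow_two_pow n
      exact congrArg NNReal.toReal this
    have e2 : ‖((star s * s) ^ 2 ^ n).2‖ = ‖star s.2 * s.2‖ ^ 2 ^ n := by
      have := (IsSelfAdjoint.star_mul_self s.2).nnnorm_pow_two_pow n
      exact congrArg NNReal.toReal this
    rw [e1, e2] at h
    refine h.trans ?_
    gcongr
    exact_mod_cast hU
  rw [CStarRing.norm_star_mul_self, CStarRing.norm_star_mul_self] at key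
  exact (abs_le_of_sq_le_sq' (by simpa [pow_two] using key) (norm_nonneg _)).2

lemma IsWeylSystem.norm_fst_eq {W : V → A} {W' : V → B} (hW : IsWeylSystem W)
    (hW' : IsWeylSystem W') {s : A × B}
    (hs : s ∈ Submodule.span ℂ (Set.range fun ξ => (W ξ, W' ξ))) : ‖s.1‖ = ‖s.2‖ := by
  refine le_antisymm (hW.norm_fst_le hW' hs) ?_
  have h : s.swap ∈ Submodule.span ℂ (Set.range fun ξ => (W' ξ, W ξ)) := by
    have := Submodule.mem_map_of_mem (f := (LinearEquiv.prodComm ℂ A B).toLinearMap) hs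
    rw [Submodule.map_span, ← Set.range_comp] at this
    exact this
  exact hW'.norm_fst_le hW h

/-! ### Morphisms from their graphs -/

/-- A star subalgebra of `A × B` on which both projections have the same norm, and whose first
projection is dense, is contained in the graph of an injective morphism `A → B`. -/
lemma exists_starAlgHom_of_graph (S : StarSubalgebra ℂ (A × B)) (hS : ∀ s ∈ S, ‖s.1‖ = ‖s.2‖)
    (hd : Dense (Prod.fst '' (S : Set (A × B)))) :
    ∃ β : A →⋆ₐ[ℂ] B, Function.Injective β ∧ ∀ s ∈ S, β s.1 = s.2 := by
  have hcl : ∀ s ∈ S.topologicalClosure, ‖s.1‖ = ‖s.2‖ := by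
    have hclosed : IsClosed {s : A × B | ‖s.1‖ = ‖s.2‖} :=
      isClosed_eq (by fun_prop) (by fun_prop)
    intro s hs
    exact closure_minimal (fun s hs => hS s hs) hclosed hs
  have : IsClosed (S.topologicalClosure : Set (A × B)) := S.isClosed_topologicalClosure
  let p : S.topologicalClosure →⋆ₐ[ℂ] A :=
    (StarAlgHom.fst ℂ A B).comp S.topologicalClosure.subtype
  let q : S.topologicalClosure →⋆ₐ[ℂ] B :=
    (StarAlgHom.snd ℂ A B).comp S.topologicalClosure.subtype
  -- The product norm is the maximum, so equal component norms make both projections isometric on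
  -- the closure. The range of `p` is then closed as well as dense, and `q ∘ p⁻¹` is the morphism.
  have hp : ∀ s, ‖p s‖ = ‖s‖ := fun s => by
    change ‖(s : A × B).1‖ = max ‖(s : A × B).1‖ ‖(s : A × B).2‖
    rw [← hcl s s.2, max_self]
  have hq : ∀ s, ‖q s‖ = ‖s‖ := fun s => by
    change ‖(s : A × B).2‖ = max ‖(s : A × B).1‖ ‖(s : A × B).2‖
    rw [hcl s s.2, max_self]
  have hpi : Isometry p := AddMonoidHomClass.isometry_of_norm p hp
  have hqi : Isometry q := AddMonoidHomClass.isometry_of_norm q hq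
  have hsurj : Function.Surjective p := by
    have hr : IsClosed (Set.range p) := hpi.isClosedEmbedding.isClosed_range
    have hd' : Dense (Set.range p) := by
      refine hd.mono ?_
      rintro _ ⟨s, hs, rfl⟩
      exact ⟨⟨s, S.le_topologicalClosure hs⟩, rfl⟩
    rw [← Set.range_eq_univ, ← hr.closure_eq, hd'.closure_eq]
  let e := StarAlgEquiv.ofBijective p ⟨hpi.injective, hsurj⟩
  refine ⟨q.comp (e.symm : A →⋆ₐ[ℂ] S.topologicalClosure), ?_, fun s hs => ?_⟩
  · exact hqi.injective.comp e.symm.injective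
  · have : e.symm s.1 = ⟨s, S.le_topologicalClosure hs⟩ := by
      rw [StarAlgEquiv.symm_apply_eq]
      rfl
    change q (e.symm s.1) = s.2
    rw [this]
    rfl

/-- **Slawny's theorem**: every Weyl system is the image of the Weyl algebra under an injective
morphism. -/
theorem IsWeylAlgebra.exists_injective_starAlgHom {W : V → A} {W' : V → B} (hW : IsWeylAlgebra W)
    (hW' : IsWeylSystem W') :
    ∃ β : A →⋆ₐ[ℂ] B, Function.Injective β ∧ ∀ ξ, β (W ξ) = W' ξ := by
  have hP := hW.isWeylSystem.prod hW'
  obtain ⟨β, hβ, hgr⟩ := exists_starAlgHom_of_graph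
    (StarAlgebra.adjoin ℂ (Set.range fun ξ => (W ξ, W' ξ)))
    (fun s hs => hW.isWeylSystem.norm_fst_eq hW' (hP.adjoin_le_span hs)) (by
      have h : StarAlgebra.adjoin ℂ (Set.range W) =
          (StarAlgebra.adjoin ℂ (Set.range fun ξ => (W ξ, W' ξ))).map (StarAlgHom.fst ℂ A B) := by
        rw [StarAlgHom.map_adjoin, ← Set.range_comp]
        rfl
      have h2 := hW.generates
      rw [h] at h2
      have h3 := congrArg (fun S : StarSubalgebra ℂ A => (S : Set A)) h2
      rw [dense_iff_closure_eq]
      simpa using h3)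
  exact ⟨β, hβ, fun ξ => hgr (W ξ, W' ξ) (StarAlgebra.subset_adjoin ℂ _ ⟨ξ, rfl⟩)⟩

lemma IsWeylAlgebra.starAlgHom_ext {W : V → A} (hW : IsWeylAlgebra W) {β γ : A →⋆ₐ[ℂ] B}
    (h : ∀ ξ, β (W ξ) = γ (W ξ)) : β = γ := by
  have hcl : IsClosed {a | β a = γ a} :=
    isClosed_eq (AddMonoidHomClass.continuous_of_bound β 1 fun a => by
      simpa using NonUnitalStarAlgHom.norm_apply_le β a)
      (AddMonoidHomClass.continuous_of_bound γ 1 fun a => by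
      simpa using NonUnitalStarAlgHom.norm_apply_le γ a)
  ext a
  have ha : a ∈ (StarAlgebra.adjoin ℂ (Set.range W)).topologicalClosure := by
    rw [hW.generates]; trivial
  refine closure_minimal (fun x hx => ?_) hcl ha
  have : StarAlgebra.adjoin ℂ (Set.range W) ≤ StarAlgHom.equalizer β γ :=
    StarAlgebra.adjoin_le (by rintro _ ⟨ξ, rfl⟩; exact h ξ)
  exact this hx

end WeylSystems

/-! ### Inductive limits -/

section InductiveLimits

variable {A : ℕ → Type*} [∀ N, CStarAlgebra (A N)] {α : ∀ N, A N →⋆ₐ[ℂ] A (N + 1)}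
variable {B C : Type*} [CStarAlgebra B] [CStarAlgebra C]

lemma range_le_of_compatible {ι : ∀ N, A N →⋆ₐ[ℂ] C} (h : ∀ N a, ι (N + 1) (α N a) = ι N a) :
    Monotone fun N => (ι N).range := by
  refine monotone_nat_of_le_succ fun N => ?_
  rintro _ ⟨a, rfl⟩
  exact ⟨α N a, h N a⟩

/-- The union of the ranges of a compatible sequence of morphisms. -/
lemma coe_iSup_range {ι : ∀ N, A N →⋆ₐ[ℂ] C} (h : ∀ N a, ι (N + 1) (α N a) = ι N a) :
    ((⨆ N, (ι N).range : StarSubalgebra ℂ C) : Set C) = ⋃ N, Set.range (ι N) := by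
  rw [StarSubalgebra.coe_iSup_of_directed (range_le_of_compatible h).directed_le]
  rfl

/-- The universal property of the inductive limit for injective morphisms. -/
theorem IsCStarInductiveLimit.exists_injective_lift {ι : ∀ N, A N →⋆ₐ[ℂ] C}
    (hι : IsCStarInductiveLimit α ι) {β : ∀ N, A N →⋆ₐ[ℂ] B}
    (hβ : ∀ N, Function.Injective (β N)) (hc : ∀ N a, β (N + 1) (α N a) = β N a) :
    ∃ γ : C →⋆ₐ[ℂ] B, Function.Injective γ ∧ ∀ N a, γ (ι N a) = β N a := by
  let κ : ∀ N, A N →⋆ₐ[ℂ] C × B := fun N => (ι N).prod (β N)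
  have hκ : ∀ N a, κ (N + 1) (α N a) = κ N a := fun N a =>
    Prod.ext (hι.compatible N a) (hc N a)
  have hmem : ∀ s, s ∈ (⨆ N, (κ N).range : StarSubalgebra ℂ (C × B)) ↔ ∃ N a, κ N a = s := by
    intro s
    rw [← SetLike.mem_coe, coe_iSup_range hκ]
    simp
  -- Injective morphisms of C*-algebras are isometric, so the two components of `κ N a` both have
  -- norm `‖a‖`.
  obtain ⟨γ, hγ, hgr⟩ := exists_starAlgHom_of_graph (⨆ N, (κ N).range) (fun s hs => by
      obtain ⟨N, a, rfl⟩ := (hmem s).1 hs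
      exact (NonUnitalStarAlgHom.norm_map (ι N) (hι.injective N) a).trans
        (NonUnitalStarAlgHom.norm_map (β N) (hβ N) a).symm) (by
      refine hι.dense.mono ?_
      intro c hcm
      obtain ⟨N, a, rfl⟩ := Set.mem_iUnion.1 hcm
      exact ⟨κ N a, (hmem _).2 ⟨N, a, rfl⟩, rfl⟩)
  exact ⟨γ, hγ, fun N a => hgr (κ N a) ((hmem _).2 ⟨N, a, rfl⟩)⟩

/-- A sequence with compatible injective morphisms into `B` has an inductive limit. -/
theorem exists_isCStarInductiveLimit {B : Type v} [CStarAlgebra B] {β : ∀ N, A N →⋆ₐ[ℂ] B}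
    (hβ : ∀ N, Function.Injective (β N)) (hc : ∀ N a, β (N + 1) (α N a) = β N a) :
    ∃ (C : Type v) (_ : CStarAlgebra C) (ι : ∀ N, A N →⋆ₐ[ℂ] C), IsCStarInductiveLimit α ι := by
  -- The limit is realized inside `B`, as the closure of the increasing union of the ranges.
  let S : StarSubalgebra ℂ B := ⨆ N, (β N).range
  have hS : (S : Set B) = ⋃ N, Set.range (β N) := coe_iSup_range hc
  have hmem : ∀ N a, β N a ∈ S.topologicalClosure := fun N a =>
    S.le_topologicalClosure (by
      rw [← SetLike.mem_coe, hS]; exact Set.mem_iUnion.2 ⟨N, a, rfl⟩)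
  have : IsClosed (S.topologicalClosure : Set B) := S.isClosed_topologicalClosure
  refine ⟨S.topologicalClosure, inferInstance,
    fun N => (β N).codRestrict S.topologicalClosure (hmem N), ⟨fun N a => ?_, fun N => ?_, ?_⟩⟩
  · exact Subtype.ext (hc N a)
  · intro a b hab
    exact hβ N (congrArg Subtype.val hab)
  · intro c
    rw [closure_subtype]
    have hcl : (c : B) ∈ closure (S : Set B) := c.2
    rw [hS] at hcl
    convert hcl using 2
    rw [Set.image_iUnion]
    congr 1
    ext N b
    constructor
    · rintro ⟨_, ⟨a, rfl⟩, rfl⟩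
      exact ⟨a, rfl⟩
    · rintro ⟨a, rfl⟩
      exact ⟨_, ⟨a, rfl⟩, rfl⟩

end InductiveLimits

/-! ### Fourier series on the torus -/

section TorusFourier

variable {d : ℕ}

attribute [local instance] instMeasureSpaceUnitAddCircle

/-- The fundamental domain `[-L, L)^d` of the torus. -/
def torusBox (d : ℕ) (L : ℝ) : Set (EuclideanSpace ℝ (Fin d)) :=
  {x | ∀ j, x j ∈ Set.Ico (-L) L}

lemma measurableSet_torusBox (L : ℝ) : MeasurableSet (torusBox d L) := by
  have : torusBox d L = ⋂ j, (fun x : EuclideanSpace ℝ (Fin d) => x j) ⁻¹' Set.Ico (-L) L := by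
    ext; simp [torusBox]
  rw [this]
  exact MeasurableSet.iInter fun j => measurableSet_Ico.preimage (by fun_prop)

/-- The representative in `(-L, L]^d` of a point of the unit torus, scaled by `2L`. -/
def torusRep (L : ℝ) (t : UnitAddTorus (Fin d)) : EuclideanSpace ℝ (Fin d) :=
  (2 * L) • WithLp.toLp 2 fun j => (AddCircle.equivIoc (1 : ℝ) (-(1 / 2)) (t j) : ℝ)

/-- This transports Fourier analysis from the unit torus, whose total mass is one, to the box of
volume `(2L)^d`; hence the normalizing factor. -/
lemma map_torusRep {L : ℝ} (hL : 0 < L) :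
    MeasurePreserving (torusRep (d := d) L) volume
      (ENNReal.ofReal ((2 * L) ^ d)⁻¹ • volume.restrict (torusBox d L)) := by
  have h2L : 2 * L ≠ 0 := by positivity
  have hm : MeasurableSet {x : Fin d → ℝ | ∀ i, x i ∈ Set.Ioc (-(1 / 2) : ℝ) (-(1 / 2) + 1)} :=
    MeasurableSet.univ_pi' fun i => measurableSet_Ioc
  have m12 := (measurePreserving_subtype_coe (μa := (volume : Measure (Fin d → ℝ))) hm).comp
    (UnitAddTorus.measurePreserving_equivPiIoc fun _ : Fin d => (-(1 / 2) : ℝ))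
  -- The representatives fill a box closed on the right, the box of the statement is closed on the
  -- left; the difference is null.
  have hae : {x : Fin d → ℝ | ∀ i, x i ∈ Set.Ioc (-(1 / 2) : ℝ) (-(1 / 2) + 1)} =ᵐ[volume]
      {x : Fin d → ℝ | ∀ i, x i ∈ Set.Ico (-(1 / 2) : ℝ) (-(1 / 2) + 1)} := by
    have h1 := Measure.univ_pi_Ioc_ae_eq_Icc (μ := fun _ : Fin d => (volume : Measure ℝ))
      (f := fun _ => -(1 / 2)) (g := fun _ => -(1 / 2) + 1)
    have h2 := Measure.univ_pi_Ico_ae_eq_Icc (μ := fun _ : Fin d => (volume : Measure ℝ))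
      (f := fun _ => -(1 / 2)) (g := fun _ => -(1 / 2) + 1)
    have := h1.trans h2.symm
    simpa [Set.pi, volume_pi] using this
  rw [Measure.restrict_congr_set hae] at m12
  have hb : {x : Fin d → ℝ | ∀ i, x i ∈ Set.Ico (-(1 / 2) : ℝ) (-(1 / 2) + 1)} =
      WithLp.toLp 2 ⁻¹' torusBox d (1 / 2) := by
    ext x
    simp only [torusBox, Set.mem_ofPred_eq, Set.mem_preimage]
    norm_num
  rw [hb] at m12
  have m3 := (PiLp.volume_preserving_toLp (Fin d)).restrict_preimage
    (measurableSet_torusBox (d := d) (1 / 2))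
  have m4 : MeasurePreserving (fun x : EuclideanSpace ℝ (Fin d) => (2 * L) • x)
      (volume.restrict (torusBox d (1 / 2)))
      (ENNReal.ofReal ((2 * L) ^ d)⁻¹ • volume.restrict (torusBox d L)) := by
    have hs : MeasurePreserving (fun x : EuclideanSpace ℝ (Fin d) => (2 * L) • x) volume
        (ENNReal.ofReal ((2 * L) ^ d)⁻¹ • volume) := by
      refine ⟨by fun_prop, ?_⟩
      rw [Measure.map_addHaar_smul _ h2L, abs_of_pos (by positivity)]
      simp
    have hr := hs.restrict_preimage (measurableSet_torusBox (d := d) L)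
    rw [Measure.restrict_smul] at hr
    convert hr using 2
    ext x
    simp only [torusBox, Set.mem_ofPred_eq, Set.mem_preimage, PiLp.smul_apply, smul_eq_mul,
      Set.mem_Ico]
    refine forall_congr' fun j => and_congr ?_ ?_
    · constructor <;> intro h <;> nlinarith
    · constructor <;> intro h <;> nlinarith
  exact m4.comp (m3.comp m12)

lemma mFourier_eq_torusRep {L : ℝ} (hL : 0 < L) (n : Fin d → ℤ) (t : UnitAddTorus (Fin d)) :
    UnitAddTorus.mFourier (-n) t = Complex.exp (-Complex.I *
      ((∑ j, Real.pi / L * n j * torusRep L t j : ℝ) : ℂ)) := by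
  have hL' : (L : ℂ) ≠ 0 := by exact_mod_cast hL.ne'
  have h : ∀ j, t j = ((AddCircle.equivIoc (1 : ℝ) (-(1 / 2)) (t j) : ℝ) : UnitAddCircle) :=
    fun j => ((AddCircle.equivIoc (1 : ℝ) (-(1 / 2))).symm_apply_apply (t j)).symm
  change ∏ j, fourier ((-n) j) (t j) = _
  push_cast
  rw [Finset.mul_sum, Complex.exp_sum]
  refine Finset.prod_congr rfl fun j _ => ?_
  rw [h j, fourier_coe_apply]
  congr 1
  simp only [torusRep, PiLp.smul_apply, smul_eq_mul, Pi.neg_apply]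
  push_cast
  field_simp

lemma torusFourier_eq_mFourierCoeff {L : ℝ} (hL : 0 < L) {f : EuclideanSpace ℝ (Fin d) → ℝ}
    (hf : AEStronglyMeasurable f (volume.restrict (torusBox d L))) (n : Fin d → ℤ) :
    torusFourier L f n = (2 * L) ^ d *
      UnitAddTorus.mFourierCoeff (fun t => (f (torusRep L t) : ℂ)) n := by
  have hmp := map_torusRep (d := d) hL
  have hf' : AEStronglyMeasurable (fun x => (f x : ℂ) * Complex.exp (-Complex.I *
      ((∑ j, Real.pi / L * n j * x j : ℝ) : ℂ)))
      (Measure.map (torusRep L) (volume : Measure (UnitAddTorus (Fin d)))) := by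
    rw [hmp.map_eq]
    refine AEStronglyMeasurable.smul_measure ?_ _
    refine (Complex.continuous_ofReal.comp_aestronglyMeasurable hf).mul ?_
    exact Continuous.aestronglyMeasurable (by fun_prop)
  have h := integral_map hmp.measurable.aemeasurable hf'
  rw [hmp.map_eq, integral_smul_measure, ENNReal.toReal_ofReal (by positivity)] at h
  have h2 : torusFourier L f n = ∫ x in torusBox d L, (f x : ℂ) * Complex.exp (-Complex.I *
      ((∑ j, Real.pi / L * n j * x j : ℝ) : ℂ)) := rfl
  rw [← h2] at h
  have h3 : UnitAddTorus.mFourierCoeff (fun t => (f (torusRep L t) : ℂ)) n =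
      ((2 * L) ^ d)⁻¹ • torusFourier L f n := by
    rw [h]
    refine integral_congr_ae (Filter.Eventually.of_forall fun t => ?_)
    simp only [mFourier_eq_torusRep hL, smul_eq_mul]
    rw [mul_comm]
  rw [h3, Complex.real_smul, ← mul_assoc]
  have : ((2 * L : ℝ) : ℂ) ≠ 0 := by exact_mod_cast (by positivity : 2 * L ≠ 0)
  push_cast at this ⊢
  rw [mul_inv_cancel₀ (pow_ne_zero _ this), one_mul]

/-- **Parseval's identity** for real square integrable functions on the torus. -/
theorem hasSum_torusFourier {L : ℝ} (hL : 0 < L) {f g : EuclideanSpace ℝ (Fin d) → ℝ}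
    (hf : MemLp f 2 (volume.restrict (torusBox d L)))
    (hg : MemLp g 2 (volume.restrict (torusBox d L))) :
    HasSum (fun n => (starRingEnd ℂ) (torusFourier L f n) * torusFourier L g n)
      ((((2 * L) ^ d * ∫ x in torusBox d L, f x * g x : ℝ)) : ℂ) := by
  have hmp := map_torusRep (d := d) hL
  have key : ∀ {f : EuclideanSpace ℝ (Fin d) → ℝ},
      MemLp f 2 (volume.restrict (torusBox d L)) →
      MemLp (fun t => (f (torusRep L t) : ℂ)) 2 (volume : Measure (UnitAddTorus (Fin d))) := by
    intro f hf
    have h1 : MemLp (fun x => (f x : ℂ)) 2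
        (Measure.map (torusRep L) (volume : Measure (UnitAddTorus (Fin d)))) := by
      rw [hmp.map_eq]
      exact (hf.ofReal (K := ℂ)).smul_measure ENNReal.ofReal_ne_top
    exact (memLp_map_measure_iff h1.1 hmp.measurable.aemeasurable).1 h1
  have hF := key hf
  have hG := key hg
  have hP := UnitAddTorus.hasSum_prod_mFourierCoeff (hF.toLp _) (hG.toLp _)
  have hc : ∀ {f : EuclideanSpace ℝ (Fin d) → ℝ}
      (hf : MemLp f 2 (volume.restrict (torusBox d L))) (n : Fin d → ℤ),
      UnitAddTorus.mFourierCoeff ((key hf).toLp _) n =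
        ((2 * L) ^ d : ℂ)⁻¹ * torusFourier L f n := by
    intro f hf n
    have hne : ((2 * L : ℝ) : ℂ) ≠ 0 := by exact_mod_cast (by positivity : 2 * L ≠ 0)
    push_cast at hne
    rw [torusFourier_eq_mFourierCoeff hL hf.1, ← mul_assoc, inv_mul_cancel₀ (pow_ne_zero _ hne),
      one_mul]
    refine integral_congr_ae ?_
    filter_upwards [(key hf).coeFn_toLp] with t ht
    rw [ht]
  have hint : ∫ t, (starRingEnd ℂ) ((hF.toLp _) t) * (hG.toLp _) t =
      ((((2 * L) ^ d)⁻¹ * ∫ x in torusBox d L, f x * g x : ℝ) : ℂ) := by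
    have h1 : ∫ t, (starRingEnd ℂ) ((hF.toLp _) t) * (hG.toLp _) t =
        ∫ t : UnitAddTorus (Fin d), ((f (torusRep L t) * g (torusRep L t) : ℝ) : ℂ) := by
      refine integral_congr_ae ?_
      filter_upwards [hF.coeFn_toLp, hG.coeFn_toLp] with t h1 h2
      rw [h1, h2, Complex.conj_ofReal]
      push_cast
      rfl
    have hfg : AEStronglyMeasurable (fun x => f x * g x)
        (Measure.map (torusRep L) (volume : Measure (UnitAddTorus (Fin d)))) := by
      rw [hmp.map_eq]
      exact (hf.1.mul hg.1).smul_measure _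
    have h2 := integral_map hmp.measurable.aemeasurable hfg
    rw [hmp.map_eq, integral_smul_measure, ENNReal.toReal_ofReal (by positivity)] at h2
    rw [h1, integral_complex_ofReal, ← h2, smul_eq_mul]
  rw [hint] at hP
  have hne : ((2 * L : ℝ) : ℂ) ^ d ≠ 0 := by
    exact_mod_cast (by positivity : (2 * L) ^ d ≠ 0)
  have h5 := hP.mul_left (((2 * L : ℝ) : ℂ) ^ d * ((2 * L : ℝ) : ℂ) ^ d)
  push_cast at hne
  have e1 : ∀ n, (starRingEnd ℂ) (torusFourier L f n) * torusFourier L g n =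
      ((2 * L : ℝ) : ℂ) ^ d * ((2 * L : ℝ) : ℂ) ^ d *
        ((starRingEnd ℂ) (UnitAddTorus.mFourierCoeff (hF.toLp _) n) *
          UnitAddTorus.mFourierCoeff (hG.toLp _) n) := fun n => by
    rw [hc hf, hc hg]
    simp only [map_mul, map_inv₀, map_pow, Complex.conj_ofReal, map_ofNat]
    push_cast
    field_simp
  have e2 : (((2 * L) ^ d * ∫ x in torusBox d L, f x * g x : ℝ) : ℂ) =
      ((2 * L : ℝ) : ℂ) ^ d * ((2 * L : ℝ) : ℂ) ^ d *
        ((((2 * L) ^ d)⁻¹ * ∫ x in torusBox d L, f x * g x : ℝ) : ℂ) := by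
    push_cast
    field_simp
  rw [funext e1, e2]
  exact h5

end TorusFourier

/-! ### Periodization -/

section Periodization

variable {d : ℕ}

/-- The lattice vector `c n`. -/
def latticeVec (c : ℝ) (n : Fin d → ℤ) : EuclideanSpace ℝ (Fin d) :=
  WithLp.toLp 2 fun j => c * n j

@[simp] lemma latticeVec_apply (c : ℝ) (n : Fin d → ℤ) (j : Fin d) :
    latticeVec c n j = c * n j := rfl

lemma iUnion_translate_torusBox {L : ℝ} (hL : 0 < L) :
    ⋃ n : Fin d → ℤ, {x | x - latticeVec (2 * L) n ∈ torusBox d L} = Set.univ := by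
  refine Set.eq_univ_of_forall fun x => Set.mem_iUnion.2 ⟨fun j => ⌊(x j + L) / (2 * L)⌋, ?_⟩
  intro j
  have h1 := Int.floor_le ((x j + L) / (2 * L))
  have h2 := Int.lt_floor_add_one ((x j + L) / (2 * L))
  rw [le_div_iff₀ (by positivity)] at h1
  rw [div_lt_iff₀ (by positivity)] at h2
  simp only [PiLp.sub_apply, latticeVec_apply, Set.mem_Ico]
  constructor <;> linarith

lemma pairwise_disjoint_translate_torusBox {L : ℝ} (hL : 0 < L) :
    Pairwise (Function.onFun Disjoint
      fun n : Fin d → ℤ => {x | x - latticeVec (2 * L) n ∈ torusBox d L}) := by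
  intro n m hnm
  refine Set.disjoint_left.2 fun x hn hm => hnm (funext fun j => ?_)
  have h1 := hn j
  have h2 := hm j
  simp only [PiLp.sub_apply, latticeVec_apply, Set.mem_Ico] at h1 h2
  have h3 : (n j : ℝ) < m j + 1 := by nlinarith
  have h4 : (m j : ℝ) < n j + 1 := by nlinarith
  norm_cast at h3 h4
  omega

lemma hasSum_setIntegral_translate {F : Type*} [NormedAddCommGroup F] [NormedSpace ℝ F]
    {L : ℝ} (hL : 0 < L) {f : EuclideanSpace ℝ (Fin d) → F} (hf : Integrable f) :
    HasSum (fun n => ∫ x in torusBox d L, f (x + latticeVec (2 * L) n)) (∫ x, f x) := by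
  have hm : ∀ n : Fin d → ℤ, MeasurableSet {x | x - latticeVec (2 * L) n ∈ torusBox d L} :=
    fun n => (measurableSet_torusBox L).preimage (by fun_prop)
  have h := hasSum_integral_iUnion (μ := volume) (f := f) hm
    (pairwise_disjoint_translate_torusBox hL) hf.integrableOn
  rw [iUnion_translate_torusBox hL, setIntegral_univ] at h
  convert h using 2 with n
  have h2 := (measurePreserving_add_right volume (latticeVec (2 * L) n)).setIntegral_preimage_emb
    (measurableEmbedding_addRight _) f {x | x - latticeVec (2 * L) n ∈ torusBox d L}
  rw [← h2]
  congr 2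
  ext x
  simp

lemma setIntegral_tsum_translate {F : Type*} [NormedAddCommGroup F] [NormedSpace ℝ F]
    {L : ℝ} (hL : 0 < L) {f : EuclideanSpace ℝ (Fin d) → F} (hf : Integrable f) :
    ∫ x in torusBox d L, ∑' n, f (x + latticeVec (2 * L) n) = ∫ x, f x := by
  have h1 := hasSum_setIntegral_translate hL hf
  have h2 := hasSum_integral_of_summable_integral_norm (μ := volume.restrict (torusBox d L))
    (F := fun (n : Fin d → ℤ) x => f (x + latticeVec (2 * L) n))
    (fun n => (hf.comp_add_right _).integrableOn)
    (hasSum_setIntegral_translate hL hf.norm).summable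
  exact h2.unique h1

lemma tsum_translate_periodic {F : Type*} [AddCommMonoid F] [TopologicalSpace F] (L : ℝ)
    (f : EuclideanSpace ℝ (Fin d) → F) (x : EuclideanSpace ℝ (Fin d)) (m : Fin d → ℤ) :
    ∑' n, f (x + latticeVec (2 * L) m + latticeVec (2 * L) n) =
      ∑' n, f (x + latticeVec (2 * L) n) := by
  rw [← (Equiv.addLeft m).tsum_eq fun n => f (x + latticeVec (2 * L) n)]
  refine tsum_congr fun n => congrArg f ?_
  ext j
  simp
  ring

lemma finite_setOf_norm_latticeVec_le {c : ℝ} (hc : 0 < c) (R : ℝ) :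
    {n : Fin d → ℤ | ‖latticeVec c n‖ ≤ R}.Finite := by
  refine (Set.finite_Icc (fun _ : Fin d => -⌈R / c⌉) fun _ => ⌈R / c⌉).subset fun n hn => ?_
  have h : ∀ j, |(n j : ℝ)| ≤ ⌈R / c⌉ := fun j => by
    have h1 := (PiLp.norm_apply_le (latticeVec c n) j).trans hn
    rw [latticeVec_apply, Real.norm_eq_abs, abs_mul, abs_of_pos hc] at h1
    exact le_trans (by rwa [le_div_iff₀' hc]) (Int.le_ceil _)
  constructor <;> intro j
  · have := (abs_le.1 (h j)).1
    exact_mod_cast this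
  · have := (abs_le.1 (h j)).2
    exact_mod_cast this

/-- On a bounded set only finitely many translates matter, so periodizations reduce to finite sums
and no convergence question arises. -/
lemma exists_finset_translate_eq_zero {L : ℝ} (hL : 0 < L) {f : EuclideanSpace ℝ (Fin d) → ℝ}
    (hf : HasCompactSupport f) {K : Set (EuclideanSpace ℝ (Fin d))} (hK : Bornology.IsBounded K) :
    ∃ M : Finset (Fin d → ℤ), ∀ x ∈ K, ∀ n ∉ M, f (x + latticeVec (2 * L) n) = 0 := by
  obtain ⟨R, hR⟩ := hK.exists_norm_le
  obtain ⟨R', hR'⟩ := hf.isCompact.isBounded.exists_norm_le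
  refine ⟨(finite_setOf_norm_latticeVec_le (by positivity : 0 < 2 * L) (R + R')).toFinset,
    fun x hx n hn => ?_⟩
  by_contra h
  refine hn ((Set.Finite.mem_toFinset _).2 ?_)
  have h1 := hR' _ (subset_tsupport f h)
  have h2 := hR x hx
  calc ‖latticeVec (2 * L) n‖ = ‖(x + latticeVec (2 * L) n) - x‖ := by simp
    _ ≤ _ := norm_sub_le _ _
    _ ≤ R + R' := by linarith

lemma isBounded_torusBox (L : ℝ) : Bornology.IsBounded (torusBox d L) := by
  refine (Metric.isBounded_iff_subset_closedBall 0).2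
    ⟨Real.sqrt (∑ _ : Fin d, |L| ^ 2), fun x hx => ?_⟩
  rw [mem_closedBall_zero_iff, EuclideanSpace.norm_eq]
  refine Real.sqrt_le_sqrt (Finset.sum_le_sum fun j _ => ?_)
  have h := hx j
  gcongr
  rw [Real.norm_eq_abs]
  exact (abs_le.2 ⟨h.1, h.2.le⟩).trans (le_abs_self L)

lemma memLp_tsum_translate {L : ℝ} (hL : 0 < L) {f : EuclideanSpace ℝ (Fin d) → ℝ}
    (hf : HasCompactSupport f) (hf2 : MemLp f 2) :
    MemLp (fun x => ∑' n, f (x + latticeVec (2 * L) n)) 2 (volume.restrict (torusBox d L)) := by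
  obtain ⟨M, hM⟩ := exists_finset_translate_eq_zero hL hf (isBounded_torusBox (d := d) L)
  have h : MemLp (fun x => ∑ n ∈ M, f (x + latticeVec (2 * L) n)) 2
      (volume.restrict (torusBox d L)) :=
    memLp_finsetSum M fun n _ =>
      (hf2.comp_measurePreserving (measurePreserving_add_right volume _)).restrict _
  refine h.ae_eq ?_
  filter_upwards [ae_restrict_mem (measurableSet_torusBox L)] with x hx
  exact (tsum_eq_sum fun n hn => hM x hx n hn).symm

/-- Unfolding: the second factor is periodic, so the box integral against the periodized first
factor is an integral over the whole space against `f` alone. -/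
lemma hasSum_setIntegral_tsum_mul_tsum {L : ℝ} (hL : 0 < L)
    {f g : EuclideanSpace ℝ (Fin d) → ℝ} (hf : HasCompactSupport f) (hf2 : MemLp f 2)
    (hg : HasCompactSupport g) (hg2 : MemLp g 2) :
    HasSum (fun n => ∫ x, f x * g (x + latticeVec (2 * L) n))
      (∫ x in torusBox d L, (∑' n, f (x + latticeVec (2 * L) n)) *
        ∑' n, g (x + latticeVec (2 * L) n)) := by
  obtain ⟨M, hM⟩ := exists_finset_translate_eq_zero hL hg hf.isCompact.isBounded
  have hz : ∀ x, ∀ n ∉ M, f x * g (x + latticeVec (2 * L) n) = 0 := by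
    intro x n hn
    by_cases hx : x ∈ tsupport f
    · rw [hM x hx n hn, mul_zero]
    · rw [image_eq_zero_of_notMem_tsupport hx, zero_mul]
  have hint : ∀ n, Integrable fun x => f x * g (x + latticeVec (2 * L) n) := fun n =>
    hf2.integrable_mul (hg2.comp_measurePreserving (measurePreserving_add_right volume _))
  have hsum : ∀ x, f x * ∑' n, g (x + latticeVec (2 * L) n) =
      ∑ n ∈ M, f x * g (x + latticeVec (2 * L) n) := by
    intro x
    rw [← tsum_mul_left]
    exact tsum_eq_sum (hz x)
  have h1 : ∫ x in torusBox d L, (∑' n, f (x + latticeVec (2 * L) n)) *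
      ∑' n, g (x + latticeVec (2 * L) n) = ∫ x, f x * ∑' n, g (x + latticeVec (2 * L) n) := by
    rw [← setIntegral_tsum_translate hL]
    · congr 1
      ext x
      rw [← tsum_mul_right]
      exact tsum_congr fun n => by rw [tsum_translate_periodic]
    · simp_rw [hsum]
      exact integrable_finsetSum _ fun n _ => hint n
  rw [h1]
  simp_rw [hsum]
  rw [integral_finsetSum _ fun n _ => hint n]
  refine hasSum_sum_of_ne_finset_zero fun n hn => ?_
  simp [hz _ n hn]

/-- The frequencies in `(π/L) ℤ^d` are exactly those whose waves have period `2L`, so the wave can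
be moved inside the periodization and the integral unfolded. -/
lemma torusFourier_tsum_translate {L : ℝ} (hL : 0 < L) {f : EuclideanSpace ℝ (Fin d) → ℝ}
    (hf : Integrable f) (k : Fin d → ℤ) :
    torusFourier L (fun x => ∑' n, f (x + latticeVec (2 * L) n)) k =
      ∫ x, (f x : ℂ) * Complex.exp (-Complex.I *
        ((∑ j, Real.pi / L * k j * x j : ℝ) : ℂ)) := by
  rw [← setIntegral_tsum_translate hL]
  · refine setIntegral_congr_fun (measurableSet_torusBox L) fun x _ => ?_
    simp only [Complex.ofReal_tsum]
    rw [← tsum_mul_right]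
    refine tsum_congr fun n => ?_
    congr 1
    refine Complex.exp_eq_exp_iff_exists_int.2 ⟨∑ j, k j * n j, ?_⟩
    have hL' : (L : ℂ) ≠ 0 := by exact_mod_cast hL.ne'
    push_cast
    rw [Finset.mul_sum, Finset.mul_sum, Finset.sum_mul, ← Finset.sum_add_distrib]
    refine Finset.sum_congr rfl fun j _ => ?_
    simp only [PiLp.add_apply, latticeVec_apply]
    push_cast
    field_simp
    ring
  · refine hf.ofReal.mul_bdd (c := 1) (Continuous.aestronglyMeasurable (by fun_prop)) ?_
    refine Filter.Eventually.of_forall fun x => ?_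
    rw [neg_mul, mul_comm, ← neg_mul, ← Complex.ofReal_neg, Complex.norm_exp_ofReal_mul_I]

end Periodization

/-! ### Rescaled scaling functions -/

section Rescaled

variable {d : ℕ}

/-- The function `x ↦ s^{-d/2} φ((x - s z) / s)`. -/
def dilate (φ : EuclideanSpace ℝ (Fin d) → ℝ) (s : ℝ) (z : Fin d → ℤ)
    (x : EuclideanSpace ℝ (Fin d)) : ℝ :=
  s ^ (-(d : ℝ) / 2) * φ (s⁻¹ • (x - latticeVec s z))

lemma rescaledScaling_eq (φ : EuclideanSpace ℝ (Fin d) → ℝ) (ε L : ℝ) (N : ℕ) (z : Fin d → ℤ) :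
    rescaledScaling φ ε L N z =
      fun y => ∑' n, dilate φ (spacing ε N) z (y + latticeVec (2 * L) n) := by
  ext y
  refine tsum_congr fun n => ?_
  rw [dilate]
  congr 2
  ext j
  simp only [PiLp.smul_apply, PiLp.sub_apply, PiLp.add_apply, latticeVec_apply, smul_eq_mul]
  rw [div_eq_inv_mul]
  ring

lemma measurePreserving_affine {s : ℝ} (hs : 0 < s) (v : EuclideanSpace ℝ (Fin d)) :
    MeasurePreserving (fun x => s⁻¹ • (x - v)) volume (ENNReal.ofReal (s ^ d) • volume) := by
  have h1 : MeasurePreserving (fun x : EuclideanSpace ℝ (Fin d) => s⁻¹ • x) volume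
      (ENNReal.ofReal (s ^ d) • volume) := by
    refine ⟨by fun_prop, ?_⟩
    rw [Measure.map_addHaar_smul _ (by positivity), abs_of_pos (by positivity)]
    simp
  exact h1.comp (measurePreserving_sub_right volume v)

lemma integral_comp_affine {F : Type*} [NormedAddCommGroup F] [NormedSpace ℝ F] {s : ℝ}
    (hs : 0 < s) (v : EuclideanSpace ℝ (Fin d)) (G : EuclideanSpace ℝ (Fin d) → F) :
    ∫ x, G (s⁻¹ • (x - v)) = s ^ d • ∫ x, G x := by
  rw [integral_sub_right_eq_self (fun x => G (s⁻¹ • x)) v, Measure.integral_comp_smul]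
  simp [abs_of_pos hs]

lemma spacing_pos {ε : ℝ} (hε : 0 < ε) (N : ℕ) : 0 < spacing ε N := by
  unfold spacing; positivity

variable {φ : EuclideanSpace ℝ (Fin d) → ℝ} {s : ℝ}

lemma hasCompactSupport_dilate (hφ : HasCompactSupport φ) (hs : 0 < s) (z : Fin d → ℤ) :
    HasCompactSupport (dilate φ s z) :=
  (hφ.comp_homeomorph ((Homeomorph.subRight (latticeVec s z)).trans
    (Homeomorph.smulOfNeZero s⁻¹ (inv_ne_zero hs.ne')))).mul_left (f := fun _ => s ^ (-(d : ℝ) / 2))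

lemma memLp_dilate (hφ : MemLp φ 2) (hs : 0 < s) (z : Fin d → ℤ) : MemLp (dilate φ s z) 2 :=
  ((hφ.smul_measure ENNReal.ofReal_ne_top).comp_measurePreserving
    (measurePreserving_affine hs (latticeVec s z))).const_mul _

lemma integrable_of_memLp_two (hφ : HasCompactSupport φ) (hφ2 : MemLp φ 2) : Integrable φ := by
  have h : IntegrableOn φ (tsupport φ) := by
    have : IsFiniteMeasure (volume.restrict (tsupport φ)) :=
      ⟨by simpa using hφ.isCompact.measure_lt_top⟩
    exact (hφ2.restrict _).integrable (by norm_num)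
  exact (integrableOn_iff_integrable_of_support_subset (subset_tsupport φ)).1 h

lemma memLp_rescaledScaling (hφ : HasCompactSupport φ) (hφ2 : MemLp φ 2) {ε L : ℝ} (hε : 0 < ε)
    (hL : 0 < L) (N : ℕ) (z : Fin d → ℤ) :
    MemLp (rescaledScaling φ ε L N z) 2 (volume.restrict (torusBox d L)) := by
  rw [rescaledScaling_eq]
  exact memLp_tsum_translate hL (hasCompactSupport_dilate hφ (spacing_pos hε N) z)
    (memLp_dilate hφ2 (spacing_pos hε N) z)

lemma fourier_ofReal_eq (φ : EuclideanSpace ℝ (Fin d) → ℝ) (w : EuclideanSpace ℝ (Fin d)) :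
    FourierTransform.fourier (fun x => (φ x : ℂ)) w =
      ∫ x, (φ x : ℂ) * Complex.exp (-Complex.I * ((∑ j, 2 * Real.pi * w j * x j : ℝ) : ℂ)) := by
  rw [Real.fourier_eq']
  refine integral_congr_ae (Filter.Eventually.of_forall fun x => ?_)
  simp only [smul_eq_mul]
  rw [mul_comm]
  congr 2
  rw [PiLp.inner_apply]
  push_cast
  rw [Finset.mul_sum, Finset.mul_sum, Finset.sum_mul]
  refine Finset.sum_congr rfl fun j _ => ?_
  simp only [RCLike.inner_apply, conj_trivial]
  push_cast
  ring

/-- The Fourier transform here has kernel `e^{-2πi⟨w, x⟩}`, so the momentum `(π/L) k` is `w = k /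
(2L)`; the dilation by `ε_N` multiplies it by `ε_N`. -/
lemma torusFourier_rescaledScaling (hφ : HasCompactSupport φ) (hφ2 : MemLp φ 2) {ε L : ℝ}
    (hε : 0 < ε) (hL : 0 < L) (N : ℕ) (z k : Fin d → ℤ) :
    torusFourier L (rescaledScaling φ ε L N z) k =
      ((spacing ε N ^ ((d : ℝ) / 2) : ℝ) : ℂ) *
        Complex.exp (-Complex.I * ((∑ j, Real.pi / L * k j * (spacing ε N * z j) : ℝ) : ℂ)) *
        FourierTransform.fourier (fun x => (φ x : ℂ)) (latticeVec (spacing ε N / (2 * L)) k) := by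
  have hs := spacing_pos hε N
  set s := spacing ε N
  rw [rescaledScaling_eq, torusFourier_tsum_translate hL (integrable_of_memLp_two
    (hasCompactSupport_dilate hφ hs z) (memLp_dilate hφ2 hs z)), fourier_ofReal_eq]
  have h := integral_comp_affine hs (latticeVec s z) fun y : EuclideanSpace ℝ (Fin d) =>
    ((s ^ (-(d : ℝ) / 2) * φ y : ℝ) : ℂ) * Complex.exp (-Complex.I *
        ((∑ j, Real.pi / L * k j * (s * y j + s * z j) : ℝ) : ℂ))
  have h1 : ∀ x : EuclideanSpace ℝ (Fin d), ∀ j,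
      s * (s⁻¹ • (x - latticeVec s z)) j + s * z j = x j := fun x j => by
    simp only [PiLp.smul_apply, PiLp.sub_apply, latticeVec_apply, smul_eq_mul]
    field_simp
    ring
  simp_rw [h1] at h
  refine h.trans ?_
  have hpow : s ^ d * s ^ (-(d : ℝ) / 2) = s ^ ((d : ℝ) / 2) := by
    rw [← Real.rpow_natCast, ← Real.rpow_add hs]
    congr 1
    ring
  rw [← hpow, Complex.real_smul, Complex.ofReal_mul, mul_assoc, mul_assoc]
  simp only [← integral_const_mul]
  refine integral_congr_ae (Filter.Eventually.of_forall fun y => ?_)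
  beta_reduce
  rw [Complex.ofReal_mul, mul_assoc, mul_left_comm (Complex.exp _), ← Complex.exp_add]
  congr 4
  rw [← mul_add, ← Complex.ofReal_add, ← Finset.sum_add_distrib]
  congr 2
  refine Finset.sum_congr rfl fun j _ => ?_
  rw [latticeVec_apply]
  field_simp
  ring

/-- In units of the spacing the period is `R` sites, so periodic images become integer shifts, to
which the orthonormality of `φ` applies. -/
lemma integral_dilate_mul_dilate (hs : 0 < s) (z z' m : Fin d → ℤ) {L : ℝ} {R : ℤ}
    (hR : 2 * L = s * R) :
    ∫ x, dilate φ s z x * dilate φ s z' (x + latticeVec (2 * L) m) =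
      ∫ x, φ x * φ (WithLp.toLp 2 fun j => x j - ((z' - z - R • m) j : ℤ)) := by
  have h := integral_comp_affine hs (latticeVec s z) fun y : EuclideanSpace ℝ (Fin d) =>
    (s ^ d)⁻¹ * (φ y * φ (WithLp.toLp 2 fun j => y j - ((z' - z - R • m) j : ℤ)))
  have h2 : s ^ d • ∫ y : EuclideanSpace ℝ (Fin d),
      (s ^ d)⁻¹ * (φ y * φ (WithLp.toLp 2 fun j => y j - ((z' - z - R • m) j : ℤ))) =
      ∫ x, φ x * φ (WithLp.toLp 2 fun j => x j - ((z' - z - R • m) j : ℤ)) := by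
    rw [integral_const_mul, smul_eq_mul, ← mul_assoc, mul_inv_cancel₀ (by positivity), one_mul]
  rw [← h2, ← h]
  congr 1
  ext x
  have hp : s ^ (-(d : ℝ) / 2) * s ^ (-(d : ℝ) / 2) = (s ^ d)⁻¹ := by
    rw [← Real.rpow_add hs, ← Real.rpow_natCast, ← Real.rpow_neg hs.le]
    congr 1
    ring
  rw [dilate, dilate, ← hp]
  have : (s⁻¹ • (x + latticeVec (2 * L) m - latticeVec s z')) = WithLp.toLp 2 fun j =>
      (s⁻¹ • (x - latticeVec s z)) j - ((z' - z - R • m) j : ℤ) := by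
    ext j
    simp only [PiLp.smul_apply, PiLp.sub_apply, PiLp.add_apply, latticeVec_apply, smul_eq_mul,
      Pi.sub_apply, Pi.smul_apply, hR]
    push_cast
    field_simp
    ring
  rw [this]
  ring

lemma two_mul_eq_spacing_mul (ε : ℝ) (r N : ℕ) :
    2 * (ε * r) = spacing ε N * ((2 * (2 ^ N * r) : ℤ) : ℝ) := by
  unfold spacing
  push_cast
  field_simp

/-- The functions `φ^{(ε_N)}_x`, `x ∈ Λ_N`, are orthonormal on the torus. -/
lemma setIntegral_rescaledScaling_mul {h : (Fin d → ℤ) →₀ ℝ} (hφ : IsScalingFunction φ h) {ε : ℝ}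
    (hε : 0 < ε) {r : ℕ} (hr : 0 < r) (N : ℕ) (x x' : LatticeSite d r N) :
    ∫ y in torusBox d (ε * r), rescaledScaling φ ε (ε * r) N (fun j => (x j : ℤ)) y *
      rescaledScaling φ ε (ε * r) N (fun j => (x' j : ℤ)) y = if x = x' then 1 else 0 := by
  have hs := spacing_pos hε N
  have hL : 0 < ε * r := by positivity
  rw [rescaledScaling_eq, rescaledScaling_eq]
  have H := hasSum_setIntegral_tsum_mul_tsum hL
    (hasCompactSupport_dilate hφ.compactSupport hs fun j => (x j : ℤ))
    (memLp_dilate hφ.memLp hs _)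
    (hasCompactSupport_dilate hφ.compactSupport hs fun j => (x' j : ℤ))
    (memLp_dilate hφ.memLp hs _)
  refine H.unique ?_
  simp_rw [integral_dilate_mul_dilate hs _ _ _ (two_mul_eq_spacing_mul ε r N), hφ.orthonormal]
  have hRpos : 0 < (2 : ℤ) ^ N * r := by positivity
  -- Coordinates of lattice sites lie in a half-open window of one period, so two of them differ by
  -- less than a period: only `m = 0` can contribute.
  have key : ∀ m : Fin d → ℤ, ((fun j => (x' j : ℤ)) - (fun j => (x j : ℤ)) -
      (2 * (2 ^ N * (r : ℤ))) • m = 0) ↔ m = 0 ∧ x = x' := by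
    intro m
    constructor
    · intro h0
      have hm : ∀ j, m j = 0 ∧ (x' j : ℤ) = x j := fun j => by
        have hj := congrFun h0 j
        simp only [Pi.sub_apply, Pi.smul_apply, smul_eq_mul, Pi.zero_apply] at hj
        have h1 := Finset.mem_Ico.1 (x j).2
        have h2 := Finset.mem_Ico.1 (x' j).2
        have h3 : m j = 0 := by
          by_contra hne
          rcases lt_or_gt_of_ne hne with hlt | hlt
          · have : (2 * (2 ^ N * (r : ℤ))) * m j ≤ (2 * (2 ^ N * (r : ℤ))) * (-1) :=
              mul_le_mul_of_nonneg_left (by omega) (by positivity)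
            linarith
          · have : (2 * (2 ^ N * (r : ℤ))) * 1 ≤ (2 * (2 ^ N * (r : ℤ))) * m j :=
              mul_le_mul_of_nonneg_left (by omega) (by positivity)
            linarith
        rw [h3] at hj
        exact ⟨h3, by linarith⟩
      exact ⟨funext fun j => (hm j).1, funext fun j => Subtype.ext (hm j).2.symm⟩
    · rintro ⟨rfl, rfl⟩
      simp
  simp_rw [key]
  by_cases hx : x = x'
  · simp only [hx, and_true, if_true]
    exact hasSum_ite_eq 0 1
  · simp only [hx, and_false, if_false]
    exact hasSum_zero

/-- The Fourier transform of the scaling equation. -/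
lemma fourier_scaling_eq {h : (Fin d → ℤ) →₀ ℝ} (hφ : IsScalingFunction φ h)
    (w : EuclideanSpace ℝ (Fin d)) :
    FourierTransform.fourier (fun x => (φ x : ℂ)) ((2 : ℝ) • w) =
      (((2 : ℝ) ^ (-(d : ℝ) / 2) : ℝ) : ℂ) * (h.sum fun n c => (c : ℂ) *
        Complex.exp (-Complex.I * ((∑ j, 2 * Real.pi * w j * n j : ℝ) : ℂ))) *
        FourierTransform.fourier (fun x => (φ x : ℂ)) w := by
  have hint := integrable_of_memLp_two hφ.compactSupport hφ.memLp
  rw [fourier_ofReal_eq, fourier_ofReal_eq]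
  have hterm : ∀ n : Fin d → ℤ,
      Integrable (fun x : EuclideanSpace ℝ (Fin d) =>
        (φ (((1 / 2 : ℝ))⁻¹ • (x - latticeVec (1 / 2) n)) : ℂ) * Complex.exp (-Complex.I *
        ((∑ j, 2 * Real.pi * ((2 : ℝ) • w) j * x j : ℝ) : ℂ))) ∧
      ∫ x : EuclideanSpace ℝ (Fin d),
        (φ (((1 / 2 : ℝ))⁻¹ • (x - latticeVec (1 / 2) n)) : ℂ) * Complex.exp (-Complex.I *
        ((∑ j, 2 * Real.pi * ((2 : ℝ) • w) j * x j : ℝ) : ℂ)) =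
      (((2 : ℝ) ^ (-(d : ℝ)) : ℝ) : ℂ) *
        Complex.exp (-Complex.I * ((∑ j, 2 * Real.pi * w j * n j : ℝ) : ℂ)) *
        ∫ x, (φ x : ℂ) * Complex.exp (-Complex.I * ((∑ j, 2 * Real.pi * w j * x j : ℝ) : ℂ)) := by
    intro n
    constructor
    · refine Integrable.mul_bdd (c := 1) ?_ (Continuous.aestronglyMeasurable (by fun_prop)) ?_
      · have := (measurePreserving_affine (d := d) (one_half_pos (α := ℝ)) (latticeVec (1 / 2) n))
        exact this.integrable_comp_of_integrable
          (hint.smul_measure ENNReal.ofReal_ne_top).ofReal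
      · refine Filter.Eventually.of_forall fun x => ?_
        rw [neg_mul, mul_comm, ← neg_mul, ← Complex.ofReal_neg, Complex.norm_exp_ofReal_mul_I]
    · have h := integral_comp_affine (one_half_pos (α := ℝ)) (latticeVec (1 / 2) n)
        fun y : EuclideanSpace ℝ (Fin d) => (φ y : ℂ) * Complex.exp (-Complex.I *
        ((∑ j, 2 * Real.pi * w j * (y j + n j) : ℝ) : ℂ))
      have h1 : ∀ x : EuclideanSpace ℝ (Fin d),
          ∑ j, 2 * Real.pi * w j * (((1 / 2 : ℝ)⁻¹ • (x - latticeVec (1 / 2) n)) j + n j) =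
          ∑ j, 2 * Real.pi * ((2 : ℝ) • w) j * x j := fun x => by
        refine Finset.sum_congr rfl fun j _ => ?_
        simp only [PiLp.smul_apply, PiLp.sub_apply, latticeVec_apply, smul_eq_mul]
        ring
      simp_rw [h1] at h
      refine h.trans ?_
      have hp : ((1 / 2 : ℝ)) ^ d = 2 ^ (-(d : ℝ)) := by
        rw [Real.rpow_neg two_pos.le, Real.rpow_natCast, one_div, inv_pow]
      rw [Complex.real_smul, hp, mul_assoc]
      simp only [← integral_const_mul]
      refine integral_congr_ae (Filter.Eventually.of_forall fun y => ?_)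
      beta_reduce
      rw [mul_left_comm (Complex.exp _), ← Complex.exp_add]
      congr 3
      rw [← mul_add, ← Complex.ofReal_add, ← Finset.sum_add_distrib]
      congr 2
      refine Finset.sum_congr rfl fun j _ => ?_
      ring
  have hval : ∀ (n : Fin d → ℤ) (x : EuclideanSpace ℝ (Fin d)),
      (WithLp.toLp 2 fun j => 2 * x j - n j : EuclideanSpace ℝ (Fin d)) =
        ((1 / 2 : ℝ))⁻¹ • (x - latticeVec (1 / 2) n) := by
    intro n x
    ext j
    simp only [PiLp.smul_apply, PiLp.sub_apply, latticeVec_apply, smul_eq_mul]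
    ring
  have hae : ∫ x, (φ x : ℂ) * Complex.exp (-Complex.I *
        ((∑ j, 2 * Real.pi * ((2 : ℝ) • w) j * x j : ℝ) : ℂ)) =
      ∫ x : EuclideanSpace ℝ (Fin d), ∑ n ∈ h.support,
        ((h n * 2 ^ ((d : ℝ) / 2) : ℝ) : ℂ) *
        ((φ (((1 / 2 : ℝ))⁻¹ • (x - latticeVec (1 / 2) n)) : ℂ) * Complex.exp (-Complex.I *
        ((∑ j, 2 * Real.pi * ((2 : ℝ) • w) j * x j : ℝ) : ℂ))) := by
    refine integral_congr_ae ?_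
    filter_upwards [hφ.scaling_eq] with x hx
    nth_rewrite 1 [hx]
    rw [Finsupp.sum, Complex.ofReal_sum, Finset.sum_mul]
    refine Finset.sum_congr rfl fun n _ => ?_
    rw [hval]
    push_cast
    ring
  rw [hae, integral_finsetSum _ fun n _ => ((hterm n).1.const_mul _)]
  simp_rw [integral_const_mul, (hterm _).2]
  rw [Finsupp.sum, Finset.mul_sum, Finset.sum_mul]
  refine Finset.sum_congr rfl fun n _ => ?_
  have hp : (2 : ℝ) ^ ((d : ℝ) / 2) * 2 ^ (-(d : ℝ)) = 2 ^ (-(d : ℝ) / 2) := by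
    rw [← Real.rpow_add two_pos]
    congr 1
    ring
  rw [← hp]
  push_cast
  ring

end Rescaled

/-! ### The smearing map -/

section Smearing

variable {d r N : ℕ} {φ : EuclideanSpace ℝ (Fin d) → ℝ} {ε : ℝ}

/-- The function `ε_N^{d/2} ∑_{x ∈ Λ_N} q(x) φ^{(ε_N)}_x` on the torus. -/
def smearReal (φ : EuclideanSpace ℝ (Fin d) → ℝ) (ε : ℝ) (q : LatticeSite d r N → ℝ)
    (y : EuclideanSpace ℝ (Fin d)) : ℝ :=
  spacing ε N ^ ((d : ℝ) / 2) *
    ∑ x : LatticeSite d r N, q x * rescaledScaling φ ε (ε * r) N (fun j => (x j : ℤ)) y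

lemma smearedFun_re (ξ : LatticeSpace d r N) :
    (fun y => (smearedFun φ ε ξ y).re) = smearReal φ ε (fieldPart ε ξ) := by
  ext y
  simp [smearedFun, smearReal, Complex.re_sum]

lemma smearedFun_im (ξ : LatticeSpace d r N) :
    (fun y => (smearedFun φ ε ξ y).im) = smearReal φ ε (momentumPart ε ξ) := by
  ext y
  simp [smearedFun, smearReal, Complex.im_sum]

lemma memLp_smearReal (hφ : HasCompactSupport φ) (hφ2 : MemLp φ 2) (hε : 0 < ε) (hr : 0 < r)
    (q : LatticeSite d r N → ℝ) :
    MemLp (smearReal φ ε q) 2 (volume.restrict (torusBox d (ε * r))) := by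
  have h := fun x : LatticeSite d r N => (memLp_rescaledScaling hφ hφ2 hε
    (by positivity : 0 < ε * r) N (fun j => (x j : ℤ))).const_mul (q x)
  exact (memLp_finsetSum Finset.univ fun x _ => h x).const_mul _

lemma setIntegral_smearReal_mul {h : (Fin d → ℤ) →₀ ℝ} (hφ : IsScalingFunction φ h)
    (hε : 0 < ε) (hr : 0 < r) (q p : LatticeSite d r N → ℝ) :
    ∫ y in torusBox d (ε * r), smearReal φ ε q y * smearReal φ ε p y =
      spacing ε N ^ d * ∑ x, q x * p x := by
  have hs := spacing_pos hε N
  have hmem := fun x : LatticeSite d r N =>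
    memLp_rescaledScaling hφ.compactSupport hφ.memLp hε (by positivity : 0 < ε * r) N
      (fun j => (x j : ℤ))
  have hp : spacing ε N ^ ((d : ℝ) / 2) * spacing ε N ^ ((d : ℝ) / 2) = spacing ε N ^ d := by
    rw [← Real.rpow_add hs, ← Real.rpow_natCast]
    congr 1
    ring
  have he : ∀ y, smearReal φ ε q y * smearReal φ ε p y = spacing ε N ^ d *
      ∑ x : LatticeSite d r N, ∑ x' : LatticeSite d r N, q x * p x' *
        (rescaledScaling φ ε (ε * r) N (fun j => (x j : ℤ)) y *
          rescaledScaling φ ε (ε * r) N (fun j => (x' j : ℤ)) y) := by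
    intro y
    rw [smearReal, smearReal, mul_mul_mul_comm, hp, Finset.sum_mul_sum]
    congr 1
    refine Finset.sum_congr rfl fun x _ => Finset.sum_congr rfl fun x' _ => ?_
    ring
  have hint : ∀ x x' : LatticeSite d r N, Integrable (fun y => q x * p x' *
      (rescaledScaling φ ε (ε * r) N (fun j => (x j : ℤ)) y *
        rescaledScaling φ ε (ε * r) N (fun j => (x' j : ℤ)) y))
      (volume.restrict (torusBox d (ε * r))) := fun x x' =>
    ((hmem x).integrable_mul (hmem x')).const_mul _
  simp_rw [he]
  rw [integral_const_mul, integral_finsetSum _ fun x _ => integrable_finsetSum _ fun x' _ =>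
    hint x x']
  congr 1
  refine Finset.sum_congr rfl fun x _ => ?_
  rw [integral_finsetSum _ fun x' _ => hint x x']
  simp_rw [integral_const_mul, setIntegral_rescaledScaling_mul hφ hε hr]
  simp

instance isFiniteMeasure_restrict_torusBox (L : ℝ) :
    IsFiniteMeasure ((volume : Measure (EuclideanSpace ℝ (Fin d))).restrict (torusBox d L)) :=
  ⟨by simpa using (isBounded_torusBox (d := d) L).measure_lt_top⟩

lemma integrable_mul_exp {L : ℝ} {f : EuclideanSpace ℝ (Fin d) → ℝ}
    (hf : MemLp f 2 (volume.restrict (torusBox d L))) (n : Fin d → ℤ) :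
    Integrable (fun x => (f x : ℂ) * Complex.exp (-Complex.I *
      ((∑ j, Real.pi / L * n j * x j : ℝ) : ℂ))) (volume.restrict (torusBox d L)) := by
  refine Integrable.mul_bdd (c := 1) (hf.integrable (by norm_num)).ofReal
    (Continuous.aestronglyMeasurable (by fun_prop)) (Filter.Eventually.of_forall fun x => ?_)
  rw [neg_mul, mul_comm, ← neg_mul, ← Complex.ofReal_neg, Complex.norm_exp_ofReal_mul_I]

/-- The plane wave `e^{-ik·x}` at the lattice point `x = s z`, for `k = (π/L) n`. -/
def latticeWave (L s : ℝ) (n z : Fin d → ℤ) : ℂ :=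
  Complex.exp (-Complex.I * ((∑ j, Real.pi / L * n j * (s * z j) : ℝ) : ℂ))

lemma norm_latticeWave (L s : ℝ) (n z : Fin d → ℤ) : ‖latticeWave L s n z‖ = 1 := by
  rw [latticeWave, neg_mul, mul_comm, ← neg_mul, ← Complex.ofReal_neg,
    Complex.norm_exp_ofReal_mul_I]

lemma latticeWave_add (L s : ℝ) (n z z' : Fin d → ℤ) :
    latticeWave L s n (z + z') = latticeWave L s n z * latticeWave L s n z' := by
  rw [latticeWave, latticeWave, latticeWave, ← Complex.exp_add, ← mul_add, ← Complex.ofReal_add,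
    ← Finset.sum_add_distrib]
  congr 3
  refine Finset.sum_congr rfl fun j _ => ?_
  simp only [Pi.add_apply]
  push_cast
  ring

/-- Waves of period `2L` are well defined on sites modulo `R`; this matches the modular index of `δ`
in the scaling map. -/
lemma latticeWave_congr {L s : ℝ} (hL : 0 < L) {R : ℤ} (hR : 2 * L = s * R) (n : Fin d → ℤ)
    {z z' : Fin d → ℤ} (h : ∀ j, z j ≡ z' j [ZMOD R]) :
    latticeWave L s n z = latticeWave L s n z' := by
  choose m hm using fun j => (Int.modEq_iff_dvd.1 (h j))
  have hz' : z' = z + fun j => R * m j := by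
    ext j
    simp only [Pi.add_apply, ← hm]
    ring
  rw [hz', latticeWave_add]
  have : latticeWave L s n (fun j => R * m j) = 1 := by
    rw [latticeWave]
    refine Complex.exp_eq_one_iff.2 ⟨-∑ j, n j * m j, ?_⟩
    have : ∑ j, Real.pi / L * n j * (s * ((R * m j : ℤ) : ℝ)) =
        2 * Real.pi * ∑ j, (n j * m j : ℝ) := by
      rw [Finset.mul_sum]
      refine Finset.sum_congr rfl fun j _ => ?_
      push_cast
      rw [← mul_assoc s, ← hR]
      field_simp
    rw [this]
    push_cast
    ring
  rw [this, mul_one]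

lemma torusFourier_smearReal (hφ : HasCompactSupport φ) (hφ2 : MemLp φ 2) (hε : 0 < ε)
    (hr : 0 < r) (q : LatticeSite d r N → ℝ) (n : Fin d → ℤ) :
    torusFourier (ε * r) (smearReal φ ε q) n = ((spacing ε N ^ d : ℝ) : ℂ) *
      (∑ x, (q x : ℂ) * latticeWave (ε * r) (spacing ε N) n (fun j => (x j : ℤ))) *
      FourierTransform.fourier (fun x => (φ x : ℂ))
        (latticeVec (spacing ε N / (2 * (ε * r))) n) := by
  have hs := spacing_pos hε N
  have hL : 0 < ε * r := by positivity
  have h1 : torusFourier (ε * r) (smearReal φ ε q) n =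
      ((spacing ε N ^ ((d : ℝ) / 2) : ℝ) : ℂ) * ∑ x : LatticeSite d r N, (q x : ℂ) *
        torusFourier (ε * r) (rescaledScaling φ ε (ε * r) N fun j => (x j : ℤ)) n := by
    unfold torusFourier
    simp_rw [← integral_const_mul]
    rw [← integral_finsetSum]
    · rw [← integral_const_mul]
      congr 1
      ext y
      rw [smearReal, Complex.ofReal_mul, Complex.ofReal_sum, mul_assoc, Finset.sum_mul]
      congr 1
      refine Finset.sum_congr rfl fun x _ => ?_
      push_cast
      ring
    · intro x _
      exact (integrable_mul_exp (memLp_rescaledScaling hφ hφ2 hε hL N _) n).const_mul _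
  have hp : spacing ε N ^ d = spacing ε N ^ ((d : ℝ) / 2) * spacing ε N ^ ((d : ℝ) / 2) := by
    rw [← Real.rpow_add hs, ← Real.rpow_natCast]
    congr 1
    ring
  rw [h1, hp, Complex.ofReal_mul, mul_assoc, mul_assoc, Finset.sum_mul, Finset.mul_sum,
    Finset.mul_sum, Finset.mul_sum]
  refine Finset.sum_congr rfl fun x _ => ?_
  rw [torusFourier_rescaledScaling hφ hφ2 hε hL, latticeWave]
  ring

lemma existsUnique_latticeSite (hr : 0 < r) (z : Fin d → ℤ) :
    ∃! x : LatticeSite d r N, ∀ j, z j ≡ (x j : ℤ) [ZMOD 2 * (2 ^ N * r)] := by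
  have hM : 0 < (2 : ℤ) ^ N * r := by positivity
  refine ⟨fun j => ⟨(z j + 2 ^ N * r) % (2 * (2 ^ N * r)) - 2 ^ N * r, ?_⟩, ?_, ?_⟩
  · have h1 := Int.emod_nonneg (z j + 2 ^ N * r) (by positivity : (2 * (2 ^ N * r) : ℤ) ≠ 0)
    have h2 := Int.emod_lt_of_pos (z j + 2 ^ N * r) (by positivity : 0 < (2 * (2 ^ N * r) : ℤ))
    rw [Finset.mem_Ico]
    constructor <;> linarith
  · intro j
    have := (Int.mod_modEq (z j + 2 ^ N * r) (2 * (2 ^ N * r))).symm.sub_right (2 ^ N * r)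
    simpa using this
  · intro y hy
    funext j
    apply Subtype.ext
    have h1 := Finset.mem_Ico.1 (y j).2
    have h2 : (z j + 2 ^ N * r) % (2 * (2 ^ N * r)) = (y j : ℤ) + 2 ^ N * r := by
      have h3 := (hy j).add_right (2 ^ N * r)
      rw [h3.eq]
      exact Int.emod_eq_of_lt (by linarith) (by linarith)
    simp only [h2]
    ring

/-- The scaling map is upsampling followed by periodic convolution with `h`, so on the discrete
Fourier side it multiplies by the symbol of `h`. -/
lemma sum_scaleFun_mul_latticeWave (hε : 0 < ε) (hr : 0 < r) (h : (Fin d → ℤ) →₀ ℝ)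
    (q : LatticeSite d r N → ℝ) (n : Fin d → ℤ) :
    ∑ x : LatticeSite d r (N + 1), (scaleFun h q x : ℂ) *
        latticeWave (ε * r) (spacing ε (N + 1)) n (fun j => (x j : ℤ)) =
      (((2 : ℝ) ^ ((d : ℝ) / 2) : ℝ) : ℂ) *
        (∑ x, (q x : ℂ) * latticeWave (ε * r) (spacing ε N) n (fun j => (x j : ℤ))) *
        h.sum fun k c => (c : ℂ) * latticeWave (ε * r) (spacing ε (N + 1)) n k := by
  have hL : 0 < ε * r := by positivity
  have hpt : ∀ (x' : LatticeSite d r N) (k : Fin d → ℤ) (c : ℝ),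
      ∑ x : LatticeSite d r (N + 1),
        ((if ∀ j, (2 * (x' j : ℤ) + k j) ≡ (x j : ℤ) [ZMOD 2 * (2 ^ (N + 1) * r)] then c else 0 :
          ℝ) : ℂ) * latticeWave (ε * r) (spacing ε (N + 1)) n (fun j => (x j : ℤ)) =
      (c : ℂ) * (latticeWave (ε * r) (spacing ε N) n (fun j => (x' j : ℤ)) *
        latticeWave (ε * r) (spacing ε (N + 1)) n k) := by
    intro x' k c
    obtain ⟨x, hx, huniq⟩ := existsUnique_latticeSite (N := N + 1) hr
      fun j => 2 * (x' j : ℤ) + k j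
    rw [Finset.sum_eq_single x]
    · rw [if_pos hx, ← latticeWave_congr hL (two_mul_eq_spacing_mul ε r (N + 1)) n hx]
      have : (fun j => 2 * (x' j : ℤ) + k j) = (fun j => 2 * (x' j : ℤ)) + k := rfl
      rw [this, latticeWave_add]
      congr 2
      rw [latticeWave, latticeWave]
      congr 3
      refine Finset.sum_congr rfl fun j _ => ?_
      simp only [spacing, pow_succ]
      push_cast
      field_simp
    · intro y _ hy
      rw [if_neg fun hy' => hy (huniq y hy')]
      simp
    · simp
  simp_rw [scaleFun, Finsupp.sum, Complex.ofReal_mul, Complex.ofReal_sum, Complex.ofReal_mul,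
    Complex.ofReal_sum, mul_assoc]
  rw [← Finset.mul_sum]
  congr 1
  simp_rw [Finset.sum_mul, Finset.mul_sum]
  rw [Finset.sum_comm]
  refine Finset.sum_congr rfl fun x' _ => ?_
  simp_rw [Finset.sum_mul, mul_assoc]
  rw [Finset.sum_comm]
  refine Finset.sum_congr rfl fun k _ => ?_
  rw [← Finset.mul_sum, hpt]
  ring

/-- The symbol produced by `scaleFun` at level `N + 1` is the one by which the scaling equation
expresses `φ̂` at the doubled frequency. The powers of two balance because `ε_N = 2 ε_{N+1}`. -/
lemma torusFourier_smearReal_scaleFun {h : (Fin d → ℤ) →₀ ℝ} (hφ : IsScalingFunction φ h)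
    (hε : 0 < ε) (hr : 0 < r) (q : LatticeSite d r N → ℝ) (n : Fin d → ℤ) :
    torusFourier (ε * r) (smearReal φ ε (scaleFun h q)) n =
      torusFourier (ε * r) (smearReal φ ε q) n := by
  rw [torusFourier_smearReal hφ.compactSupport hφ.memLp hε hr,
    torusFourier_smearReal hφ.compactSupport hφ.memLp hε hr,
    sum_scaleFun_mul_latticeWave hε hr]
  have hsp : spacing ε N = 2 * spacing ε (N + 1) := by
    simp only [spacing, pow_succ]
    field_simp
  have hv : latticeVec (spacing ε N / (2 * (ε * r))) n =
      (2 : ℝ) • latticeVec (spacing ε (N + 1) / (2 * (ε * r))) n := by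
    ext j
    simp only [latticeVec_apply, PiLp.smul_apply, smul_eq_mul, hsp]
    ring
  rw [hv, fourier_scaling_eq hφ]
  have hw : ∀ k : Fin d → ℤ, Complex.exp (-Complex.I * ((∑ j, 2 * Real.pi *
      latticeVec (spacing ε (N + 1) / (2 * (ε * r))) n j * k j : ℝ) : ℂ)) =
      latticeWave (ε * r) (spacing ε (N + 1)) n k := by
    intro k
    rw [latticeWave]
    congr 3
    refine Finset.sum_congr rfl fun j _ => ?_
    rw [latticeVec_apply]
    field_simp
  simp_rw [hw]
  have hp : spacing ε (N + 1) ^ d * (2 : ℝ) ^ ((d : ℝ) / 2) =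
      spacing ε N ^ d * 2 ^ (-(d : ℝ) / 2) := by
    rw [hsp, mul_pow, mul_comm ((2 : ℝ) ^ d), mul_assoc]
    congr 1
    rw [← Real.rpow_natCast, ← Real.rpow_add two_pos]
    congr 1
    ring
  have hp' := congrArg (fun x : ℝ => (x : ℂ)) hp
  simp only [Complex.ofReal_mul] at hp'
  linear_combination ((∑ x, (q x : ℂ) *
    latticeWave (ε * r) (spacing ε N) n (fun j => (x j : ℤ))) *
    (h.sum fun k c => (c : ℂ) * latticeWave (ε * r) (spacing ε (N + 1)) n k) *
    FourierTransform.fourier (fun x => (φ x : ℂ))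
      (latticeVec (spacing ε (N + 1) / (2 * (ε * r))) n)) * hp'

lemma fieldPart_scalingMap (hε : 0 < ε) (h : (Fin d → ℤ) →₀ ℝ) (ξ : LatticeSpace d r N) :
    fieldPart ε (scalingMap ε h N ξ) = scaleFun h (fieldPart ε ξ) := by
  have hs := spacing_pos hε (N + 1)
  ext x
  simp only [fieldPart, scalingMap, ofFieldMomentum]
  simp only [Complex.add_re, Complex.ofReal_re, Complex.mul_re, Complex.I_re, zero_mul,
    Complex.I_im, Complex.ofReal_im, mul_zero, sub_zero, add_zero]
  rw [← mul_assoc, ← Real.rpow_add hs, show -((d : ℝ) + 1) / 2 + ((d : ℝ) + 1) / 2 = 0 by ring,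
    Real.rpow_zero, one_mul]

lemma momentumPart_scalingMap (hε : 0 < ε) (h : (Fin d → ℤ) →₀ ℝ) (ξ : LatticeSpace d r N) :
    momentumPart ε (scalingMap ε h N ξ) = scaleFun h (momentumPart ε ξ) := by
  have hs := spacing_pos hε (N + 1)
  ext x
  simp only [momentumPart, scalingMap, ofFieldMomentum]
  simp only [Complex.add_im, Complex.ofReal_re, Complex.mul_im, Complex.I_re, zero_mul,
    Complex.I_im, Complex.ofReal_im, one_mul, zero_add]
  rw [← mul_assoc, ← Real.rpow_add hs, show (1 - (d : ℝ)) / 2 + ((d : ℝ) - 1) / 2 = 0 by ring,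
    Real.rpow_zero, one_mul]

lemma oneParticleCoeff_smearedFun (m : ℝ) (ξ : LatticeSpace d r N) (n : Fin d → ℤ) :
    oneParticleCoeff (ε * r) m (smearedFun φ ε ξ) n =
      (((2 * (ε * r)) ^ (-(d : ℝ) / 2) : ℝ) : ℂ) *
        (((dispersion (ε * r) m n ^ (-(1 : ℝ) / 2) : ℝ) : ℂ) *
          torusFourier (ε * r) (smearReal φ ε (fieldPart ε ξ)) n +
        Complex.I * ((dispersion (ε * r) m n ^ ((1 : ℝ) / 2) : ℝ) : ℂ) *
          torusFourier (ε * r) (smearReal φ ε (momentumPart ε ξ)) n) := by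
  rw [oneParticleCoeff, smearedFun_re, smearedFun_im]

/-- `toOneParticle` sees a function only through its coefficients, so equal coefficients suffice; if
they were not square summable, both sides would take the default value `0`. -/
theorem smearingMap_scalingMap {h : (Fin d → ℤ) →₀ ℝ} (hφ : IsScalingFunction φ h)
    (hε : 0 < ε) (hr : 0 < r) (m : ℝ) (ξ : LatticeSpace d r N) :
    smearingMap φ ε m (N + 1) (scalingMap ε h N ξ) = smearingMap φ ε m N ξ := by
  have : oneParticleCoeff (ε * r) m (smearedFun φ ε (scalingMap ε h N ξ)) =
      oneParticleCoeff (ε * r) m (smearedFun φ ε ξ) := by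
    funext n
    rw [oneParticleCoeff_smearedFun, oneParticleCoeff_smearedFun, fieldPart_scalingMap hε,
      momentumPart_scalingMap hε, torusFourier_smearReal_scaleFun hφ hε hr,
      torusFourier_smearReal_scaleFun hφ hε hr]
  classical
  exact congrArg (fun c : (Fin d → ℤ) → ℂ =>
    if hc : Memℓp c 2 then (⟨c, hc⟩ : OneParticleSpace d) else 0) this

lemma dispersion_pos {L m : ℝ} (hm : 0 < m) (n : Fin d → ℤ) : 0 < dispersion L m n :=
  Real.sqrt_pos.2 (add_pos_of_nonneg_of_pos (Finset.sum_nonneg fun j _ => sq_nonneg _)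
    (by positivity))

lemma le_dispersion (L m : ℝ) (n : Fin d → ℤ) : m ≤ dispersion L m n :=
  Real.le_sqrt_of_sq_le (le_add_of_nonneg_left (Finset.sum_nonneg fun _ _ => sq_nonneg _))

lemma dispersion_le {L m : ℝ} (hL : 0 < L) (hm : 0 < m) (n : Fin d → ℤ) :
    dispersion L m n ≤ (m + Real.pi / L) * (1 + ∑ j, |(n j : ℝ)|) := by
  have hnn : 0 ≤ ∑ j, |(n j : ℝ)| := Finset.sum_nonneg fun j _ => abs_nonneg _
  have hpi : 0 < Real.pi / L := div_pos Real.pi_pos hL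
  refine Real.sqrt_le_iff.2 ⟨by positivity, ?_⟩
  have h1 : ∑ j, (Real.pi / L * n j) ^ 2 ≤ (Real.pi / L * ∑ j, |(n j : ℝ)|) ^ 2 := by
    rw [mul_pow, Finset.sum_congr rfl fun j _ => mul_pow (Real.pi / L) (n j : ℝ) 2,
      ← Finset.mul_sum]
    gcongr
    rw [Finset.sum_congr rfl fun j _ => (sq_abs (n j : ℝ)).symm]
    exact Finset.sum_sq_le_sq_sum_of_nonneg fun j _ => abs_nonneg _
  nlinarith [mul_nonneg hm.le hnn, mul_nonneg hpi.le hnn, mul_nonneg (mul_nonneg hpi.le hnn) hm.le,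
    mul_pos hm hpi, mul_nonneg (mul_nonneg hm.le hnn) (mul_nonneg hm.le hnn), mul_pos hpi hpi,
    mul_nonneg (mul_nonneg hm.le hnn) (mul_nonneg hpi.le hnn), mul_nonneg (mul_pos hm hm).le hnn,
    mul_nonneg (mul_pos hpi hpi).le hnn]

/-- Decay of the Fourier transform of `φ` along all lattices, as needed for the smeared functions
to have finite energy. -/
def HasSummableFourier (φ : EuclideanSpace ℝ (Fin d) → ℝ) : Prop :=
  ∀ c : ℝ, 0 < c → Summable fun n : Fin d → ℤ => (1 + ∑ j, |(n j : ℝ)|) *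
    ‖FourierTransform.fourier (fun x => (φ x : ℂ)) (latticeVec c n)‖ ^ 2

/-- The lattice sums are bounded uniformly in `n`, leaving `φ̂` as the only source of decay. The
momentum part, with weight `γ^{1/2}`, is decisive: `γ ≥ m > 0` gives `γ^{-1/2} ≤ m⁻¹ γ^{1/2}`, and
`γ` grows at most linearly in `n`. -/
theorem memℓp_oneParticleCoeff_smearedFun (hφ : HasCompactSupport φ) (hφ2 : MemLp φ 2)
    (hS : HasSummableFourier φ) (hε : 0 < ε) (hr : 0 < r) {m : ℝ} (hm : 0 < m)
    (ξ : LatticeSpace d r N) : Memℓp (oneParticleCoeff (ε * r) m (smearedFun φ ε ξ)) 2 := by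
  have hs := spacing_pos hε N
  have hL : 0 < ε * r := by positivity
  set c := spacing ε N / (2 * (ε * r)) with hc
  have hcpos : 0 < c := by positivity
  set F := fun n : Fin d → ℤ => ‖FourierTransform.fourier (fun x => (φ x : ℂ)) (latticeVec c n)‖
    with hF
  have hb : ∀ (q : LatticeSite d r N → ℝ) (n : Fin d → ℤ),
      ‖torusFourier (ε * r) (smearReal φ ε q) n‖ ≤ (spacing ε N ^ d * ∑ x, |q x|) * F n := by
    intro q n
    rw [torusFourier_smearReal hφ hφ2 hε hr, norm_mul, norm_mul, Complex.norm_real,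
      Real.norm_of_nonneg (by positivity)]
    gcongr
    refine (norm_sum_le _ _).trans (Finset.sum_le_sum fun x _ => ?_)
    rw [norm_mul, norm_latticeWave, Complex.norm_real, mul_one, Real.norm_eq_abs]
  set Cq := spacing ε N ^ d * ∑ x, |fieldPart ε ξ x| with hCq
  set Cp := spacing ε N ^ d * ∑ x, |momentumPart ε ξ x| with hCp
  have hCq0 : 0 ≤ Cq := mul_nonneg (by positivity) (Finset.sum_nonneg fun x _ => abs_nonneg _)
  have hCp0 : 0 ≤ Cp := mul_nonneg (by positivity) (Finset.sum_nonneg fun x _ => abs_nonneg _)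
  set b := (2 * (ε * r)) ^ (-(d : ℝ) / 2)
  have hb0 : 0 ≤ b := by positivity
  refine (memℓp_gen_iff (by norm_num)).2 ?_
  refine Summable.of_nonneg_of_le (fun n => by positivity) (fun n => ?_)
    ((hS c hcpos).mul_left ((b * (m⁻¹ * Cq + Cp)) ^ 2 * (m + Real.pi / (ε * r))))
  have hγ := dispersion_pos (L := ε * r) hm n
  set γ := dispersion (ε * r) m n with hγdef
  have h1 : γ ^ (-(1 : ℝ) / 2) ≤ m⁻¹ * γ ^ ((1 : ℝ) / 2) := by
    have : γ ^ (-(1 : ℝ) / 2) = γ⁻¹ * γ ^ ((1 : ℝ) / 2) := by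
      rw [← Real.rpow_neg_one, ← Real.rpow_add hγ]
      norm_num
    rw [this]
    gcongr
    exact le_dispersion _ m n
  have h2 : ‖oneParticleCoeff (ε * r) m (smearedFun φ ε ξ) n‖ ≤
      b * (m⁻¹ * Cq + Cp) * (γ ^ ((1 : ℝ) / 2) * F n) := by
    rw [oneParticleCoeff_smearedFun, norm_mul, Complex.norm_real, Real.norm_of_nonneg hb0,
      mul_assoc b]
    refine mul_le_mul_of_nonneg_left ?_ hb0
    refine (norm_add_le _ _).trans ?_
    rw [norm_mul, norm_mul, norm_mul, Complex.norm_I, one_mul, Complex.norm_real,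
      Complex.norm_real, Real.norm_of_nonneg (by positivity), Real.norm_of_nonneg (by positivity)]
    calc γ ^ (-(1 : ℝ) / 2) * ‖torusFourier (ε * r) (smearReal φ ε (fieldPart ε ξ)) n‖ +
          γ ^ ((1 : ℝ) / 2) * ‖torusFourier (ε * r) (smearReal φ ε (momentumPart ε ξ)) n‖
        ≤ (m⁻¹ * γ ^ ((1 : ℝ) / 2)) * (Cq * F n) + γ ^ ((1 : ℝ) / 2) * (Cp * F n) := by
          gcongr
          · exact hb _ n
          · exact hb _ n
      _ = _ := by ring
  have h3 : (γ ^ ((1 : ℝ) / 2)) ^ 2 = γ := by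
    rw [← Real.rpow_natCast, ← Real.rpow_mul hγ.le]
    norm_num
  calc ‖oneParticleCoeff (ε * r) m (smearedFun φ ε ξ) n‖ ^ (2 : ENNReal).toReal
      = ‖oneParticleCoeff (ε * r) m (smearedFun φ ε ξ) n‖ ^ 2 := by
        rw [← Real.rpow_natCast]; norm_num
    _ ≤ (b * (m⁻¹ * Cq + Cp) * (γ ^ ((1 : ℝ) / 2) * F n)) ^ 2 := by gcongr
    _ = (b * (m⁻¹ * Cq + Cp)) ^ 2 * (γ * F n ^ 2) := by rw [mul_pow, mul_pow (γ ^ _), h3]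
    _ ≤ (b * (m⁻¹ * Cq + Cp)) ^ 2 *
        ((m + Real.pi / (ε * r)) * (1 + ∑ j, |(n j : ℝ)|) * F n ^ 2) := by
        gcongr
        exact dispersion_le hL hm n
    _ = _ := by ring

lemma torusFourier_neg (L : ℝ) (f : EuclideanSpace ℝ (Fin d) → ℝ) (n : Fin d → ℤ) :
    torusFourier L f (-n) = (starRingEnd ℂ) (torusFourier L f n) := by
  unfold torusFourier
  rw [← integral_conj]
  congr 1
  ext x
  rw [map_mul, Complex.conj_ofReal, ← Complex.exp_conj, map_mul, Complex.conj_ofReal, map_neg,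
    Complex.conj_I, neg_neg]
  congr 2
  simp

lemma dispersion_neg (L m : ℝ) (n : Fin d → ℤ) : dispersion L m (-n) = dispersion L m n := by
  simp [dispersion]

lemma smearingMap_apply (hφ : HasCompactSupport φ) (hφ2 : MemLp φ 2)
    (hS : HasSummableFourier φ) (hε : 0 < ε) (hr : 0 < r) {m : ℝ} (hm : 0 < m)
    (ξ : LatticeSpace d r N) (n : Fin d → ℤ) :
    smearingMap φ ε m N ξ n = oneParticleCoeff (ε * r) m (smearedFun φ ε ξ) n := by
  rw [smearingMap, toOneParticle,
    dif_pos (memℓp_oneParticleCoeff_smearedFun hφ hφ2 hS hε hr hm ξ)]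

lemma sympForm_lattice (hε : 0 < ε) (ξ η : LatticeSpace d r N) :
    sympForm ξ η = spacing ε N ^ d * (∑ x, fieldPart ε ξ x * momentumPart ε η x -
      ∑ x, momentumPart ε ξ x * fieldPart ε η x) := by
  have hs := spacing_pos hε N
  rw [sympForm, PiLp.inner_apply, Complex.im_sum, ← Finset.sum_sub_distrib, Finset.mul_sum]
  refine Finset.sum_congr rfl fun x _ => ?_
  have hp : spacing ε N ^ d * (spacing ε N ^ (-((d : ℝ) + 1) / 2) *
      spacing ε N ^ ((1 - (d : ℝ)) / 2)) = 1 := by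
    rw [← Real.rpow_add hs, ← Real.rpow_natCast, ← Real.rpow_add hs]
    rw [show (d : ℝ) + (-((d : ℝ) + 1) / 2 + (1 - (d : ℝ)) / 2) = 0 by ring, Real.rpow_zero]
  simp only [fieldPart, momentumPart, RCLike.inner_apply, Complex.mul_im, Complex.conj_re,
    Complex.conj_im]
  linear_combination (-((ξ x).re * (η x).im - (ξ x).im * (η x).re)) * hp

/-- With `a = γ^{-1/2}` and `a' = γ^{1/2}`, the field-momentum cross terms lose their dependence on
`γ`; what remains involves `q, q'` or `p, p'` alone. -/
lemma im_conj_mul_of_mul_eq_one (b : ℝ) {a a' : ℝ} (h : a * a' = 1) (q p q' p' : ℂ) :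
    ((starRingEnd ℂ) ((b : ℂ) * ((a : ℂ) * q + Complex.I * (a' : ℂ) * p)) *
      ((b : ℂ) * ((a : ℂ) * q' + Complex.I * (a' : ℂ) * p'))).im =
      b * b * (((starRingEnd ℂ) q * p').re - ((starRingEnd ℂ) p * q').re) +
        b * b * (a * a * ((starRingEnd ℂ) q * q').im + a' * a' * ((starRingEnd ℂ) p * p').im) := by
  simp only [Complex.mul_im, Complex.mul_re, Complex.conj_re, Complex.conj_im, Complex.add_re,
    Complex.add_im, Complex.ofReal_re, Complex.ofReal_im, Complex.I_re, Complex.I_im]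
  linear_combination (b * b * (q.re * p'.re + q.im * p'.im - p.re * q'.re - p.im * q'.im)) * h

/-- Parseval and orthonormality evaluate the cross terms as the lattice form. The remainder `o` is
odd in `n`, because Fourier coefficients of real functions are conjugated under `n ↦ -n` and `γ` is
even. -/
theorem isSymplecticMap_smearingMap {h : (Fin d → ℤ) →₀ ℝ} (hφ : IsScalingFunction φ h)
    (hS : HasSummableFourier φ) (hε : 0 < ε) (hr : 0 < r) {m : ℝ} (hm : 0 < m) (N : ℕ) :
    IsSymplecticMap (smearingMap (r := r) φ ε m N) := by
  have happ := fun ξ n => smearingMap_apply (N := N) hφ.compactSupport hφ.memLp hS hε hr hm ξ n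
  have hL : 0 < ε * r := by positivity
  refine ⟨fun ξ η => ?_, fun t ξ => ?_, fun ξ η => ?_⟩
  · ext n
    rw [lp.coeFn_add, Pi.add_apply, happ, happ, happ, oneParticleCoeff_smearedFun,
      oneParticleCoeff_smearedFun, oneParticleCoeff_smearedFun]
    simp only [torusFourier_smearReal hφ.compactSupport hφ.memLp hε hr]
    have e1 : ∀ x, fieldPart ε (ξ + η) x = fieldPart ε ξ x + fieldPart ε η x := fun x => by
      simp [fieldPart, mul_add]
    have e2 : ∀ x, momentumPart ε (ξ + η) x = momentumPart ε ξ x + momentumPart ε η x :=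
      fun x => by simp [momentumPart, mul_add]
    simp only [e1, e2, Complex.ofReal_add, add_mul, Finset.sum_add_distrib]
    ring
  · ext n
    rw [lp.coeFn_smul, Pi.smul_apply, happ, happ, oneParticleCoeff_smearedFun,
      oneParticleCoeff_smearedFun]
    simp only [torusFourier_smearReal hφ.compactSupport hφ.memLp hε hr]
    have e1 : ∀ x, fieldPart ε ((t : ℂ) • ξ) x = t * fieldPart ε ξ x := fun x => by
      simp [fieldPart, mul_left_comm]
    have e2 : ∀ x, momentumPart ε ((t : ℂ) • ξ) x = t * momentumPart ε ξ x := fun x => by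
      simp [momentumPart, mul_left_comm]
    simp only [e1, e2, Complex.ofReal_mul, mul_assoc, smul_eq_mul, ← Finset.mul_sum]
    ring
  · set Q := fun ζ : LatticeSpace d r N => torusFourier (ε * r) (smearReal φ ε (fieldPart ε ζ))
      with hQ
    set P := fun ζ : LatticeSpace d r N => torusFourier (ε * r) (smearReal φ ε (momentumPart ε ζ))
      with hP
    set γ := dispersion (d := d) (ε * r) m with hγ
    have hmem := fun q : LatticeSite d r N → ℝ =>
      memLp_smearReal hφ.compactSupport hφ.memLp hε hr q
    have hpars := fun q p : LatticeSite d r N → ℝ =>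
      Complex.hasSum_re (hasSum_torusFourier hL (hmem q) (hmem p))
    have hinner : HasSum (fun n => (inner ℂ (smearingMap φ ε m N ξ n)
        (smearingMap φ ε m N η n)).im)
        (sympForm (smearingMap φ ε m N ξ) (smearingMap φ ε m N η)) :=
      Complex.hasSum_im (lp.hasSum_inner _ _)
    have heven := (((hpars (fieldPart ε ξ) (momentumPart ε η)).sub
      (hpars (momentumPart ε ξ) (fieldPart ε η))).mul_left ((2 * (ε * r)) ^ (-(d : ℝ))))
    set o : (Fin d → ℤ) → ℝ := fun n => (2 * (ε * r)) ^ (-(d : ℝ)) *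
      ((γ n)⁻¹ * ((starRingEnd ℂ) (Q ξ n) * Q η n).im + γ n * ((starRingEnd ℂ) (P ξ n) * P η n).im)
      with ho
    have hodd : ∀ n, o (-n) = -o n := by
      intro n
      simp only [ho, hQ, hP, torusFourier_neg, hγ, dispersion_neg, Complex.mul_im, Complex.conj_re,
        Complex.conj_im, neg_neg]
      ring
    have hdecomp : ∀ n, (inner ℂ (smearingMap φ ε m N ξ n) (smearingMap φ ε m N η n)).im =
        (2 * (ε * r)) ^ (-(d : ℝ)) * (((starRingEnd ℂ) (Q ξ n) * P η n).re -
          ((starRingEnd ℂ) (P ξ n) * Q η n).re) + o n := by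
      intro n
      have hγn : 0 < γ n := dispersion_pos hm n
      have g1 : γ n ^ (-(1 : ℝ) / 2) * γ n ^ (-(1 : ℝ) / 2) = (γ n)⁻¹ := by
        rw [← Real.rpow_add hγn, ← Real.rpow_neg_one]
        norm_num
      have g2 : γ n ^ ((1 : ℝ) / 2) * γ n ^ ((1 : ℝ) / 2) = γ n := by
        rw [← Real.rpow_add hγn]
        norm_num
      have g3 : γ n ^ (-(1 : ℝ) / 2) * γ n ^ ((1 : ℝ) / 2) = 1 := by
        rw [← Real.rpow_add hγn]
        norm_num
      have g4 : (2 * (ε * r)) ^ (-(d : ℝ) / 2) * (2 * (ε * r)) ^ (-(d : ℝ) / 2) =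
          (2 * (ε * r)) ^ (-(d : ℝ)) := by
        rw [← Real.rpow_add (by positivity)]
        congr 1
        ring
      rw [happ, happ, oneParticleCoeff_smearedFun, oneParticleCoeff_smearedFun]
      rw [RCLike.inner_apply, mul_comm, im_conj_mul_of_mul_eq_one _ g3, g1, g2, g4]
    -- Convergence of the odd part needs no estimate: it is the difference of the inner product
    -- series and the Parseval series. Reflecting `n` then shows that its sum equals its own
    -- negative.
    have hosum : HasSum o (sympForm (smearingMap φ ε m N ξ) (smearingMap φ ε m N η) -
        sympForm ξ η) := by
      have h1 := hinner.sub heven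
      have hval : (2 * (ε * r)) ^ (-(d : ℝ)) * ((((2 * (ε * r)) ^ d *
          ∫ x in torusBox d (ε * r), smearReal φ ε (fieldPart ε ξ) x *
            smearReal φ ε (momentumPart ε η) x : ℝ) : ℂ).re - (((2 * (ε * r)) ^ d *
          ∫ x in torusBox d (ε * r), smearReal φ ε (momentumPart ε ξ) x *
            smearReal φ ε (fieldPart ε η) x : ℝ) : ℂ).re) = sympForm ξ η := by
        rw [Complex.ofReal_re, Complex.ofReal_re, setIntegral_smearReal_mul hφ hε hr,
          setIntegral_smearReal_mul hφ hε hr, sympForm_lattice hε, ← mul_sub, ← mul_assoc,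
          Real.rpow_neg (by positivity), Real.rpow_natCast, inv_mul_cancel₀ (by positivity),
          one_mul, mul_sub]
      rw [hval] at h1
      refine h1.congr_fun fun n => ?_
      rw [hdecomp]
      ring
    have hneg : HasSum o (-(sympForm (smearingMap φ ε m N ξ) (smearingMap φ ε m N η) -
        sympForm ξ η)) := by
      have h1 := ((Equiv.neg (Fin d → ℤ)).hasSum_iff.2 hosum).neg
      refine h1.congr_fun fun n => ?_
      simp [hodd]
    have := hosum.unique hneg
    linarith

/-- Smearing preserves `σ` at both levels and absorbs the scaling map, so the scaling map preserves
`σ` too. The mass is auxiliary here and is set to `1`. -/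
theorem isSymplecticMap_scalingMap {h : (Fin d → ℤ) →₀ ℝ} (hφ : IsScalingFunction φ h)
    (hS : HasSummableFourier φ) (hε : 0 < ε) (hr : 0 < r) (N : ℕ) :
    IsSymplecticMap (scalingMap (r := r) ε h N) := by
  have hlin : ∀ (a b : ℝ) (q p : LatticeSite d r N → ℝ) (x : LatticeSite d r (N + 1)),
      scaleFun h (fun x => a * q x + b * p x) x = a * scaleFun h q x + b * scaleFun h p x := by
    intro a b q p x
    simp only [scaleFun, add_mul, Finset.sum_add_distrib, mul_assoc, ← Finset.mul_sum]
    ring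
  have hsm := isSymplecticMap_smearingMap hφ hS hε hr (m := 1) one_pos
  refine ⟨fun ξ η => ?_, fun t ξ => ?_, fun ξ η => ?_⟩
  · have e1 : fieldPart ε (ξ + η) = fun x => 1 * fieldPart ε ξ x + 1 * fieldPart ε η x := by
      ext x; simp [fieldPart, mul_add]
    have e2 : momentumPart ε (ξ + η) =
        fun x => 1 * momentumPart ε ξ x + 1 * momentumPart ε η x := by
      ext x; simp [momentumPart, mul_add]
    ext x
    simp only [scalingMap, ofFieldMomentum, e1, e2, hlin, PiLp.add_apply]
    push_cast
    ring
  · have e1 : fieldPart ε ((t : ℂ) • ξ) = fun x => t * fieldPart ε ξ x + 0 * fieldPart ε ξ x := by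
      ext x; simp [fieldPart, mul_left_comm]
    have e2 : momentumPart ε ((t : ℂ) • ξ) =
        fun x => t * momentumPart ε ξ x + 0 * momentumPart ε ξ x := by
      ext x; simp [momentumPart, mul_left_comm]
    ext x
    simp only [scalingMap, ofFieldMomentum, e1, e2, hlin, PiLp.smul_apply, smul_eq_mul]
    push_cast
    ring
  · rw [← (hsm (N + 1)).preserves, smearingMap_scalingMap hφ hε hr, smearingMap_scalingMap hφ hε hr,
      (hsm N).preserves]

end Smearing

/-! ### Decay of the Fourier transform for Daubechies filters -/

section Summability

/-- A finite set of indices lies in the product of its coordinate projections, over which the sum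
factorizes. -/
lemma sum_prod_le_prod_tsum {d : ℕ} {a : Fin d → ℤ → ℝ} (h0 : ∀ j n, 0 ≤ a j n)
    (ha : ∀ j, Summable (a j)) (S : Finset (Fin d → ℤ)) :
    ∑ n ∈ S, ∏ j, a j (n j) ≤ ∏ j, ∑' n, a j n := by
  classical
  calc ∑ n ∈ S, ∏ j, a j (n j)
      ≤ ∑ n ∈ Fintype.piFinset fun j => S.image fun n => n j, ∏ j, a j (n j) := by
        refine Finset.sum_le_sum_of_subset_of_nonneg (fun n hn => ?_)
          fun _ _ _ => Finset.prod_nonneg fun j _ => h0 j _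
        exact Fintype.mem_piFinset.2 fun j => Finset.mem_image_of_mem _ hn
    _ = ∏ j, ∑ n ∈ S.image fun n => n j, a j n := (Finset.prod_univ_sum _ _).symm
    _ ≤ ∏ j, ∑' n, a j n := by
        refine Finset.prod_le_prod (fun j _ => Finset.sum_nonneg fun _ _ => h0 j _) fun j _ => ?_
        exact (ha j).sum_le_tsum _ fun _ _ => h0 j _

lemma summable_prod_pi {d : ℕ} {a : Fin d → ℤ → ℝ} (h0 : ∀ j n, 0 ≤ a j n)
    (ha : ∀ j, Summable (a j)) : Summable fun n : Fin d → ℤ => ∏ j, a j (n j) :=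
  summable_of_sum_le (fun _ => Finset.prod_nonneg fun j _ => h0 j _) (sum_prod_le_prod_tsum h0 ha)

lemma one_add_sum_le_prod_one_add {ι : Type*} (s : Finset ι) {x : ι → ℝ} (hx : ∀ i, 0 ≤ x i) :
    1 + ∑ i ∈ s, x i ≤ ∏ i ∈ s, (1 + x i) := by
  classical
  induction s using Finset.induction_on with
  | empty => simp
  | insert i s hi ih =>
    rw [Finset.sum_insert hi, Finset.prod_insert hi]
    have : 0 ≤ ∑ i ∈ s, x i := Finset.sum_nonneg fun i _ => hx i
    nlinarith [hx i]

lemma summable_one_add_abs_int_rpow {b : ℝ} (hb : 1 < b) :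
    Summable fun n : ℤ => (1 + |(n : ℝ)|) ^ (-b) := by
  refine Summable.of_nonneg_of_le (fun n => by positivity) (fun n => ?_)
    ((Real.summable_abs_int_rpow hb).add
      (hasSum_ite_eq (0 : ℤ) (1 : ℝ)).summable)
  by_cases hn : n = 0
  · subst hn
    simp
    positivity
  · have : 0 < |(n : ℝ)| := by positivity
    rw [if_neg hn, add_zero]
    exact Real.rpow_le_rpow_of_nonpos this (by linarith) (by linarith)

lemma min_one_mul_one_add_le {c x : ℝ} (hx : 0 ≤ x) : min 1 c * (1 + x) ≤ 1 + c * x := by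
  have h1 := min_le_left 1 c
  have h2 := mul_le_mul_of_nonneg_right (min_le_right 1 c) hx
  linarith

end Summability

/-! ### Binomial estimates and the infinite product of Daubechies filter moduli. -/

section Daubechies

/-- At `K = 1` there is equality. The strictness from `K = 2` on is what makes the final decay
exponent exceed one. -/
lemma centralBinom_lt {K : ℕ} (hK : 2 ≤ K) : 2 * K.centralBinom < 4 ^ K := by
  induction K, hK using Nat.le_induction with
  | base => decide
  | succ n hn ih =>
    have h := Nat.succ_mul_centralBinom_succ n
    have h2 : (n + 1) * (2 * (n + 1).centralBinom) < (n + 1) * 4 ^ (n + 1) := by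
      calc (n + 1) * (2 * (n + 1).centralBinom) = (2 * (2 * n + 1)) * (2 * n.centralBinom) := by
            linarith
        _ < (2 * (2 * n + 1)) * 4 ^ n := by gcongr
        _ ≤ (4 * (n + 1)) * 4 ^ n := Nat.mul_le_mul_right _ (by omega)
        _ = _ := by ring
    exact lt_of_mul_lt_mul_left h2 (by omega)

/-- By the hockey-stick identity the sum is `binom(2K-1, K)`, half of the central binomial
coefficient. -/
lemma sum_choose_lt {K : ℕ} (hK : 2 ≤ K) :
    ∑ k ∈ Finset.range K, ((K - 1 + k).choose k : ℝ) < 4 ^ (K - 1) := by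
  obtain ⟨n, rfl⟩ : ∃ n, K = n + 1 := ⟨K - 1, by omega⟩
  simp only [Nat.add_sub_cancel]
  have h1 : ∑ k ∈ Finset.range (n + 1), (n + k).choose k = (2 * n + 1).choose (n + 1) := by
    rw [two_mul, ← Nat.sum_Icc_choose, ← Finset.Ico_succ_right_eq_Icc,
      Finset.sum_Ico_eq_sum_range]
    refine Finset.sum_congr (by congr 1; simp; omega) fun k _ => ?_
    rw [Nat.choose_symm_add]
  have h2 : 2 * (2 * n + 1).choose (n + 1) = (n + 1).centralBinom := by
    rw [Nat.centralBinom_eq_two_mul_choose, show 2 * (n + 1) = (2 * n + 1) + 1 by ring,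
      Nat.choose_succ_succ' (2 * n + 1) n, two_mul]
    congr 1
    exact (Nat.choose_symm_half n)
  have h3 := centralBinom_lt hK
  rw [← h2, pow_succ] at h3
  have h4 : ∑ k ∈ Finset.range (n + 1), (n + k).choose k < 4 ^ n := by
    rw [h1]; omega
  exact_mod_cast h4

/-- The sum truncates the power series of `(1 - y)^{-K}`, whose terms are nonnegative. With `y =
sin²` this gives `|m₀| ≤ 1`. -/
lemma one_sub_pow_mul_sum_choose_le {K : ℕ} (hK : 1 ≤ K) {y : ℝ} (hy0 : 0 ≤ y) (hy1 : y ≤ 1) :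
    (1 - y) ^ K * ∑ k ∈ Finset.range K, ((K - 1 + k).choose k : ℝ) * y ^ k ≤ 1 := by
  obtain ⟨n, rfl⟩ : ∃ n, K = n + 1 := ⟨K - 1, by omega⟩
  simp only [Nat.add_sub_cancel]
  rcases hy1.eq_or_lt with rfl | hy
  · simp
  have hn : ‖y‖ < 1 := by rwa [Real.norm_of_nonneg hy0]
  have h1 := tsum_choose_mul_geometric_of_norm_lt_one n hn
  have h2 := (summable_choose_mul_geometric_of_norm_lt_one n hn).sum_le_tsum
    (Finset.range (n + 1)) fun k _ => by positivity
  rw [h1, le_div_iff₀ (by have := sub_pos.2 hy; positivity)] at h2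
  have e : ∀ k, (n + k).choose k = (k + n).choose n := fun k => by
    rw [add_comm k n, Nat.choose_symm_add]
  simp only [e]
  rw [mul_comm]
  exact h2

/-- The normalized modulus `|m₀(2πt)|` of the low-pass filter. -/
def filterModulus (g : ℤ →₀ ℝ) (t : ℝ) : ℝ :=
  ‖g.sum fun n c => (c : ℂ) * Complex.exp (-Complex.I * n * ((2 * Real.pi * t : ℝ) : ℂ))‖ / √2

variable {K : ℕ} {g : ℤ →₀ ℝ}

lemma filterModulus_nonneg (g : ℤ →₀ ℝ) (t : ℝ) : 0 ≤ filterModulus g t := by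
  unfold filterModulus; positivity

lemma IsDaubechiesFilter.filterModulus_sq (hg : IsDaubechiesFilter K g) (t : ℝ) :
    filterModulus g t ^ 2 = Real.cos (Real.pi * t) ^ (2 * K) *
      ∑ k ∈ Finset.range K, ((K - 1 + k).choose k : ℝ) * Real.sin (Real.pi * t) ^ (2 * k) := by
  rw [filterModulus, div_pow, Real.sq_sqrt two_pos.le, hg.normSq_eq]
  have : 2 * Real.pi * t / 2 = Real.pi * t := by ring
  rw [this]

lemma IsDaubechiesFilter.filterModulus_le_one (hg : IsDaubechiesFilter K g) (hK : 1 ≤ K) (t : ℝ) :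
    filterModulus g t ≤ 1 := by
  have h : filterModulus g t ^ 2 ≤ 1 := by
    rw [hg.filterModulus_sq, pow_mul, Real.cos_sq']
    simp_rw [pow_mul]
    exact one_sub_pow_mul_sum_choose_le hK (sq_nonneg _) (Real.sin_sq_le_one _)
  nlinarith [filterModulus_nonneg g t]

lemma IsDaubechiesFilter.filterModulus_le (hg : IsDaubechiesFilter K g) (t : ℝ) :
    filterModulus g t ≤ |Real.cos (Real.pi * t)| ^ K *
      √(∑ k ∈ Finset.range K, ((K - 1 + k).choose k : ℝ)) := by
  refine (abs_le_of_sq_le_sq' ?_ (by positivity)).2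
  rw [hg.filterModulus_sq, mul_pow, Real.sq_sqrt (by positivity), ← pow_mul, mul_comm K 2,
    pow_mul |Real.cos (Real.pi * t)| 2 K, sq_abs, ← pow_mul]
  gcongr with k _
  · rw [pow_mul]; positivity
  · refine mul_le_of_le_one_right (by positivity) ?_
    rw [pow_mul]
    exact pow_le_one₀ (sq_nonneg _) (Real.sin_sq_le_one _)

/-- Viète's product: the double-angle formula telescopes. -/
lemma prod_cos_mul_sin (x : ℝ) (J : ℕ) :
    (∏ i ∈ Finset.range J, Real.cos (x / 2 ^ (i + 1))) * (2 ^ J * Real.sin (x / 2 ^ J)) =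
      Real.sin x := by
  induction J with
  | zero => simp
  | succ J ih =>
    rw [← ih, Finset.prod_range_succ]
    have : x / 2 ^ J = 2 * (x / 2 ^ (J + 1)) := by rw [pow_succ]; field_simp
    rw [this, Real.sin_two_mul, pow_succ]
    ring

/-- The infinite product of the dilated filter moduli decays faster than `1 / |t|`. -/
lemma IsDaubechiesFilter.exists_prod_filterModulus_le (hg : IsDaubechiesFilter K g) (hK : 2 ≤ K) :
    ∃ s C : ℝ, 1 < s ∧ 0 ≤ C ∧ ∀ t : ℝ, ∃ J₀ : ℕ, ∀ J ≥ J₀,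
      ∏ i ∈ Finset.range J, filterModulus g (t / 2 ^ (i + 1)) ≤ C * (1 + |t|) ^ (-s) := by
  set B := √(∑ k ∈ Finset.range K, ((K - 1 + k).choose k : ℝ)) with hB
  have hBpos : 0 < B := by
    refine Real.sqrt_pos.2 (Finset.sum_pos (fun k _ => ?_) ⟨0, by simp; omega⟩)
    exact_mod_cast Nat.choose_pos (by omega)
  have hBlt : B < 2 ^ (K - 1) := by
    rw [hB, Real.sqrt_lt' (by positivity), ← pow_mul, mul_comm, pow_mul]
    norm_num
    exact sum_choose_lt hK
  -- Each dyadic scale contributes a factor `ρ`: `B` bounds the sine polynomial and `2^{-K}` comes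
  -- from the cosines. `ρ < 1/2` is exactly `s > 1`.
  set ρ := B / 2 ^ K with hρ
  have hρpos : 0 < ρ := by positivity
  have hρlt : ρ < 2⁻¹ := by
    rw [hρ, div_lt_iff₀ (by positivity)]
    obtain ⟨n, rfl⟩ : ∃ n, K = n + 1 := ⟨K - 1, by omega⟩
    simp only [Nat.add_sub_cancel] at hBlt
    rw [pow_succ]
    linarith
  set s := -Real.logb 2 ρ with hs
  have hs1 : 1 < s := by
    have : Real.logb 2 ρ < -1 := by
      rw [Real.logb_lt_iff_lt_rpow one_lt_two hρpos, Real.rpow_neg_one]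
      exact hρlt
    linarith
  have hρs : ρ = (2 : ℝ) ^ (-s) := by
    rw [hs, neg_neg, Real.rpow_logb two_pos (by norm_num) hρpos]
  have hmono : ∀ t : ℝ, Antitone fun J => ∏ i ∈ Finset.range J, filterModulus g (t / 2 ^ (i + 1)) :=
    fun t => antitone_nat_of_succ_le fun J => by
      rw [Finset.prod_range_succ]
      exact mul_le_of_le_one_right (Finset.prod_nonneg fun i _ => filterModulus_nonneg g _)
        (hg.filterModulus_le_one (by omega) _)
  refine ⟨s, 2 ^ K * 3 ^ s, hs1, by positivity, fun t => ?_⟩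
  suffices h : ∃ J₀ : ℕ, ∏ i ∈ Finset.range J₀, filterModulus g (t / 2 ^ (i + 1)) ≤
      2 ^ K * 3 ^ s * (1 + |t|) ^ (-s) by
    obtain ⟨J₀, hJ⟩ := h
    exact ⟨J₀, fun J hJJ => (hmono t hJJ).trans hJ⟩
  have hcmp : ∀ x : ℝ, 0 < x → 1 + |t| ≤ 3 * x → x ^ (-s) ≤ 3 ^ s * (1 + |t|) ^ (-s) := by
    intro x hx h
    calc x ^ (-s) = 3 ^ s * (3 * x) ^ (-s) := by
          rw [Real.mul_rpow (by norm_num) hx.le, ← mul_assoc, ← Real.rpow_add (by norm_num)]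
          simp
      _ ≤ 3 ^ s * (1 + |t|) ^ (-s) := by
          gcongr ?_ * ?_
          exact Real.rpow_le_rpow_of_nonpos (by positivity) h (by linarith)
  rcases lt_or_ge |t| (1 / 2) with ht | ht
  · refine ⟨0, ?_⟩
    have h1 := hcmp 1 one_pos (by linarith)
    rw [Real.one_rpow] at h1
    simp only [Finset.range_zero, Finset.prod_empty, mul_assoc]
    exact one_le_mul_of_one_le_of_one_le (one_le_pow₀ one_le_two) h1
  -- With `J = n + 1` this places `|t| / 2^J` between `1/4` and `1/2`, where Jordan's inequality
  -- bounds the sine in Viète's product below by `1/2`.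
  · obtain ⟨n, hn1, hn2⟩ := exists_nat_pow_near (by linarith : 1 ≤ 2 * |t|) (one_lt_two (α := ℝ))
    refine ⟨n + 1, ?_⟩
    set J := n + 1
    have h2J : (0 : ℝ) < 2 ^ J := by positivity
    have hu1 : 1 / 4 ≤ |t / 2 ^ J| := by
      rw [abs_div, abs_of_pos h2J, le_div_iff₀ h2J, pow_succ]
      linarith
    have hu2 : |t / 2 ^ J| ≤ 1 / 2 := by
      rw [abs_div, abs_of_pos h2J, div_le_iff₀ h2J]
      linarith
    have hsin : 1 / 2 ≤ |Real.sin (Real.pi * t / 2 ^ J)| := by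
      have h1 : |Real.pi * t / 2 ^ J| = Real.pi * |t / 2 ^ J| := by
        rw [mul_div_assoc, abs_mul, abs_of_pos Real.pi_pos]
      have h2 := Real.mul_abs_le_abs_sin (x := Real.pi * t / 2 ^ J) (by
        rw [h1]; nlinarith [Real.pi_pos])
      rw [h1] at h2
      have h3 : 2 / Real.pi * (Real.pi * |t / 2 ^ J|) = 2 * |t / 2 ^ J| := by
        have := Real.pi_ne_zero
        field_simp
      linarith
    have hcos : ∏ i ∈ Finset.range J, |Real.cos (Real.pi * (t / 2 ^ (i + 1)))| ≤ 2 / 2 ^ J := by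
      have h1 := congrArg abs (prod_cos_mul_sin (Real.pi * t) J)
      rw [abs_mul, Finset.abs_prod, abs_mul, abs_of_pos h2J] at h1
      have h2 : ∏ i ∈ Finset.range J, |Real.cos (Real.pi * (t / 2 ^ (i + 1)))| =
          ∏ i ∈ Finset.range J, |Real.cos (Real.pi * t / 2 ^ (i + 1))| := by
        simp_rw [mul_div_assoc]
      rw [h2, le_div_iff₀ h2J]
      have h3 := Real.abs_sin_le_one (Real.pi * t)
      have h0 : 0 ≤ ∏ i ∈ Finset.range J, |Real.cos (Real.pi * t / 2 ^ (i + 1))| :=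
        Finset.prod_nonneg fun i _ => abs_nonneg _
      have h4 := mul_le_mul_of_nonneg_left (mul_le_mul_of_nonneg_left hsin h2J.le) h0
      linarith
    calc ∏ i ∈ Finset.range J, filterModulus g (t / 2 ^ (i + 1))
        ≤ ∏ i ∈ Finset.range J, (|Real.cos (Real.pi * (t / 2 ^ (i + 1)))| ^ K * B) :=
          Finset.prod_le_prod (fun i _ => filterModulus_nonneg g _)
            fun i _ => hg.filterModulus_le _
      _ = (∏ i ∈ Finset.range J, |Real.cos (Real.pi * (t / 2 ^ (i + 1)))|) ^ K * B ^ J := by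
          rw [Finset.prod_mul_distrib, Finset.prod_pow]
          simp
      _ ≤ (2 / 2 ^ J) ^ K * B ^ J := by
          gcongr
      _ = 2 ^ K * ρ ^ J := by
          rw [hρ, div_pow, div_pow, ← pow_mul, ← pow_mul, mul_comm J K]
          field_simp
      _ ≤ 2 ^ K * (3 ^ s * (1 + |t|) ^ (-s)) := by
          gcongr
          have h1 : ρ ^ J = (2 ^ J : ℝ) ^ (-s) := by
            rw [hρs, ← Real.rpow_natCast, ← Real.rpow_mul two_pos.le, mul_comm,
              Real.rpow_mul two_pos.le, Real.rpow_natCast]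
          rw [h1]
          exact hcmp _ h2J (by linarith)
      _ = _ := by ring

variable {d : ℕ} {φ : EuclideanSpace ℝ (Fin d) → ℝ} {h : (Fin d → ℤ) →₀ ℝ}

lemma norm_tensor_filter (hh : ∀ n, h n = ∏ j, g (n j)) (w : EuclideanSpace ℝ (Fin d)) :
    (2 : ℝ) ^ (-(d : ℝ) / 2) * ‖h.sum fun n c => (c : ℂ) *
      Complex.exp (-Complex.I * ((∑ j, 2 * Real.pi * w j * n j : ℝ) : ℂ))‖ =
      ∏ j, filterModulus g (w j) := by
  classical
  have hsupp : h.support ⊆ Fintype.piFinset fun _ => g.support := by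
    intro n hn
    rw [Finsupp.mem_support_iff, hh, Finset.prod_ne_zero_iff] at hn
    exact Fintype.mem_piFinset.2 fun j => Finsupp.mem_support_iff.2 (hn j (Finset.mem_univ j))
  have h1 : (h.sum fun n c => (c : ℂ) *
      Complex.exp (-Complex.I * ((∑ j, 2 * Real.pi * w j * n j : ℝ) : ℂ))) =
      ∏ j, g.sum fun n c => (c : ℂ) *
        Complex.exp (-Complex.I * n * ((2 * Real.pi * w j : ℝ) : ℂ)) := by
    rw [Finsupp.sum_of_support_subset h hsupp _ (by simp)]
    simp only [Finsupp.sum]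
    rw [Finset.prod_univ_sum]
    refine Finset.sum_congr rfl fun n _ => ?_
    rw [hh, Finset.prod_mul_distrib, ← Complex.exp_sum]
    push_cast
    rw [Finset.mul_sum]
    congr 2
    refine Finset.sum_congr rfl fun j _ => ?_
    ring
  rw [h1, norm_prod]
  unfold filterModulus
  rw [Finset.prod_div_distrib, Finset.prod_const, Finset.card_univ, Fintype.card_fin,
    Real.sqrt_eq_rpow, ← Real.rpow_natCast, ← Real.rpow_mul two_pos.le, neg_div,
    Real.rpow_neg two_pos.le, inv_mul_eq_div]
  congr 2
  ring

/-- The scaling equation is iterated finitely often and the last factor of `φ̂` is bounded by the L¹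
norm of `φ`, so the infinite product never has to be identified with `φ̂`. -/
theorem hasSummableFourier_of_daubechies (hφ : IsScalingFunction φ h) (hK : 2 ≤ K)
    (hg : IsDaubechiesTensorFilter K h) : HasSummableFourier φ := by
  obtain ⟨g, hg, hh⟩ := hg
  obtain ⟨s, C, hs, hC, hdecay⟩ := hg.exists_prod_filterModulus_le hK
  set F := FourierTransform.fourier fun x => (φ x : ℂ) with hF
  set C₀ := ∫ x, ‖(φ x : ℂ)‖ with hC₀
  have hC₀nn : 0 ≤ C₀ := integral_nonneg fun x => norm_nonneg _
  have hF0 : ∀ w, ‖F w‖ ≤ C₀ := fun w =>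
    VectorFourier.norm_fourierIntegral_le_integral_norm _ _ _ _ _
  have hstep : ∀ w, ‖F w‖ = (∏ j, filterModulus g (w j / 2)) * ‖F ((2 : ℝ)⁻¹ • w)‖ := by
    intro w
    have h1 := fourier_scaling_eq hφ ((2 : ℝ)⁻¹ • w)
    rw [smul_inv_smul₀ two_ne_zero] at h1
    rw [hF, h1, norm_mul, norm_mul, Complex.norm_real, Real.norm_of_nonneg (by positivity),
      norm_tensor_filter hh]
    simp [div_eq_inv_mul]
  have hiter : ∀ (J : ℕ) w, ‖F w‖ ≤
      (∏ j, ∏ i ∈ Finset.range J, filterModulus g (w j / 2 ^ (i + 1))) * C₀ := by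
    intro J
    induction J with
    | zero => intro w; simpa using hF0 w
    | succ J ih =>
      intro w
      rw [hstep]
      calc _ ≤ (∏ j, filterModulus g (w j / 2)) * ((∏ j, ∏ i ∈ Finset.range J,
            filterModulus g (((2 : ℝ)⁻¹ • w) j / 2 ^ (i + 1))) * C₀) := by
            gcongr
            · exact Finset.prod_nonneg fun j _ => filterModulus_nonneg g _
            · exact ih _
        _ = _ := by
            rw [← mul_assoc, ← Finset.prod_mul_distrib]
            congr 1
            refine Finset.prod_congr rfl fun j _ => ?_
            rw [Finset.prod_range_succ', mul_comm]
            congr 1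
            · refine Finset.prod_congr rfl fun i _ => ?_
              simp only [PiLp.smul_apply, smul_eq_mul]
              congr 1
              rw [pow_succ _ (i + 1)]
              field_simp
            · simp
  have hbound : ∀ w : EuclideanSpace ℝ (Fin d), ‖F w‖ ≤ (∏ j, C * (1 + |w j|) ^ (-s)) * C₀ := by
    intro w
    choose J₀ hJ₀ using hdecay
    -- One number of iterations must serve all coordinates; the decay bound persists for every
    -- larger `J`.
    refine (hiter (Finset.univ.sup fun j => J₀ (w j)) w).trans ?_
    gcongr with j _
    · exact fun j _ => Finset.prod_nonneg fun i _ => filterModulus_nonneg g _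
    · exact hJ₀ (w j) _ (Finset.le_sup (f := fun j => J₀ (w j)) (Finset.mem_univ j))
  intro c hc
  set κ := min 1 c with hκ
  have hκ0 : 0 < κ := lt_min one_pos hc
  -- The weight is at most `∏ (1 + |n_j|)`, costing one power in each coordinate; `2s - 1 > 1` still
  -- sums.
  set a : ℤ → ℝ := fun n => (C * κ ^ (-s)) ^ 2 * (1 + |(n : ℝ)|) ^ (-(2 * s - 1)) with ha
  have hsum : Summable a := (summable_one_add_abs_int_rpow (by linarith)).mul_left _
  have ha0 : ∀ n, 0 ≤ a n := fun n => by positivity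
  refine Summable.of_nonneg_of_le (fun n => ?_) (fun n => ?_)
    ((summable_prod_pi (fun (_ : Fin d) n => ha0 n) fun _ => hsum).mul_left (C₀ ^ 2))
  · exact mul_nonneg (add_nonneg one_pos.le (Finset.sum_nonneg fun j _ => abs_nonneg _))
      (sq_nonneg _)
  · calc (1 + ∑ j, |(n j : ℝ)|) * ‖F (latticeVec c n)‖ ^ 2
        ≤ (∏ j, (1 + |(n j : ℝ)|)) *
            ((∏ j, C * (1 + |latticeVec c n j|) ^ (-s)) * C₀) ^ 2 := by
          refine mul_le_mul (one_add_sum_le_prod_one_add _ fun j => abs_nonneg _)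
            (pow_le_pow_left₀ (norm_nonneg _) (hbound _) 2) (sq_nonneg _)
            (Finset.prod_nonneg fun j _ => by positivity)
      _ = C₀ ^ 2 * ∏ j, (1 + |(n j : ℝ)|) * (C * (1 + |latticeVec c n j|) ^ (-s)) ^ 2 := by
          simp only [Finset.prod_mul_distrib, Finset.prod_pow, mul_pow]
          ring
      _ ≤ C₀ ^ 2 * ∏ j, a (n j) := by
          gcongr with j _
          have h1 : (1 + |latticeVec c n j|) ^ (-s) ≤ κ ^ (-s) * (1 + |(n j : ℝ)|) ^ (-s) := by
            rw [← Real.mul_rpow hκ0.le (by positivity)]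
            refine Real.rpow_le_rpow_of_nonpos (by positivity) ?_ (by linarith)
            rw [latticeVec_apply, abs_mul, abs_of_pos hc]
            exact min_one_mul_one_add_le (abs_nonneg _)
          calc (1 + |(n j : ℝ)|) * (C * (1 + |latticeVec c n j|) ^ (-s)) ^ 2
              ≤ (1 + |(n j : ℝ)|) * (C * (κ ^ (-s) * (1 + |(n j : ℝ)|) ^ (-s))) ^ 2 := by gcongr
            _ = (C * κ ^ (-s)) ^ 2 * ((1 + |(n j : ℝ)|) *
                  ((1 + |(n j : ℝ)|) ^ (-s)) ^ 2) := by ring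
            _ = a (n j) := by
                rw [ha]
                beta_reduce
                congr 1
                rw [← Real.rpow_natCast, ← Real.rpow_mul (by positivity)]
                nth_rewrite 1 [← Real.rpow_one (1 + |(n j : ℝ)|)]
                rw [← Real.rpow_add (by positivity)]
                congr 1
                push_cast
                ring

end Daubechies

/-! ### Sampling the Fourier transform of a compactly supported Sobolev function -/

section Sobolev

variable {d : ℕ}

/-- Sums over the points of a shifted lattice in `ℝ` are uniformly bounded. -/
lemma exists_tsum_shift_le {c : ℝ} (hc : 0 < c) : ∃ M : ℝ, ∀ s : ℝ,
    Summable (fun n : ℤ => ((1 + |s - c * n|) ^ 2)⁻¹) ∧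
      ∑' n : ℤ, ((1 + |s - c * n|) ^ 2)⁻¹ ≤ M := by
  set κ := min 1 c / 2 with hκ
  have hκ0 : 0 < κ := by have := lt_min one_pos hc; positivity
  have hsum : Summable fun n : ℤ => (κ ^ 2)⁻¹ * ((1 + |(n : ℝ)|) ^ 2)⁻¹ := by
    refine ((summable_one_add_abs_int_rpow one_lt_two).congr fun n => ?_).mul_left _
    rw [Real.rpow_neg (by positivity)]
    norm_num
  refine ⟨∑' n : ℤ, (κ ^ 2)⁻¹ * ((1 + |(n : ℝ)|) ^ 2)⁻¹, fun s => ?_⟩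
  -- Recentring at `n₀` makes the bound independent of `s`. The rounding error costs one unit of
  -- `|m|`, which the `1/2` in `κ` absorbs.
  set n₀ := ⌊s / c⌋ with hn₀
  have hle : ∀ m : ℤ, ((1 + |s - c * ((n₀ + m : ℤ) : ℝ)|) ^ 2)⁻¹ ≤
      (κ ^ 2)⁻¹ * ((1 + |(m : ℝ)|) ^ 2)⁻¹ := by
    intro m
    rw [← mul_inv, ← mul_pow]
    have h1 : κ * (1 + |(m : ℝ)|) ≤ 1 + |s - c * ((n₀ + m : ℤ) : ℝ)| := by
      have hf1 := Int.floor_le (s / c)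
      have hf2 := Int.lt_floor_add_one (s / c)
      rw [← hn₀] at hf1 hf2
      have hs : s - c * ((n₀ + m : ℤ) : ℝ) = c * (s / c - n₀ - m) := by
        push_cast
        field_simp
        ring
      rw [hs, abs_mul, abs_of_pos hc]
      have ht : |(m : ℝ)| - 1 ≤ |s / c - n₀ - m| := by
        have h3 := abs_sub_abs_le_abs_sub (m : ℝ) (s / c - n₀)
        rw [abs_sub_comm (m : ℝ) (s / c - n₀)] at h3
        have h4 : |s / c - n₀| ≤ 1 := abs_le.2 ⟨by linarith, by linarith⟩
        linarith
      have hmin1 : min 1 c ≤ 1 := min_le_left _ _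
      have hmin2 : min 1 c ≤ c := min_le_right _ _
      have hmin0 : 0 < min 1 c := lt_min one_pos hc
      by_cases hm : m = 0
      · subst hm
        simp only [Int.cast_zero, abs_zero, add_zero, mul_one]
        have := mul_nonneg hc.le (abs_nonneg (s / c - n₀ - 0))
        linarith
      · have hm1 : 1 ≤ |(m : ℝ)| := by exact_mod_cast Int.one_le_abs hm
        have h5 : c * (|(m : ℝ)| - 1) ≤ c * |s / c - n₀ - m| :=
          mul_le_mul_of_nonneg_left ht hc.le
        have h6 : min 1 c * (|(m : ℝ)| - 1) ≤ c * (|(m : ℝ)| - 1) :=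
          mul_le_mul_of_nonneg_right hmin2 (by linarith)
        rw [hκ]
        nlinarith
    have h0 : 0 < κ * (1 + |(m : ℝ)|) := by positivity
    exact inv_anti₀ (by positivity) (pow_le_pow_left₀ h0.le h1 2)
  have hs2 : Summable fun m : ℤ => ((1 + |s - c * ((n₀ + m : ℤ) : ℝ)|) ^ 2)⁻¹ :=
    Summable.of_nonneg_of_le (fun m => by positivity) hle hsum
  refine ⟨(Equiv.addLeft n₀).summable_iff.1 hs2, ?_⟩
  rw [← (Equiv.addLeft n₀).tsum_eq]
  exact hs2.tsum_le_tsum hle hsum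

/-- The **Cauchy–Schwarz inequality** for a nonnegative integrable weight and a bounded function. -/
lemma sq_integral_mul_le {α : Type*} [MeasurableSpace α] {μ : Measure α} {G H : α → ℝ}
    (hG : Integrable G μ) (hG0 : ∀ x, 0 ≤ G x) (hGH : Integrable (fun x => G x * H x) μ)
    (hGH2 : Integrable (fun x => G x * H x ^ 2) μ) :
    (∫ x, G x * H x ∂μ) ^ 2 ≤ (∫ x, G x ∂μ) * ∫ x, G x * H x ^ 2 ∂μ := by
  -- The quadratic is `t ↦ ∫ G (H - t)²`, which is nonnegative.
  have h := discrim_le_zero (a := ∫ x, G x ∂μ) (b := -2 * ∫ x, G x * H x ∂μ)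
    (c := ∫ x, G x * H x ^ 2 ∂μ) fun t => by
      have h1 : 0 ≤ ∫ x, (G x * H x ^ 2 - (2 * t) * (G x * H x) + t ^ 2 * G x) ∂μ := by
        refine integral_nonneg fun x => ?_
        have := mul_nonneg (hG0 x) (sq_nonneg (H x - t))
        simp only [Pi.zero_apply]
        nlinarith
      have e : Integrable (fun x => G x * H x ^ 2 - (2 * t) * (G x * H x)) μ :=
        hGH2.sub (hGH.const_mul _)
      rw [integral_add e (hG.const_mul _), integral_sub hGH2 (hGH.const_mul _), integral_const_mul, integral_const_mul] at h1
      linarith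
  rw [discrim] at h
  nlinarith

variable {φ : EuclideanSpace ℝ (Fin d) → ℝ}

/-- The Fourier transform of a compactly supported function reproduces itself under the
correlation with a Schwartz function. -/
lemma exists_schwartz_fourier_eq (hφ : HasCompactSupport φ) (hφ1 : Integrable φ) :
    ∃ g : SchwartzMap (EuclideanSpace ℝ (Fin d)) ℂ, ∀ k,
      FourierTransform.fourier (fun x => (φ x : ℂ)) k =
        ∫ l, g (l - k) * FourierTransform.fourier (fun x => (φ x : ℂ)) l := by
  obtain ⟨R, hR0, hR⟩ := hφ.isCompact.isBounded.exists_pos_norm_le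
  -- A smooth cutoff equal to `1` on the support of `φ` gives `φ = χ φ`. With `ĝ = χ`, moving the
  -- Fourier transform from `g` to the modulated `φ` yields the correlation formula.
  let b : ContDiffBump (0 : EuclideanSpace ℝ (Fin d)) := ⟨R, R + 1, hR0, by linarith⟩
  have hbs : HasCompactSupport fun x => (b x : ℂ) :=
    b.hasCompactSupport.comp_left (g := fun t : ℝ => (t : ℂ)) (by simp)
  have hbc : ContDiff ℝ (⊤ : ℕ∞) fun x => (b x : ℂ) :=
    Complex.ofRealCLM.contDiff.comp b.contDiff
  let χ : SchwartzMap (EuclideanSpace ℝ (Fin d)) ℂ := hbs.toSchwartzMap hbc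
  let g : SchwartzMap (EuclideanSpace ℝ (Fin d)) ℂ := FourierTransformInv.fourierInv χ
  have hg : FourierTransform.fourier (⇑g) = ⇑χ := by
    rw [← SchwartzMap.fourier_coe]
    simp [g]
  refine ⟨g, fun k => ?_⟩
  have hint : Integrable fun x => Complex.exp (-Complex.I *
      ((∑ j, 2 * Real.pi * k j * x j : ℝ) : ℂ)) * (φ x : ℂ) := by
    refine hφ1.ofReal.bdd_mul (c := 1) (Continuous.aestronglyMeasurable (by fun_prop)) ?_
    refine Filter.Eventually.of_forall fun x => ?_
    rw [neg_mul, mul_comm, ← neg_mul, ← Complex.ofReal_neg, Complex.norm_exp_ofReal_mul_I]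
  have h := VectorFourier.integral_fourierIntegral_smul_eq_flip
    (L := innerₗ (EuclideanSpace ℝ (Fin d))) Real.continuous_fourierChar continuous_inner
    (g.integrable (μ := volume)) hint
  rw [flip_innerₗ] at h
  have h' : ∫ x, FourierTransform.fourier (⇑g) x • (Complex.exp (-Complex.I *
      ((∑ j, 2 * Real.pi * k j * x j : ℝ) : ℂ)) * (φ x : ℂ)) =
      ∫ l, g l • FourierTransform.fourier (fun x => Complex.exp (-Complex.I *
      ((∑ j, 2 * Real.pi * k j * x j : ℝ) : ℂ)) * (φ x : ℂ)) l := h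
  rw [hg] at h'
  have hl : ∫ x, χ x • (Complex.exp (-Complex.I *
      ((∑ j, 2 * Real.pi * k j * x j : ℝ) : ℂ)) * (φ x : ℂ)) =
      FourierTransform.fourier (fun x => (φ x : ℂ)) k := by
    rw [fourier_ofReal_eq]
    congr 1
    ext x
    by_cases hx : x ∈ tsupport φ
    · have : χ x = 1 := by
        change (b x : ℂ) = 1
        rw [b.one_of_mem_closedBall (by simpa using hR x hx)]
        simp
      rw [this, one_smul, mul_comm]
    · rw [image_eq_zero_of_notMem_tsupport hx]
      simp
  have hr : ∀ l, FourierTransform.fourier (fun x => Complex.exp (-Complex.I *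
      ((∑ j, 2 * Real.pi * k j * x j : ℝ) : ℂ)) * (φ x : ℂ)) l =
      FourierTransform.fourier (fun x => (φ x : ℂ)) (l + k) := by
    intro l
    rw [fourier_ofReal_eq, Real.fourier_eq']
    congr 1
    ext x
    rw [smul_eq_mul, ← mul_assoc, ← Complex.exp_add, mul_comm]
    congr 2
    rw [PiLp.inner_apply]
    push_cast
    rw [Finset.mul_sum, Finset.mul_sum, Finset.mul_sum, Finset.sum_mul, ← Finset.sum_add_distrib]
    refine Finset.sum_congr rfl fun j _ => ?_
    simp only [RCLike.inner_apply, conj_trivial, PiLp.add_apply]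
    push_cast
    ring
  rw [← hl, h']
  simp_rw [hr, smul_eq_mul]
  rw [← integral_sub_right_eq_self _ k]
  simp

/-- Decay of order `2d + 1` pays for the weight and leaves two powers per coordinate, so the sum is
dominated by a product of one-dimensional sums, bounded uniformly in the shift. -/
lemma exists_sum_schwartz_le (g : SchwartzMap (EuclideanSpace ℝ (Fin d)) ℂ) {c : ℝ} (hc : 0 < c) :
    ∃ M : ℝ, 0 ≤ M ∧ ∀ (l : EuclideanSpace ℝ (Fin d)) (S : Finset (Fin d → ℤ)),
      ∑ n ∈ S, (1 + ‖l - latticeVec c n‖) * ‖g (l - latticeVec c n)‖ ≤ M := by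
  obtain ⟨M₁, hM₁⟩ := exists_tsum_shift_le hc
  have hM₁0 : 0 ≤ M₁ := (tsum_nonneg fun n => by positivity).trans (hM₁ 0).2
  set Cg : ℝ := 2 ^ (2 * d + 1) *
    ((Finset.Iic ((2 * d + 1, 0) : ℕ × ℕ)).sup fun m => SchwartzMap.seminorm ℝ m.1 m.2) g
  have hg : ∀ y, (1 + ‖y‖) ^ (2 * d + 1) * ‖g y‖ ≤ Cg := fun y => by
    have := SchwartzMap.one_add_le_sup_seminorm_apply (𝕜 := ℝ) (m := (2 * d + 1, 0)) le_rfl le_rfl g y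
    simpa using this
  have hCg : 0 ≤ Cg := le_trans (by positivity) (hg 0)
  have hpt : ∀ y : EuclideanSpace ℝ (Fin d),
      (1 + ‖y‖) * ‖g y‖ ≤ Cg * ∏ j, ((1 + |y j|) ^ 2)⁻¹ := by
    intro y
    have hprod : ∏ j, (1 + |y j|) ^ 2 ≤ (1 + ‖y‖) ^ (2 * d) := by
      calc ∏ j, (1 + |y j|) ^ 2 ≤ ∏ _j : Fin d, (1 + ‖y‖) ^ 2 := by
            refine Finset.prod_le_prod (fun j _ => by positivity) fun j _ => ?_
            gcongr
            exact PiLp.norm_apply_le y j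
        _ = _ := by simp [pow_mul]
    rw [Finset.prod_inv_distrib, ← div_eq_mul_inv,
      le_div_iff₀ (Finset.prod_pos fun j _ => by positivity)]
    calc (1 + ‖y‖) * ‖g y‖ * ∏ j, (1 + |y j|) ^ 2
        ≤ (1 + ‖y‖) * ‖g y‖ * (1 + ‖y‖) ^ (2 * d) := by gcongr
      _ = (1 + ‖y‖) ^ (2 * d + 1) * ‖g y‖ := by ring
      _ ≤ Cg := hg y
  refine ⟨Cg * M₁ ^ d, by positivity, fun l S => ?_⟩
  calc ∑ n ∈ S, (1 + ‖l - latticeVec c n‖) * ‖g (l - latticeVec c n)‖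
      ≤ ∑ n ∈ S, Cg * ∏ j, ((1 + |l j - c * n j|) ^ 2)⁻¹ :=
        Finset.sum_le_sum fun n _ => hpt _
    _ = Cg * ∑ n ∈ S, ∏ j, ((1 + |l j - c * n j|) ^ 2)⁻¹ := by rw [Finset.mul_sum]
    _ ≤ Cg * ∏ j, ∑' n : ℤ, ((1 + |l j - c * n|) ^ 2)⁻¹ := by
        gcongr
        exact sum_prod_le_prod_tsum (a := fun j (n : ℤ) => ((1 + |l j - c * n|) ^ 2)⁻¹)
          (fun j n => by positivity) (fun j => (hM₁ (l j)).1) S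
    _ ≤ Cg * ∏ _j : Fin d, M₁ := by
        gcongr with j _
        exact (hM₁ (l j)).2
    _ = Cg * M₁ ^ d := by simp

lemma one_add_sum_abs_le {c : ℝ} (hc : 0 < c) (n : Fin d → ℤ) :
    1 + ∑ j, |(n j : ℝ)| ≤ (1 + d / c) * (1 + ‖latticeVec c n‖) := by
  have h : ∑ j, |(n j : ℝ)| ≤ d / c * ‖latticeVec c n‖ := by
    calc ∑ j, |(n j : ℝ)| ≤ ∑ _j : Fin d, c⁻¹ * ‖latticeVec c n‖ := by
          refine Finset.sum_le_sum fun j _ => ?_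
          have := PiLp.norm_apply_le (latticeVec c n) j
          rw [latticeVec_apply, Real.norm_eq_abs, abs_mul, abs_of_pos hc] at this
          rw [inv_mul_eq_div, le_div_iff₀' hc]
          exact this
      _ = _ := by simp; ring
  have h1 : 0 ≤ d / c := by positivity
  nlinarith [norm_nonneg (latticeVec c n)]

/-- By the correlation formula and Cauchy–Schwarz, `|φ̂(k)|²` is at most a constant times the
integral of `|g(l - k)| |φ̂(l)|²`. Since `1 + |cn| ≤ (1 + |l|)(1 + |l - cn|)`, the weight moves
partly onto `φ̂`, giving the Sobolev integral, and partly onto `g`, whose lattice sums are bounded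
uniformly in `l`. -/
theorem hasSummableFourier_of_memHalfSobolev (hφ : HasCompactSupport φ) (hφ1 : Integrable φ)
    (hS : MemHalfSobolev φ) : HasSummableFourier φ := by
  intro c hc
  obtain ⟨g, hg⟩ := exists_schwartz_fourier_eq hφ hφ1
  obtain ⟨M, hM0, hM⟩ := exists_sum_schwartz_le g hc
  set F := FourierTransform.fourier fun x => (φ x : ℂ) with hF
  have hFc : Continuous F := VectorFourier.fourierIntegral_continuous Real.continuous_fourierChar
    continuous_inner hφ1.ofReal
  have hF0 : ∀ w, ‖F w‖ ≤ ∫ x, ‖(φ x : ℂ)‖ := fun w =>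
    VectorFourier.norm_fourierIntegral_le_integral_norm _ _ _ _ _
  have hw : Integrable fun l => (1 + ‖l‖) * ‖F l‖ ^ 2 := by
    refine (hS.const_mul 2).mono' (Continuous.aestronglyMeasurable (by fun_prop))
      (Filter.Eventually.of_forall fun l => ?_)
    rw [Real.norm_of_nonneg (by positivity), ← mul_assoc]
    gcongr
    have h1 : 1 ≤ √(1 + ‖l‖ ^ 2) := Real.one_le_sqrt.2 (by nlinarith [norm_nonneg l])
    have h2 : ‖l‖ ≤ √(1 + ‖l‖ ^ 2) := Real.le_sqrt_of_sq_le (by linarith)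
    linarith
  set I₀ := ∫ l, ‖g l‖ with hI₀
  have hI₀0 : 0 ≤ I₀ := integral_nonneg fun l => norm_nonneg _
  have hG : ∀ k, Integrable fun l => ‖g (l - k)‖ := fun k => (g.integrable.comp_sub_right k).norm
  have hGF : ∀ k, Integrable fun l => ‖g (l - k)‖ * ‖F l‖ := fun k =>
    (hG k).mul_bdd (c := ∫ x, ‖(φ x : ℂ)‖) (by fun_prop)
      (Filter.Eventually.of_forall fun l => by simpa using hF0 l)
  have hGF2 : ∀ k, Integrable fun l => ‖g (l - k)‖ * ‖F l‖ ^ 2 := fun k =>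
    (hG k).mul_bdd (c := (∫ x, ‖(φ x : ℂ)‖) ^ 2) (Continuous.aestronglyMeasurable (by fun_prop))
      (Filter.Eventually.of_forall fun l => by
        rw [Real.norm_of_nonneg (by positivity)]
        exact pow_le_pow_left₀ (norm_nonneg _) (hF0 l) 2)
  have hpt : ∀ k, ‖F k‖ ^ 2 ≤ I₀ * ∫ l, ‖g (l - k)‖ * ‖F l‖ ^ 2 := by
    intro k
    have h1 : ‖F k‖ ≤ ∫ l, ‖g (l - k)‖ * ‖F l‖ := by
      rw [hg k]
      refine (norm_integral_le_integral_norm _).trans (le_of_eq ?_)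
      simp_rw [norm_mul]
    have h2 : ∫ l, ‖g (l - k)‖ = I₀ := integral_sub_right_eq_self (fun l => ‖g l‖) k
    rw [← h2]
    exact (pow_le_pow_left₀ (norm_nonneg _) h1 2).trans
      (sq_integral_mul_le (hG k) (fun l => norm_nonneg _) (hGF k) (hGF2 k))
  refine summable_of_sum_le (c := I₀ * ((1 + d / c) * (M * ∫ l, (1 + ‖l‖) * ‖F l‖ ^ 2)))
    (fun n => ?_) fun S => ?_
  · exact mul_nonneg (add_nonneg one_pos.le (Finset.sum_nonneg fun j _ => abs_nonneg _))
      (sq_nonneg _)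
  · have hnn : ∀ n : Fin d → ℤ, 0 ≤ 1 + ∑ j, |(n j : ℝ)| := fun n =>
      add_nonneg one_pos.le (Finset.sum_nonneg fun j _ => abs_nonneg _)
    calc ∑ n ∈ S, (1 + ∑ j, |(n j : ℝ)|) * ‖F (latticeVec c n)‖ ^ 2
        ≤ ∑ n ∈ S, (1 + ∑ j, |(n j : ℝ)|) *
            (I₀ * ∫ l, ‖g (l - latticeVec c n)‖ * ‖F l‖ ^ 2) :=
          Finset.sum_le_sum fun n _ => mul_le_mul_of_nonneg_left (hpt _) (hnn n)
      _ = I₀ * ∫ l, ∑ n ∈ S, (1 + ∑ j, |(n j : ℝ)|) *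
            (‖g (l - latticeVec c n)‖ * ‖F l‖ ^ 2) := by
          rw [integral_finsetSum _ fun n _ => (hGF2 _).const_mul _, Finset.mul_sum]
          refine Finset.sum_congr rfl fun n _ => ?_
          rw [integral_const_mul]
          ring
      _ ≤ I₀ * ∫ l, (1 + d / c) * (M * ((1 + ‖l‖) * ‖F l‖ ^ 2)) := by
          refine mul_le_mul_of_nonneg_left (integral_mono
            (integrable_finsetSum _ fun n _ => (hGF2 _).const_mul _)
            ((hw.const_mul _).const_mul _) fun l => ?_) hI₀0
          have hterm : ∀ n : Fin d → ℤ, (1 + ∑ j, |(n j : ℝ)|) *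
              (‖g (l - latticeVec c n)‖ * ‖F l‖ ^ 2) ≤ (1 + d / c) * ((1 + ‖l‖) * ‖F l‖ ^ 2) *
              ((1 + ‖l - latticeVec c n‖) * ‖g (l - latticeVec c n)‖) := by
            intro n
            have h1 : 1 + ‖latticeVec c n‖ ≤ (1 + ‖l‖) * (1 + ‖l - latticeVec c n‖) := by
              have := norm_sub_norm_le (latticeVec c n) l
              rw [norm_sub_rev] at this
              nlinarith [norm_nonneg l, norm_nonneg (l - latticeVec c n)]
            calc _ ≤ ((1 + d / c) * ((1 + ‖l‖) * (1 + ‖l - latticeVec c n‖))) *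
                  (‖g (l - latticeVec c n)‖ * ‖F l‖ ^ 2) := by
                  refine mul_le_mul_of_nonneg_right ((one_add_sum_abs_le hc n).trans ?_)
                    (by positivity)
                  gcongr
              _ = _ := by ring
          calc _ ≤ ∑ n ∈ S, (1 + d / c) * ((1 + ‖l‖) * ‖F l‖ ^ 2) *
                ((1 + ‖l - latticeVec c n‖) * ‖g (l - latticeVec c n)‖) :=
                Finset.sum_le_sum fun n _ => hterm n
            _ ≤ (1 + d / c) * ((1 + ‖l‖) * ‖F l‖ ^ 2) * M := by
                rw [← Finset.mul_sum]
                exact mul_le_mul_of_nonneg_left (hM l S) (by positivity)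
            _ = _ := by ring
      _ = _ := by rw [integral_const_mul, integral_const_mul]

end Sobolev

end

/-! ### Assembly of the proposition. -/

theorem mainTheorem7
    {d r : ℕ} (hr : 0 < r) {ε m : ℝ} (hε : 0 < ε) (hm : 0 < m)
    {φ : EuclideanSpace ℝ (Fin d) → ℝ} {h : (Fin d → ℤ) →₀ ℝ}
    (hφ : IsScalingFunction φ h)
    (hreg : MemHalfSobolev φ ∨ ∃ K : ℕ, 2 ≤ K ∧ IsDaubechiesTensorFilter K h)
    {A : ℕ → Type u} [∀ N, CStarAlgebra (A N)]
    {W : ∀ N, LatticeSpace d r N → A N} (hW : ∀ N, IsWeylAlgebra (W N))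
    {B : Type v} [CStarAlgebra B]
    {Wct : OneParticleSpace d → B} (hWct : IsWeylAlgebra Wct) :
    (∀ N, IsSymplecticMap (scalingMap (r := r) ε h N)) ∧
    (∀ (N : ℕ) (ξ : LatticeSpace d r N),
      Memℓp (oneParticleCoeff (ε * r) m (smearedFun φ ε ξ)) 2) ∧
    (∀ N, IsSymplecticMap (smearingMap (r := r) φ ε m N)) ∧
    (∀ (N : ℕ) (ξ : LatticeSpace d r N),
      smearingMap φ ε m (N + 1) (scalingMap ε h N ξ) = smearingMap φ ε m N ξ) ∧
    ∃ α : ∀ N, A N →⋆ₐ[ℂ] A (N + 1),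
      (∀ N, Function.Injective (α N)) ∧
      (∀ N ξ, α N (W N ξ) = W (N + 1) (scalingMap ε h N ξ)) ∧
      (∃ (C : Type v) (_ : CStarAlgebra C) (ι : ∀ N, A N →⋆ₐ[ℂ] C),
        IsCStarInductiveLimit α ι) ∧
      ∀ {C : Type w} [CStarAlgebra C] (ι : ∀ N, A N →⋆ₐ[ℂ] C),
        IsCStarInductiveLimit α ι →
        ∃ β : C →⋆ₐ[ℂ] B, Function.Injective β ∧
          ∀ N ξ, β (ι N (W N ξ)) = Wct (smearingMap φ ε m N ξ) := by
  have hS : HasSummableFourier φ := by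
    rcases hreg with hreg | ⟨K, hK, hg⟩
    · exact hasSummableFourier_of_memHalfSobolev hφ.compactSupport
        (integrable_of_memLp_two hφ.compactSupport hφ.memLp) hreg
    · exact hasSummableFourier_of_daubechies hφ hK hg
  have hscal := isSymplecticMap_scalingMap (r := r) hφ hS hε hr
  have hsmear := isSymplecticMap_smearingMap (r := r) hφ hS hε hr hm
  have hcomp : ∀ (N : ℕ) (ξ : LatticeSpace d r N),
      smearingMap φ ε m (N + 1) (scalingMap ε h N ξ) = smearingMap φ ε m N ξ :=
    fun N ξ => smearingMap_scalingMap hφ hε hr m ξ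
  choose α hαinj hα using fun N =>
    (hW N).exists_injective_starAlgHom ((hW (N + 1)).isWeylSystem.comp_symplectic (hscal N))
  choose β hβinj hβ using fun N =>
    (hW N).exists_injective_starAlgHom (hWct.isWeylSystem.comp_symplectic (hsmear N))
  -- Both morphisms send `W N ξ` to `Wct` of the same vector, by the compatibility of smearing and
  -- scaling, and generators determine a morphism. This family gives both the existence of the limit
  -- and its embedding into `B`.
  have hβα : ∀ N a, β (N + 1) (α N a) = β N a := by
    intro N a
    have : (β (N + 1)).comp (α N) = β N := (hW N).starAlgHom_ext fun ξ => by
      simp only [StarAlgHom.comp_apply, hα, hβ, Function.comp_apply, hcomp]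
    exact DFunLike.congr_fun this a
  refine ⟨hscal, fun N ξ => memℓp_oneParticleCoeff_smearedFun hφ.compactSupport hφ.memLp hS hε hr
    hm ξ, hsmear, hcomp, α, hαinj, hα, exists_isCStarInductiveLimit hβinj hβα, ?_⟩
  intro C _ ι hι
  obtain ⟨γ, hγinj, hγ⟩ := hι.exists_injective_lift hβinj hβα
  exact ⟨γ, hγinj, fun N ξ => by rw [hγ, hβ, Function.comp_apply]⟩
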